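/- **Definitions.** An (abstract) Gauss diagram $G$ consists of two finite families $\mathcal M^{+},\mathcal M^{-}$ of disjoint oriented circles (possibly of different sizes) and finitely many chords with signs $\pm$, each joining a point of a circle of $\mathcal M^{+}$ to a point of a circle of $\mathcal M^{-}$, the chord ends being distinct; it is considered up to orientation-preserving homeomorphisms of the circles. We also write $G$ for the graph whose vertices are the chord ends (and one auxiliary point on each circle without chords) and whose edges are the chords and the arcs into which the vertices cut the circles, the arcs being oriented as the circles. The *ribbon graph* $\Gamma(G)$ is the oriented surface obtained from the annuli $\mu\times[-1,1]$, $\mu\in\mathcal M^{\pm}$, by gluing, for each chord, the squares around its two ends crosswise by an orientation-preserving homeomorphism, such that at the crossing point the pair (direction of the circle of $\mathcal M^{+}$, direction of the circle of $\mathcal M^{-}$) is a positive frame if and only if the chord is positive. A *cycle* of $G$ is the closed sequence of arcs, each traversed along or against its orientation, followed by a boundary component of $\Gamma(G)$. The diagram is taken with all cycles colored differently, which means that the *associated surface* $S$ is obtained by gluing a separate disc to each boundary component of $\Gamma(G)$. The *associated manifold* $M$ is obtained from $S\times[-1,1]$ by attaching a 2-handle along each circle of $\mathcal M^{+}$ in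 $S\times\{1\}$ and along each circle of $\mathcal M^{-}$ in $S\times\{-1\}$, and then gluing a 3-ball to every boundary component that is a 2-sphere. The graph $G$ is mapped to $S\times\{0\}\subset M$ by mapping the arcs to the cores of the ribbons and contracting every chord to the corresponding crossing point. **Proposition.** Let $G$ be a connected abstract Gauss diagram with all cycles colored differently, let $M$ be the associated manifold, and let $T$ be a maximal tree of the graph $G$ that contains all chords. Let $v_0$ be a vertex of $G$. Then $\pi_1(M,v_0)$ has the following presentation. * The generators are the edges of $G-T$. The edge $e$ represents the class of the loop that goes from $v_0$ to the beginning of $e$ in $T$, then along $e$, then back to $v_0$ in $T$. * There is one relator for each cycle of $G$ and one for each circle of $\mathcal M^{+}$ and of $\mathcal M^{-}$. The relator is the word read when the cycle (respectively the oriented circle) is traversed once from an arbitrarily chosen starting place, writing only the edges in $G-T$: $e$ when the edge $e$ is traversed along its orientation, and $e^{-1}$ when it is traversed against it. -/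

import Mathlib

/-! ### Adjunction spaces and trees -/

/-- The gluing relation of the adjunction space: every `b ∈ A ⊆ B` is glued to `f b ∈ X`. -/
inductive AttachRel {X B : Type*} (A : Set B) (f : B → X) : X ⊕ B → X ⊕ B → Prop
  | glue (b : B) (hb : b ∈ A) : AttachRel A f (Sum.inr b) (Sum.inl (f b))

/-- The adjunction space `X ∪_f B`, with `B` attached to `X` along `f : A → X`, `A ⊆ B`
(only the values of `f` on `A` matter), with the quotient topology. -/
def Attach {X B : Type*} (A : Set B) (f : B → X) : Type _ := Quot (AttachRel A f)

namespace Attach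

variable {X B : Type*} (A : Set B) (f : B → X)

instance [TopologicalSpace X] [TopologicalSpace B] : TopologicalSpace (Attach A f) :=
  inferInstanceAs (TopologicalSpace (Quot (AttachRel A f)))

/-- The canonical map of the space to which something is attached. -/
def old (x : X) : Attach A f := Quot.mk _ (Sum.inl x)

/-- The canonical map of the attached piece. -/
def new (b : B) : Attach A f := Quot.mk _ (Sum.inr b)

theorem continuous_old [TopologicalSpace X] [TopologicalSpace B] : Continuous (old A f) :=
  continuous_quot_mk.comp continuous_inl

end Attach

/-- Two vertices of a multigraph joined by a walk that uses only edges from `F`. -/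
def JoinedVia {V E : Type*} (Γ : Graph V E) (F : Set E) (u v : V) : Prop :=
  Relation.ReflTransGen (fun a b => ∃ e ∈ F, Γ.IsLink e a b) u v

/-- A tree: a nonempty connected multigraph without circuits (no edge has its two ends
joined by a walk avoiding that edge; in particular there are no loops or multiple edges). -/
structure IsTreeGraph {V E : Type*} (Γ : Graph V E) : Prop where
  nonempty : Γ.vertexSet.Nonempty
  connected : ∀ u ∈ Γ.vertexSet, ∀ v ∈ Γ.vertexSet, JoinedVia Γ Set.univ u v
  acyclic : ∀ e u v, Γ.IsLink e u v → ¬ JoinedVia Γ {e}ᶜ u v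

/-- A maximal tree of a multigraph: a maximal element among its subgraphs that are trees. -/
def IsMaximalTree {V E : Type*} (Γ T : Graph V E) : Prop :=
  Maximal (fun T' : Graph V E => T' ≤ Γ ∧ IsTreeGraph T') T

/-! ### Gauss diagrams -/

/-- An (abstract) Gauss diagram: two families of oriented circles (the family `𝓜⁺` has index
`true`, the family `𝓜⁻` has index `false`), and signed chords, each joining a point of a circle
of `𝓜⁺` to a point of a circle of `𝓜⁻`, recorded up to homeomorphism of the circles.

There are `n` chords. Each chord has exactly one end in each family. `next σ h` is the
chord whose end is met right after that of `h` when one follows the orientation of the circle of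
family `σ` that carries the end of `h`; so the circles of family `σ` with at least one chord end
are the cycles (fixed points included) of the permutation `next σ`. Besides them, family
`σ` has `bubbles σ` circles without chords. -/
structure GaussDiagram where
  n : ℕ
  next : Bool → Equiv.Perm (Fin n)
  bubbles : Bool → ℕ
  positive : Fin n → Bool

namespace GaussDiagram

variable (G : GaussDiagram)

/-- The marked points on the circles of family `σ`: the chord ends, and one auxiliary
point on each circle without chords. -/
abbrev Site (σ : Bool) : Type := Fin G.n ⊕ Fin (G.bubbles σ)

/-- The next marked point along the oriented circle. -/
def succ (σ : Bool) : Equiv.Perm (G.Site σ) := Equiv.sumCongr (G.next σ) (Equiv.refl _)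

/-- The circles of family `σ`, with and without chords. -/
def Circle (σ : Bool) : Type := Quotient (Equiv.Perm.SameCycle.setoid (G.succ σ))

/-- The vertices of the diagram regarded as a graph. -/
abbrev Vertex : Type := Σ σ : Bool, G.Site σ

/-- The edges of the diagram regarded as a graph: `Sum.inl v` is the arc of a circle from the
marked point `v` to the next one, `Sum.inr h` is the chord `h`. -/
abbrev Edge : Type := G.Vertex ⊕ Fin G.n

/-- The marked point following `v` on its circle. -/
def after (v : G.Vertex) : G.Vertex := ⟨v.1, G.succ v.1 v.2⟩

/-- The end of the chord `h` on the circle of family `σ`. -/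
def chordEnd (h : Fin G.n) (σ : Bool) : G.Vertex := ⟨σ, Sum.inl h⟩

/-- Initial vertex of an edge (a chord is directed from `𝓜⁺` to `𝓜⁻`). -/
def src : G.Edge → G.Vertex
  | Sum.inl v => v
  | Sum.inr h => G.chordEnd h true

/-- Terminal vertex of an edge. -/
def tgt : G.Edge → G.Vertex
  | Sum.inl v => G.after v
  | Sum.inr h => G.chordEnd h false

/-- The Gauss diagram as a (multi)graph. -/
def graph : Graph G.Vertex G.Edge where
  vertexSet := Set.univ
  edgeSet := Set.univ
  IsLink e u v := (u = G.src e ∧ v = G.tgt e) ∨ (u = G.tgt e ∧ v = G.src e)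
  isLink_symm e _ := ⟨fun u v h => by tauto⟩
  eq_or_eq_of_isLink_of_isLink e u v x y h₁ h₂ := by
    rcases h₁ with ⟨rfl, rfl⟩ | ⟨rfl, rfl⟩ <;> rcases h₂ with ⟨rfl, rfl⟩ | ⟨rfl, rfl⟩ <;> simp
  edge_mem_iff_exists_isLink e := by
    simp only [Set.mem_univ, true_iff]
    exact ⟨G.src e, G.tgt e, Or.inl ⟨rfl, rfl⟩⟩
  left_mem_of_isLink _ _ _ _ := Set.mem_univ _

/-- The diagram is connected (as a graph, hence so is its ribbon graph). -/
def Connected : Prop :=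
  Nonempty G.Vertex ∧ ∀ u v : G.Vertex, JoinedVia G.graph Set.univ u v

/-! ### Cycles: the right turn rule -/

/-- A side of an arc with its direction as a piece of boundary of the ribbon graph:
`(v, true)` is the right side of the arc starting at `v`, traversed along the arc, and
`(v, false)` is its left side, traversed against the arc. -/
abbrev Dart : Type := G.Vertex × Bool

/-- Right turn rule for the direction of travel: arriving at a chord of sign `pos` along
(`α = true`) or against (`α = false`) a circle of family `σ`, one leaves along or against the
circle of the other family. -/
def turnDir (σ pos α : Bool) : Bool := xor (xor α pos) (!σ)

/-- The side of an arc that comes after the given one in the boundary of the ribbon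
graph. At a chord one passes to the other family, leaving by the outgoing arc
(travelling along it) or by the incoming arc (travelling against it). The boundary of the annulus
of a circle without chords closes up. -/
def turnFun : G.Dart → G.Dart
  | (⟨σ, Sum.inl h⟩, α) =>
      let p := if α then G.next σ h else h
      let β := turnDir σ (G.positive p) α
      (⟨!σ, Sum.inl (if β then p else (G.next (!σ)).symm p)⟩, β)
  | (⟨σ, Sum.inr b⟩, α) => (⟨σ, Sum.inr b⟩, α)

/-- The inverse of `turnFun`. -/
def turnInv : G.Dart → G.Dart
  | (⟨σ, Sum.inl h⟩, β) =>
      let p := if β then h else G.next σ h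
      let α := turnDir σ (!(G.positive p)) β
      (⟨!σ, Sum.inl (if α then (G.next (!σ)).symm p else p)⟩, α)
  | (⟨σ, Sum.inr b⟩, α) => (⟨σ, Sum.inr b⟩, α)

/-- The right turn rule as a permutation of the sides of arcs. -/
def turn : Equiv.Perm G.Dart where
  toFun := G.turnFun
  invFun := G.turnInv
  left_inv := by
    rintro ⟨⟨_ | _, h | b⟩, _ | _⟩
    · cases hp : G.positive h <;> simp [turnFun, turnInv, turnDir, hp]
    · cases hp : G.positive (G.next false h) <;> simp [turnFun, turnInv, turnDir, hp]
    · rfl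
    · rfl
    · cases hp : G.positive h <;> simp [turnFun, turnInv, turnDir, hp]
    · cases hp : G.positive (G.next true h) <;> simp [turnFun, turnInv, turnDir, hp]
    · rfl
    · rfl
  right_inv := by
    rintro ⟨⟨_ | _, h | b⟩, _ | _⟩
    · cases hp : G.positive (G.next false h) <;> simp [turnFun, turnInv, turnDir, hp]
    · cases hp : G.positive h <;> simp [turnFun, turnInv, turnDir, hp]
    · rfl
    · rfl
    · cases hp : G.positive (G.next true h) <;> simp [turnFun, turnInv, turnDir, hp]
    · cases hp : G.positive h <;> simp [turnFun, turnInv, turnDir, hp]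
    · rfl
    · rfl

/-- The cycles of the diagram, in bijection with the boundary components of the ribbon graph. -/
def Cycle : Type := Quotient (Equiv.Perm.SameCycle.setoid G.turn)

/-! ### The ribbon graph -/

/-- The annuli `circle × [-1,1]`, cut at one place between any two consecutive
marked points: the strip of `v` is `[-1,3] × [-1,1]`; the first coordinate runs along the
circle, which sits at height `0` with `v` at `(0, 0)`. For a chord end,
`[-1,1] × [-1,1]` is the neighbourhood that is going to be glued to the one of the other end,
and `[1,3] × [-1,1]` is the ribbon along the arc from `v` to the next marked point. -/
abbrev Strips : Type := Σ _ : G.Vertex, Set.Icc (-1 : ℝ) 3 × Set.Icc (-1 : ℝ) 1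

/-- The sign of a chord as a real number. -/
def sgn (h : Fin G.n) : ℝ := if G.positive h then 1 else -1

/-- The identifications that make the ribbon graph out of the strips.
`seam` reassembles the annuli. `coupon` glues the squares around the two ends of a chord
crosswise by a rotation (so preserving orientation): in the coordinates `(x, y)` of the square
of the end in `𝓜⁺`, the circle of `𝓜⁺` runs in the positive `x` direction, and the circle of `𝓜⁻`
runs in the positive `y` direction for a positive chord, in the negative one for a negative
chord. -/
inductive RibbonRel : G.Strips → G.Strips → Prop
  | seam (v : G.Vertex) (y : Set.Icc (-1 : ℝ) 1) :
      RibbonRel ⟨v, ⟨3, by norm_num⟩, y⟩ ⟨G.after v, ⟨-1, by norm_num⟩, y⟩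
  | coupon (h : Fin G.n) (x x' : Set.Icc (-1 : ℝ) 3) (y y' : Set.Icc (-1 : ℝ) 1)
      (hx : (x' : ℝ) = G.sgn h * y) (hy : (y' : ℝ) = -(G.sgn h * x)) :
      RibbonRel ⟨G.chordEnd h true, x, y⟩ ⟨G.chordEnd h false, x', y'⟩

/-- The ribbon graph of the diagram: an oriented compact surface with boundary. -/
def Ribbon : Type := Quot G.RibbonRel

instance : TopologicalSpace G.Ribbon := inferInstanceAs (TopologicalSpace (Quot G.RibbonRel))

/-- The point with coordinates `(x, y) ∈ [-1,3] × [-1,1]` of the strip of `v`. -/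
noncomputable def strip (v : G.Vertex) (x y : ℝ) : G.Ribbon :=
  Quot.mk _ ⟨v, Set.projIcc (-1) 3 (by norm_num) x, Set.projIcc (-1) 1 (by norm_num) y⟩

/-- The first coordinate of the beginning of the ribbon: it is `1`, except on the annulus of a
circle without chords, where the whole strip serves as the ribbon. -/
def ribbonStart (v : G.Vertex) : ℝ := Sum.elim (fun _ => 1) (fun _ => -1) v.2

/-- Parametrization by `t ∈ [0,1]` of a side of an arc, in the direction of travel. -/
noncomputable def side (d : G.Dart) (t : ℝ) : G.Ribbon :=
  if d.2 then G.strip d.1 (G.ribbonStart d.1 + t * (3 - G.ribbonStart d.1)) (-1)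
  else G.strip d.1 (3 - t * (3 - G.ribbonStart d.1)) 1

/-- The walk along the boundary component of the ribbon graph, starting with the side `d` at time
`0`, one side per unit of time. -/
noncomputable def boundaryWalk (d : G.Dart) (t : ℝ) : G.Ribbon :=
  G.side ((G.turn ^ ⌊t⌋) d) (Int.fract t)

/-! ### The associated surface -/

/-- The closed unit disc. -/
abbrev Disc : Type := Metric.closedBall (0 : ℂ) 1

/-- The parameter in a cyclic walk of length `k` of a point of the unit circle. -/
noncomputable def angle (k : ℕ) (z : ℂ) : ℝ := k * (Complex.arg z / (2 * Real.pi))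

/-- The attaching map of the disc of the cycle `c`: its boundary circle goes once
around the boundary component of the ribbon graph that corresponds to `c`. -/
noncomputable def cycleAttach (b : Σ _ : G.Cycle, Disc) : G.Ribbon :=
  let d : G.Dart := Quotient.out b.1
  G.boundaryWalk d (angle (Function.minimalPeriod G.turn d) b.2)

/-- The closed surface associated with the diagram with all cycles coloured differently: a disc is
glued to each boundary component of the ribbon graph. -/
noncomputable def Surface : Type := Attach {b : Σ _ : G.Cycle, Disc | ‖(b.2 : ℂ)‖ = 1} G.cycleAttach

instance : TopologicalSpace G.Surface := inferInstanceAs (TopologicalSpace (Attach _ _))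

/-- The inclusion of the ribbon graph in the surface. -/
noncomputable def ribbonToSurface : G.Ribbon → G.Surface := Attach.old _ _

/-! ### The associated manifold -/

/-- The point at parameter `t` and height `y` of the annulus around the circle that
passes through the marked point `v`, starting with the strip of `v`,
one strip per unit of time. -/
noncomputable def annulusWalk {σ : Bool} (s : G.Site σ) (t y : ℝ) : G.Ribbon :=
  G.strip ⟨σ, (G.succ σ ^ ⌊t⌋) s⟩ (-1 + 4 * Int.fract t) y

/-- All circles, of both families. -/
abbrev Circles : Type := Σ σ : Bool, G.Circle σ

/-- The 2-handles `D² × [-1,1]`, one for each circle. -/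
abbrev Handles : Type := Σ _ : G.Circles, Disc × Set.Icc (-1 : ℝ) 1

/-- Circles of `𝓜⁺` are placed on `S × {1}`, circles of `𝓜⁻` on `S × {-1}`. -/
def level (σ : Bool) : Set.Icc (-1 : ℝ) 1 :=
  if σ then ⟨1, by norm_num⟩ else ⟨-1, by norm_num⟩

/-- The attaching map of the 2-handles: `S¹ × [-1,1]` goes to the annulus
around the circle, at the level of its family. -/
noncomputable def handleAttach (b : G.Handles) : G.Surface × Set.Icc (-1 : ℝ) 1 :=
  let s : G.Site b.1.1 := Quotient.out b.1.2
  (G.ribbonToSurface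
    (G.annulusWalk s (angle (Function.minimalPeriod (G.succ b.1.1) s) b.2.1) b.2.2),
    level b.1.1)

/-- The collar `S × [-1,1]` of the surface with all the 2-handles attached. -/
noncomputable def Body : Type := Attach {b : G.Handles | ‖(b.2.1 : ℂ)‖ = 1} G.handleAttach

instance : TopologicalSpace G.Body := inferInstanceAs (TopologicalSpace (Attach _ _))

/-- The inclusion of the collar. -/
noncomputable def collarToBody : G.Surface × Set.Icc (-1 : ℝ) 1 → G.Body := Attach.old _ _

/-- The interiors of the annuli around the circles of family `σ`, as a subset of the surface. -/
def openAnnuli (σ : Bool) : Set G.Surface :=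
  {p | ∃ (s : G.Site σ) (x y : ℝ), x ∈ Set.Icc (-1) 3 ∧ y ∈ Set.Ioo (-1) 1 ∧
    p = G.ribbonToSurface (G.strip ⟨σ, s⟩ x y)}

/-- The part of the boundary of `S × [-1,1] ∪ (2-handles)` on the side of family `σ`, that is,
the result of surgery on the surface along the circles of this family: the surface at the level
of `σ` outside the annuli, and the two discs `D² × {-1, 1}` of each handle. -/
def bodyBoundary (σ : Bool) : Set G.Body :=
  {q | (∃ p : G.Surface, p ∉ G.openAnnuli σ ∧ q = G.collarToBody (p, level σ)) ∨
    ∃ (c : G.Circle σ) (z : Disc) (y : Set.Icc (-1 : ℝ) 1),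
      ((y : ℝ) = 1 ∨ (y : ℝ) = -1) ∧ q = Attach.new _ _ ⟨⟨σ, c⟩, z, y⟩}

/-- The unit sphere in `ℝ³`. -/
abbrev Sphere2 : Type := Metric.sphere (0 : EuclideanSpace ℝ (Fin 3)) 1

/-- The closed unit ball in `ℝ³`. -/
abbrev Ball3 : Type := Metric.closedBall (0 : EuclideanSpace ℝ (Fin 3)) 1

/-- `K` is a spherical component of the boundary of the body. -/
def IsSphericalComponent (K : Set G.Body) : Prop :=
  (∃ σ, ∃ q ∈ G.bodyBoundary σ, K = connectedComponentIn (G.bodyBoundary σ) q) ∧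
    Nonempty (Sphere2 ≃ₜ K)

/-- The spherical components of the boundary of the body. -/
abbrev SphericalComponent : Type := {K : Set G.Body // G.IsSphericalComponent K}

/-- The attaching map of the 3-balls, one for each spherical boundary component
`K`: the boundary sphere of the ball is glued to `K` by a homeomorphism. (The value on the interior
of the ball is irrelevant.) -/
noncomputable def ballAttach (b : Σ _ : G.SphericalComponent, Ball3) : G.Body :=
  open Classical in
  if hb : ‖(b.2 : EuclideanSpace ℝ (Fin 3))‖ = 1 then
    (b.1.2.2.some ⟨b.2, by simpa using hb⟩ : b.1.1)
  else b.1.2.1.choose_spec.choose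

/-- The 3-manifold associated with the diagram with all cycles coloured differently: attach 2-handles
to the collar `S × [-1,1]` of the associated surface `S`, along the circles of `𝓜⁺` in `S × {1}` and
the circles of `𝓜⁻` in `S × {-1}`, and fill the spherical boundary components with 3-balls. -/
noncomputable def Manifold : Type :=
  Attach {b : Σ _ : G.SphericalComponent, Ball3 | ‖(b.2 : EuclideanSpace ℝ (Fin 3))‖ = 1}
    G.ballAttach

instance : TopologicalSpace G.Manifold := inferInstanceAs (TopologicalSpace (Attach _ _))

/-! ### The graph of the diagram inside the manifold -/

/-- The ribbon graph as a subspace of `S × {0}` in the manifold. -/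
noncomputable def ribbonToManifold (r : G.Ribbon) : G.Manifold :=
  Attach.old _ _ (G.collarToBody (G.ribbonToSurface r, ⟨0, by norm_num⟩))

theorem continuous_ribbonToManifold : Continuous G.ribbonToManifold :=
  (Attach.continuous_old _ _).comp <| (Attach.continuous_old _ _).comp <|
    (Attach.continuous_old _ _).prodMk continuous_const

theorem continuous_strip (v : G.Vertex) (y : ℝ) : Continuous fun x => G.strip v x y :=
  continuous_quot_mk.comp <| continuous_sigmaMk.comp <|
    continuous_projIcc.prodMk continuous_const

theorem strip_seam (v : G.Vertex) : G.strip v 3 0 = G.strip (G.after v) (-1) 0 := by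
  have := Quot.sound (RibbonRel.seam (G := G) v (Set.projIcc (-1) 1 (by norm_num) 0))
  have h3 : max (-1 : ℝ) 3 = 3 := max_eq_right (by norm_num)
  simp only [strip, Set.projIcc] at this ⊢
  simpa [h3, Ribbon] using this

theorem strip_chord (h : Fin G.n) :
    G.strip (G.chordEnd h true) 0 0 = G.strip (G.chordEnd h false) 0 0 :=
  Quot.sound (RibbonRel.coupon h _ _ _ _ (by simp [Set.projIcc]) (by simp [Set.projIcc]))

/-- The point of the manifold that corresponds to the vertex `v`. The two ends of a chord
give the same point: chords are contracted in the core of the ribbon graph. -/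
noncomputable def point (v : G.Vertex) : G.Manifold := G.ribbonToManifold (G.strip v 0 0)

/-- The path in the manifold along the arc of a circle from `v` to the next marked point. -/
noncomputable def arcPath (v : G.Vertex) : Path (G.point v) (G.point (G.after v)) :=
  let p : Path (G.strip v 0 0) (G.strip v 3 0) :=
    { toFun := fun t => G.strip v (3 * t) 0
      continuous_toFun := (G.continuous_strip v 0).comp (by fun_prop)
      source' := by simp
      target' := by simp }
  let q : Path (G.strip (G.after v) (-1) 0) (G.strip (G.after v) 0 0) :=
    { toFun := fun t => G.strip (G.after v) (-1 + t) 0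
      continuous_toFun := (G.continuous_strip _ 0).comp (by fun_prop)
      source' := by simp
      target' := by simp }
  (p.trans (q.cast (G.strip_seam v) rfl)).map G.continuous_ribbonToManifold

/-- The path in the manifold along an edge of the diagram; it is constant for chords. -/
noncomputable def edgePath : (e : G.Edge) → Path (G.point (G.src e)) (G.point (G.tgt e))
  | Sum.inl v => G.arcPath v
  | Sum.inr h => (Path.refl (G.point (G.chordEnd h true))).cast rfl
      (congrArg G.ribbonToManifold (G.strip_chord h)).symm

/-! ### The presentation -/

variable (T : Graph G.Vertex G.Edge)

/-- The letter written for an edge: a generator if the edge is not in `T`, nothing otherwise. -/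
noncomputable def letter (e : G.Edge) : FreeGroup {e : G.Edge // e ∉ T.edgeSet} :=
  open Classical in if he : e ∈ T.edgeSet then 1 else FreeGroup.of ⟨e, he⟩

/-- The word read along the cycle that starts with the side `d`: the arcs are
recorded with exponent `1` or `-1` according to the direction in which they are traversed.
(The chords passed at the turns lie in `T` and contribute nothing.) -/
noncomputable def cycleWord (d : G.Dart) : FreeGroup {e : G.Edge // e ∉ T.edgeSet} :=
  ((List.range (Function.minimalPeriod G.turn d)).map fun i =>
    G.letter T (Sum.inl ((G.turn ^ i) d).1) ^ (if ((G.turn ^ i) d).2 then (1 : ℤ) else -1)).prod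

/-- The word read along the oriented circle that passes through `s`, starting at `s`. -/
noncomputable def circleWord {σ : Bool} (s : G.Site σ) :
    FreeGroup {e : G.Edge // e ∉ T.edgeSet} :=
  ((List.range (Function.minimalPeriod (G.succ σ) s)).map fun i =>
    G.letter T (Sum.inl ⟨σ, (G.succ σ ^ i) s⟩)).prod

/-- The relators: one for each cycle and one for each circle, read from the given
starting places. -/
def relators (a : G.Cycle → G.Dart) (b : ∀ σ, G.Circle σ → G.Site σ) :
    Set (FreeGroup {e : G.Edge // e ∉ T.edgeSet}) :=
  Set.range (fun c => G.cycleWord T (a c)) ∪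
    Set.range (fun c : G.Circles => G.circleWord T (b c.1 c.2))

end GaussDiagram

section

open Topology unitInterval

/-! The ribbon graph retracts onto `G` with its chords contracted. As `T` is a spanning tree
containing the chords, its fundamental group is free on the edges outside `T`. The disc of a cycle
kills the loop read along that cycle, the thickening to S × [-1,1] changes nothing, a 2-handle kills
its circle, and a 3-ball, being attached along a simply connected sphere, changes nothing.

The proof does van Kampen's argument by hand, without computing the groups of the intermediate
spaces. Its tool is a holonomy, a functor from the fundamental groupoid to a group. Sending each
generator to its loop through `T` gives a homomorphism φ from the presented group to π₁, because the
walk of each relator bounds in a disc or a handle (`cycle_word_eq_one`, `circle_word_eq_one`).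

Surjectivity: let H be the range of φ. The base coset of π₁/H is fixed by the loops of all arcs, so
it spreads to a function on the ribbon graph that is equivariant along paths (`exists_flat_ribbon`).
Such a function extends over any cell with path connected boundary (`Cell.exists_flat_extension`),
hence to the manifold. The holonomy of a loop at the base point therefore fixes the base coset, that
is, lies in H (`val_mem`).

Injectivity: the ribbon graph carries a local system whose structure group is the presented group
and whose transport along an arc is the letter of the arc. The relators make it trivial on the
attaching regions of the discs and handles, and on a sphere every local system is trivial, so it
extends to the manifold (`Cell.exists_locSys_extension`, `exists_locSys_manifold`). Its holonomy is
a left inverse of φ. -/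

instance unitInterval.contractibleSpace : ContractibleSpace I :=
  (convex_Icc (0 : ℝ) 1).contractibleSpace ⟨0, by simp⟩

instance unitInterval.locallyPathConnectedSpace : LocallyPathConnectedSpace I :=
  (convex_Icc (0 : ℝ) 1).locallyPathConnectedSpace

/-! ### Holonomies -/

/-- A functor from the fundamental groupoid of `Y` to the group `Q`. -/
structure Holonomy (Y : Type*) [TopologicalSpace Y] (Q : Type*) [Group Q] where
  val : ∀ {x y : Y}, Path x y → Q
  val_trans : ∀ {x y z : Y} (p : Path x y) (q : Path y z), val (p.trans q) = val p * val q
  val_homotopic : ∀ {x y : Y} {p q : Path x y}, p.Homotopic q → val p = val q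

namespace Holonomy

variable {X Y Z W Q S : Type*} [TopologicalSpace X] [TopologicalSpace Y] [TopologicalSpace Z]
  [TopologicalSpace W] [Group Q] [MulAction Q S] (R : Holonomy Y Q)

theorem val_refl (y : Y) : R.val (Path.refl y) = 1 := by
  have h := R.val_trans (Path.refl y) (Path.refl y)
  rw [Path.refl_trans_refl] at h
  simpa using h

theorem val_cast {x y x' y' : Y} (p : Path x y) (hx : x' = x) (hy : y' = y) :
    R.val (p.cast hx hy) = R.val p := by
  subst hx hy; rfl

/-- The holonomy of a path of `Z` from `z` to `w`, mapped to `Y`. This is independent of the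
path if `Z` is simply connected. -/
noncomputable def along [PathConnectedSpace Z] (g : C(Z, Y)) (z w : Z) : Q :=
  R.val ((PathConnectedSpace.somePath z w).map g.continuous)

section

variable [SimplyConnectedSpace Z] (g : C(Z, Y))

theorem val_map {z w : Z} (p : Path z w) : R.val (p.map g.continuous) = R.along g z w :=
  R.val_homotopic ((SimplyConnectedSpace.paths_homotopic p _).map g)

theorem along_self (z : Z) : R.along g z z = 1 := by
  rw [← R.val_map g (Path.refl z)]
  exact R.val_refl (g z)

theorem along_trans (z w v : Z) : R.along g z w * R.along g w v = R.along g z v := by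
  rw [← R.val_map g ((PathConnectedSpace.somePath z w).trans (PathConnectedSpace.somePath w v)),
    Path.map_trans, R.val_trans]
  rfl

theorem along_symm (z w : Z) : (R.along g z w)⁻¹ = R.along g w z := by
  rw [inv_eq_iff_mul_eq_one, along_trans, along_self]

theorem along_comp [SimplyConnectedSpace W] (h : C(W, Z)) (w w' : W) :
    R.along (g.comp h) w w' = R.along g (h w) (h w') :=
  R.val_map g ((PathConnectedSpace.somePath w w').map h.continuous)

theorem along_eq_one_of_const (h : ∀ z w, g z = g w) (z w : Z) : R.along g z w = 1 := by
  have : g = (ContinuousMap.const Unit (g z)).comp (ContinuousMap.const Z ()) :=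
    ContinuousMap.ext fun w => h w z
  rw [this, along_comp]
  exact along_self _ _ _

end

theorem val_eq_along {x y : Y} (p : Path x y) : R.val p = R.along p.toContinuousMap 0 1 := by
  let q : Path (0 : I) 1 := ⟨ContinuousMap.id I, rfl, rfl⟩
  rw [← R.val_map _ q, ← R.val_cast _ p.source.symm p.target.symm]
  rfl

/-- The restriction of a holonomy along a continuous map. -/
def comap (f : C(X, Y)) : Holonomy X Q where
  val p := R.val (p.map f.continuous)
  val_trans p q := by rw [Path.map_trans, R.val_trans]
  val_homotopic h := R.val_homotopic (h.map f)

theorem comap_along [PathConnectedSpace Z] (f : C(X, Y)) (g : C(Z, X)) (z w : Z) :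
    (R.comap f).along g z w = R.along (f.comp g) z w := rfl

/-- The four sides of a square. -/
theorem along_square (h : C(I × I, Y)) (g₀ g₁ v₀ v₁ : C(I, Y)) (h₀ : ∀ t, g₀ t = h (t, 0))
    (h₁ : ∀ t, g₁ t = h (t, 1)) (h₂ : ∀ t, v₀ t = h (0, t)) (h₃ : ∀ t, v₁ t = h (1, t)) :
    R.along g₀ 0 1 * R.along v₁ 0 1 = R.along v₀ 0 1 * R.along g₁ 0 1 := by
  have e₀ : g₀ = h.comp ⟨fun t => (t, 0), by fun_prop⟩ := ContinuousMap.ext h₀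
  have e₁ : g₁ = h.comp ⟨fun t => (t, 1), by fun_prop⟩ := ContinuousMap.ext h₁
  have e₂ : v₀ = h.comp ⟨fun t => (0, t), by fun_prop⟩ := ContinuousMap.ext h₂
  have e₃ : v₁ = h.comp ⟨fun t => (1, t), by fun_prop⟩ := ContinuousMap.ext h₃
  rw [e₀, e₁, e₂, e₃, along_comp, along_comp, along_comp, along_comp]
  simp only [ContinuousMap.coe_mk]
  rw [along_trans, along_trans]

/-- A function that is equivariantly constant along all paths. -/
def Flat (N : Y → S) : Prop := ∀ γ : C(I, Y), N (γ 0) = R.along γ 0 1 • N (γ 1)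

/-- Flatness can be checked locally. -/
theorem flat_of_local {N : Y → S} (h : ∀ y, ∃ O ∈ 𝓝 y, ∀ γ : C(I, Y), (∀ t, γ t ∈ O) →
    N (γ 0) = R.along γ 0 1 • N (γ 1)) : R.Flat N := by
  intro γ
  -- The value at time t, transported back to time 0, is locally constant on the connected interval,
  -- hence constant.
  have key : IsLocallyConstant fun t => R.along γ 0 t • N (γ t) := by
    rw [IsLocallyConstant.iff_eventually_eq]
    intro t₀
    obtain ⟨O, hO, hflat⟩ := h (γ t₀)
    obtain ⟨U, ⟨hU, hUc⟩, hUO⟩ :=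
      (path_connected_basis t₀).mem_iff.1 (γ.continuous.continuousAt.preimage_mem_nhds hO)
    filter_upwards [hU] with t ht
    obtain ⟨p, hp⟩ := hUc.joinedIn t₀ (mem_of_mem_nhds hU) t ht
    have := hflat (γ.comp p.toContinuousMap) fun s => hUO (hp s)
    rw [R.along_comp] at this
    simp only [ContinuousMap.comp_apply, Path.coe_toContinuousMap, p.source, p.target] at this
    rw [← R.along_trans γ 0 t₀ t, mul_smul, this]
  have := key.apply_eq_of_preconnectedSpace 0 1
  simpa [R.along_self] using this

/-- Transfer of flatness along a homotopy. -/
theorem flat_of_homotopy {N : Y → S} {O : Set Y} {h : Y → C(I, Y)} (hc : ContinuousOn h O)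
    (h₀ : ∀ y, h y 0 = y) (hN : ∀ y ∈ O, N y = R.along (h y) 0 1 • N (h y 1))
    (γ : C(I, Y)) (hγ : ∀ t, γ t ∈ O)
    (h₁ : ∀ γ₁ : C(I, Y), (∀ t, γ₁ t = h (γ t) 1) → N (γ₁ 0) = R.along γ₁ 0 1 • N (γ₁ 1)) :
    N (γ 0) = R.along γ 0 1 • N (γ 1) := by
  let k : C(I, C(I, Y)) := ⟨fun t => h (γ t), hc.comp_continuous γ.continuous hγ⟩
  let γ₁ : C(I, Y) := ⟨fun t => k t 1, by fun_prop⟩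
  -- The deformation sweeps out a square with sides γ, γ₁ and the tracks of the two ends of γ.
  have hs := R.along_square k.uncurry γ γ₁ (h (γ 0)) (h (γ 1)) (fun t => (h₀ _).symm)
    (fun t => rfl) (fun t => rfl) (fun t => rfl)
  rw [hN _ (hγ 0), hN _ (hγ 1), ← mul_smul, hs, mul_smul]
  congr 1
  exact h₁ γ₁ fun t => rfl

end Holonomy

/-! ### Local systems -/

/-- A principal local system with structure group `P`, given by germs of trivializations. -/
structure LocSys (X : Type*) [TopologicalSpace X] (P : Type*) [Group P] where
  germ : X → X → P
  -- Only the values of `germ x` near x matter, and only up to a left constant. `P` has no topology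
  -- and `germ x` need not be continuous in any sense: its values just name the points of one sheet
  -- in the coordinates of the fibres.
  compat : ∀ x, ∀ᶠ y in 𝓝 x, ∃ c, germ y =ᶠ[𝓝 y] fun z => c * germ x z

namespace LocSys

variable {X Y Z P : Type*} [TopologicalSpace X] [TopologicalSpace Y] [TopologicalSpace Z]
  [Group P] (L : LocSys X P)

/-- A trivialization of the pullback of a local system along `g`. -/
def IsSection (g : Z → X) (ψ : Z → P) : Prop :=
  ∀ z, ∃ c, ψ =ᶠ[𝓝 z] fun w => c * L.germ (g z) (g w)

/-- The associated covering space. -/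
@[ext] structure Total (L : LocSys X P) where
  base : X
  coord : P

variable {L}

theorem IsSection.comp {g : Z → X} {ψ : Z → P} (h : L.IsSection g ψ) {f : Y → Z}
    (hf : Continuous f) : L.IsSection (g ∘ f) (ψ ∘ f) := fun y =>
  let ⟨c, hc⟩ := h (f y)
  ⟨c, hf.continuousAt.eventually hc⟩

/-- Near each point both sections are left multiples of the same germ, so the quotient is locally
constant. -/
theorem IsSection.div_eq [PreconnectedSpace Z] {g : Z → X} {ψ ψ' : Z → P}
    (h : L.IsSection g ψ) (h' : L.IsSection g ψ') (z w : Z) :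
    ψ z * (ψ' z)⁻¹ = ψ w * (ψ' w)⁻¹ := by
  have key : IsLocallyConstant fun z => ψ z * (ψ' z)⁻¹ := by
    rw [IsLocallyConstant.iff_eventually_eq]
    intro z
    obtain ⟨c, hc⟩ := h z
    obtain ⟨c', hc'⟩ := h' z
    filter_upwards [hc, hc'] with w h1 h2
    rw [h1, h2, hc.self_of_nhds, hc'.self_of_nhds]
    group
  exact key.apply_eq_of_preconnectedSpace z w

variable (L)

/-- The displayed points form the sheet through e: the left multiple of the germ that takes the
value `e.coord` at `e.base`. A set is open if with each point it contains the nearby part of its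
sheet. -/
instance : TopologicalSpace L.Total where
  IsOpen O := ∀ e ∈ O, ∀ᶠ z in 𝓝 e.base,
    (⟨z, e.coord * (L.germ e.base e.base)⁻¹ * L.germ e.base z⟩ : L.Total) ∈ O
  isOpen_univ := fun _ _ => by simp
  isOpen_inter := fun _ _ h₁ h₂ e he => (h₁ e he.1).and (h₂ e he.2)
  isOpen_sUnion := fun _ h e ⟨O, hO, he⟩ => (h O hO e he).mono fun _ hz => ⟨O, hO, hz⟩

theorem isOpen_total_iff {O : Set L.Total} : IsOpen O ↔ ∀ e ∈ O, ∀ᶠ z in 𝓝 e.base,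
    (⟨z, e.coord * (L.germ e.base e.base)⁻¹ * L.germ e.base z⟩ : L.Total) ∈ O := Iff.rfl

theorem isOpen_sheet {x : X} {W : Set X} (hW : IsOpen W)
    (hx : ∀ y ∈ W, ∃ c, L.germ y =ᶠ[𝓝 y] fun z => c * L.germ x z) (c : P) :
    IsOpen (Total.base ⁻¹' W ∩ {e : L.Total | e.coord = c * L.germ x e.base}) := by
  rw [isOpen_total_iff]
  rintro ⟨z, q⟩ ⟨hz, hq⟩
  obtain ⟨k, hk⟩ := hx z hz
  filter_upwards [hk, hW.mem_nhds hz] with w h1 h2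
  refine ⟨h2, ?_⟩
  change q = c * L.germ x z at hq
  change q * (L.germ z z)⁻¹ * L.germ z w = c * L.germ x w
  rw [hq, h1, hk.self_of_nhds]
  group

theorem exists_open_chart (x : X) : ∃ V : Set X, x ∈ V ∧ IsOpen V ∧
    ∀ y ∈ V, ∃ c, L.germ y =ᶠ[𝓝 y] fun z => c * L.germ x z := by
  obtain ⟨V, hV, hVo, hx⟩ := mem_nhds_iff.1 (L.compat x)
  exact ⟨V, hx, hVo, hV⟩

/-- Over the domain of a chart at x the total space is the disjoint union of the open sheets `coord
= c * germ x`, one for each c in the discrete set `P`. -/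
theorem isCoveringMap_base : IsCoveringMap (Total.base : L.Total → X) := by
  let : TopologicalSpace P := ⊥
  have : DiscreteTopology P := ⟨rfl⟩
  have : Nonempty (X → L.Total) := ⟨fun x => ⟨x, 1⟩⟩
  choose V hxV hV hc using L.exists_open_chart
  refine IsCoveringMap.mk Total.base (fun _ => P) (fun x => IsOpen.trivializationDiscrete
    (fun c => {e : L.Total | e.coord = c * L.germ x e.base}) (V x) (hV x) ?_ ?_ ?_ ?_ ?_) hxV
  · intro c W hW
    refine ⟨fun h => L.isOpen_sheet h (fun y hy => hc x y (hW hy)) c, fun h => ?_⟩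
    rw [isOpen_iff_mem_nhds]
    intro z hz
    exact (L.isOpen_total_iff.1 h ⟨z, c * L.germ x z⟩ ⟨hz, rfl⟩).mono fun w hw => hw.1
  · intro c e (he : _ = _) e' (he' : _ = _) h
    ext
    · exact h
    · rw [he, he', h]
  · exact fun c z _ => ⟨⟨z, c * L.germ x z⟩, rfl, rfl⟩
  · intro c c' hcc
    refine Set.disjoint_left.2 ?_
    intro e (h1 : _ = _) (h2 : _ = _)
    exact hcc (mul_right_cancel (h1.symm.trans h2))
  · rintro ⟨z, q⟩ -
    refine Set.mem_iUnion.2 ⟨q * (L.germ x z)⁻¹, ?_⟩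
    change q = q * (L.germ x z)⁻¹ * L.germ x z
    group

theorem isSection_of_continuous {F : Z → L.Total} (hF : Continuous F) :
    L.IsSection (fun z => (F z).base) fun z => (F z).coord := by
  intro z
  obtain ⟨V, hxV, hV, hc⟩ := L.exists_open_chart (F z).base
  refine ⟨(F z).coord * (L.germ (F z).base (F z).base)⁻¹, ?_⟩
  have := hF.continuousAt.preimage_mem_nhds ((L.isOpen_sheet hV hc
    ((F z).coord * (L.germ (F z).base (F z).base)⁻¹)).mem_nhds
      ⟨hxV, show (F z).coord = _ by group⟩)
  exact Filter.mem_of_superset this fun w hw => hw.2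

/-- The map lifts to the covering space, and the fibre coordinate of a lift is a section. -/
theorem exists_section [SimplyConnectedSpace Z] [LocallyPathConnectedSpace Z] (g : C(Z, X)) :
    ∃ ψ, L.IsSection g ψ := by
  obtain ⟨z₀⟩ : Nonempty Z := inferInstance
  obtain ⟨F, ⟨-, hF⟩, -⟩ := L.isCoveringMap_base.existsUnique_continuousMap_lifts g z₀
    ⟨g z₀, 1⟩ rfl
  refine ⟨fun z => (F z).coord, ?_⟩
  rw [← hF]
  exact L.isSection_of_continuous F.continuous

/-- The parallel transport of a local system along a path. -/
noncomputable def transport {x y : X} (p : Path x y) : P :=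
  ((L.exists_section p.toContinuousMap).choose 0)⁻¹ *
    (L.exists_section p.toContinuousMap).choose 1

variable {L}

/-- Sections are unique up to a left constant, which cancels in the inverse of the first value times
the last. -/
theorem transport_eq {x y : X} (p : Path x y) {ψ : I → P} (h : L.IsSection p ψ) :
    L.transport p = (ψ 0)⁻¹ * ψ 1 := by
  have := h.div_eq (L.exists_section p.toContinuousMap).choose_spec 0 1
  rw [transport, mul_inv_eq_iff_eq_mul.1 this.symm]
  group

theorem IsSection.eq_of_const {x : X} {g : Z → X} (hg : ∀ z, g z = x) [PreconnectedSpace Z]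
    {ψ : Z → P} (h : L.IsSection g ψ) (z w : Z) : ψ z = ψ w := by
  have : L.IsSection g fun _ => 1 := fun z =>
    ⟨(L.germ x x)⁻¹, Filter.Eventually.of_forall fun w => by simp [hg]⟩
  simpa using h.div_eq this z w

variable (L)

/-- The holonomy of a local system. -/
noncomputable def holonomy : Holonomy X P where
  val p := L.transport p
  val_trans {x y z} p q := by
    -- One section over the concatenation restricts to sections over both halves, and the product
    -- telescopes at the midpoint.
    obtain ⟨ψ, hψ⟩ := L.exists_section (p.trans q).toContinuousMap
    have h1 : L.IsSection p (ψ ∘ fun t : I => (⟨t / 2, by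
        constructor <;> linarith [t.2.1, t.2.2]⟩ : I)) := by
      convert! hψ.comp (f := fun t : I => (⟨t / 2, by
        constructor <;> linarith [t.2.1, t.2.2]⟩ : I)) (by fun_prop) using 1
      ext t
      have : (t : ℝ) / 2 ≤ 1 / 2 := by linarith [t.2.2]
      simp only [Path.coe_toContinuousMap, Function.comp_apply, Path.trans_apply, this, dite_true]
      congr 1
      ext
      simp [mul_div_cancel₀]
    have h2 : L.IsSection q (ψ ∘ fun t : I => (⟨(t + 1) / 2, by
        constructor <;> linarith [t.2.1, t.2.2]⟩ : I)) := by
      convert! hψ.comp (f := fun t : I => (⟨(t + 1) / 2, by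
        constructor <;> linarith [t.2.1, t.2.2]⟩ : I)) (by fun_prop) using 1
      ext t
      simp only [Path.coe_toContinuousMap, Function.comp_apply, Path.trans_apply]
      split_ifs with ht
      · have ht0 : (t : ℝ) = 0 := le_antisymm (by linarith) t.2.1
        obtain rfl : t = 0 := Subtype.ext ht0
        simp
      · congr 1
        ext
        simp only
        ring
    rw [transport_eq _ hψ, transport_eq _ h1, transport_eq _ h2]
    have e1 : (⟨((1 : I) : ℝ) / 2, by norm_num [div_le_one]⟩ : I) =
      ⟨(((0 : I) : ℝ) + 1) / 2, by norm_num [div_le_one]⟩ := by ext; simp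
    have e0 : (⟨((0 : I) : ℝ) / 2, by simp⟩ : I) = 0 := by ext; simp
    have e2 : (⟨(((1 : I) : ℝ) + 1) / 2, by norm_num⟩ : I) = 1 := by ext; norm_num
    simp only [Function.comp_apply, e0, e1, e2]
    group
  val_homotopic {x y p q} h := by
    obtain ⟨H⟩ := h
    -- A section over the homotopy square is constant on the two sides where the homotopy is
    -- constant, so the other two sides have equal transport.
    obtain ⟨ψ, hψ⟩ := L.exists_section H.toContinuousMap
    have h1 : L.IsSection p (ψ ∘ fun t : I => (0, t)) := by
      convert! hψ.comp (f := fun t : I => ((0, t) : I × I)) (by fun_prop) using 1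
      ext t; simp
    have h2 : L.IsSection q (ψ ∘ fun t : I => (1, t)) := by
      convert! hψ.comp (f := fun t : I => ((1, t) : I × I)) (by fun_prop) using 1
      ext t; simp
    have h3 := (hψ.comp (f := fun t : I => ((t, 0) : I × I)) (by fun_prop)).eq_of_const
      (x := x) (fun t => by simp) 0 1
    have h4 := (hψ.comp (f := fun t : I => ((t, 1) : I × I)) (by fun_prop)).eq_of_const
      (x := y) (fun t => by simp) 0 1
    rw [transport_eq _ h1, transport_eq _ h2]
    simp only [Function.comp_apply] at h3 h4 ⊢
    rw [h3, h4]

variable {L}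

theorem IsSection.along_eq [SimplyConnectedSpace Z] {g : C(Z, X)} {ψ : Z → P}
    (h : L.IsSection g ψ) (z w : Z) : L.holonomy.along g z w = (ψ z)⁻¹ * ψ w := by
  have := transport_eq ((PathConnectedSpace.somePath z w).map g.continuous)
    (h.comp (PathConnectedSpace.somePath z w).continuous)
  simpa [Holonomy.along, holonomy] using this

end LocSys

/-! ### Attaching cells -/

/-- A space with a boundary `{nrm = 1}`, onto which the complement of the core `{nrm = 0}` can be
retracted by a deformation. -/
structure Cell (D : Type*) [TopologicalSpace D] where
  nrm : D → ℝ
  continuous_nrm : Continuous nrm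
  retr : D → D
  continuousOn_retr : ContinuousOn retr {d | nrm d ≠ 0}
  nrm_retr : ∀ d, nrm d ≠ 0 → nrm (retr d) = 1
  retr_eq : ∀ d, nrm d = 1 → retr d = d
  ray : D → C(I, D)
  continuousOn_ray : ContinuousOn ray {d | nrm d ≠ 0}
  ray_zero : ∀ d, ray d 0 = d
  ray_one : ∀ d, nrm d ≠ 0 → ray d 1 = retr d
  ray_eq : ∀ d t, nrm d = 1 → ray d t = d

namespace Cell

variable {D X ι P Q S : Type*} [TopologicalSpace D] [TopologicalSpace X]
  [Group P] [Group Q] [MulAction Q S] (K : Cell D)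

/-- The boundary of a cell. -/
def bdry : Set D := {d | K.nrm d = 1}

/-- The boundary of a family of cells. -/
def bdrySigma (ι : Type*) : Set (Σ _ : ι, D) := {b | K.nrm b.2 = 1}

variable (f : (Σ _ : ι, D) → X)

/-- The space with a family of cells attached. -/
abbrev Glued : Type _ := Attach (K.bdrySigma ι) f

/-- The canonical map of the old space. -/
def oldMap : C(X, K.Glued f) := ⟨Attach.old _ _, Attach.continuous_old _ _⟩

/-- The canonical map of the cell with index `i`. -/
def newMap (i : ι) : C(D, K.Glued f) :=
  ⟨fun d => Attach.new _ _ ⟨i, d⟩,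
    continuous_quot_mk.comp (continuous_inr.comp continuous_sigmaMk)⟩

variable {f} in
theorem glue {i : ι} {d : D} (h : K.nrm d = 1) : K.newMap f i d = K.oldMap f (f ⟨i, d⟩) :=
  Quot.sound (AttachRel.glue (A := K.bdrySigma ι) (f := f) ⟨i, d⟩ h)

variable {f} in
@[elab_as_elim]
theorem Glued.ind {p : K.Glued f → Prop} (h₁ : ∀ x, p (K.oldMap f x))
    (h₂ : ∀ i d, p (K.newMap f i d)) (y : K.Glued f) : p y := by
  rcases y with ⟨x | ⟨i, d⟩⟩
  · exact h₁ x
  · exact h₂ i d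

/-- Functions on the space with cells attached. -/
def lift {Z : Type*} (g : X → Z) (k : ι → D → Z)
    (h : ∀ i d, K.nrm d = 1 → k i d = g (f ⟨i, d⟩)) : K.Glued f → Z :=
  Quot.lift (Sum.elim g fun b => k b.1 b.2) (by
    rintro _ _ ⟨⟨i, d⟩, hb⟩
    exact h i d hb)

/-- Stated on an open set, to which a quotient map restricts well, because retraction and flow are
continuous only off the cores. -/
theorem continuousOn_lift {Z : Type*} [TopologicalSpace Z] {g : X → Z} {k : ι → D → Z}
    {h : ∀ i d, K.nrm d = 1 → k i d = g (f ⟨i, d⟩)} {O : Set (K.Glued f)} (hO : IsOpen O)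
    (hg : ContinuousOn g (K.oldMap f ⁻¹' O))
    (hk : ∀ i, ContinuousOn (k i) (K.newMap f i ⁻¹' O)) : ContinuousOn (K.lift f g k h) O := by
  have hq : IsQuotientMap (Sum.elim (K.oldMap f) fun b : Σ _ : ι, D => K.newMap f b.1 b.2) := by
    convert! isQuotientMap_quot_mk (r := AttachRel (K.bdrySigma ι) f) using 1
    ext (x | b) <;> rfl
  rw [hq.continuousOn_isOpen_iff hO, continuousOn_open_iff (hO.preimage hq.continuous)]
  exact fun W hW => isOpen_sum_iff.2 ⟨(continuousOn_open_iff
    (hO.preimage (K.oldMap f).continuous)).1 hg W hW, isOpen_sigma_iff.2 fun i =>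
      (continuousOn_open_iff (hO.preimage (K.newMap f i).continuous)).1 (hk i) W hW⟩

theorem continuous_lift {Z : Type*} [TopologicalSpace Z] {g : X → Z} {k : ι → D → Z}
    {h : ∀ i d, K.nrm d = 1 → k i d = g (f ⟨i, d⟩)}
    (hg : Continuous g) (hk : ∀ i, Continuous (k i)) : Continuous (K.lift f g k h) := by
  rw [← continuousOn_univ]
  exact K.continuousOn_lift f isOpen_univ hg.continuousOn fun i => (hk i).continuousOn

/-- The radial coordinate. -/
def rad : K.Glued f → ℝ := K.lift f (fun _ => 1) (fun _ => K.nrm) fun _ _ h => h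

theorem continuous_rad : Continuous (K.rad f) :=
  K.continuous_lift f continuous_const fun _ => K.continuous_nrm

theorem isOpen_rad_ne (c : ℝ) : IsOpen {y | K.rad f y ≠ c} :=
  isOpen_ne_fun (K.continuous_rad f) continuous_const

/-- The retraction to the old space of the complement of the cores. -/
def toOld : K.Glued f → X :=
  K.lift f id (fun i d => f ⟨i, K.retr d⟩) fun i d h => by rw [K.retr_eq d h]; rfl

variable {f} in
theorem continuousOn_bdry (hf : ContinuousOn f (K.bdrySigma ι)) (i : ι) :
    ContinuousOn (fun d => f ⟨i, d⟩) K.bdry :=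
  hf.comp continuous_sigmaMk.continuousOn fun _ h => h

variable {f} in
theorem continuousOn_toOld (hf : ContinuousOn f (K.bdrySigma ι)) :
    ContinuousOn (K.toOld f) {y | K.rad f y ≠ 0} :=
  K.continuousOn_lift f (K.isOpen_rad_ne f 0) continuousOn_id fun i =>
    (K.continuousOn_bdry hf i).comp K.continuousOn_retr K.nrm_retr

/-- The deformation to the old space of the complement of the cores. -/
def flow : K.Glued f → C(I, K.Glued f) :=
  K.lift f (fun x => ContinuousMap.const I (K.oldMap f x)) (fun i d => (K.newMap f i).comp (K.ray d))
    fun i d h => by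
      ext t
      simp [K.ray_eq d t h, K.glue h]

theorem continuousOn_flow : ContinuousOn (K.flow f) {y | K.rad f y ≠ 0} :=
  K.continuousOn_lift f (K.isOpen_rad_ne f 0)
    (ContinuousMap.continuous_const'.comp (K.oldMap f).continuous).continuousOn fun i =>
      ((K.newMap f i).continuous_postcomp.comp_continuousOn K.continuousOn_ray)

theorem flow_zero (y : K.Glued f) : K.flow f y 0 = y := by
  induction y using Glued.ind with
  | h₁ x => rfl
  | h₂ i d => exact congrArg (K.newMap f i) (K.ray_zero d)

theorem flow_one {y : K.Glued f} (hy : K.rad f y ≠ 0) :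
    K.flow f y 1 = K.oldMap f (K.toOld f y) := by
  induction y using Glued.ind with
  | h₁ x => rfl
  | h₂ i d => exact (congrArg (K.newMap f i) (K.ray_one d hy)).trans (K.glue (K.nrm_retr d hy))

variable {f} in
-- Interiors of cells are untouched by the gluing, so neighbourhoods of interior points remain
-- neighbourhoods.
theorem nhds_newMap {i : ι} {d : D} (hd : K.nrm d ≠ 1) {O : Set D} (hO : O ∈ 𝓝 d) :
    K.newMap f i '' O ∈ 𝓝 (K.newMap f i d) := by
  obtain ⟨W, hWO, hW, hdW⟩ := mem_nhds_iff.1 hO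
  -- The image of the interior part of W as a `Prop`-valued function: its preimages in the old space
  -- and in each cell are then explicit.
  let T : K.Glued f → Prop := K.lift f (fun _ => False) (fun j d => j = i ∧ d ∈ W ∧ K.nrm d ≠ 1)
    fun j d h => by simp [h]
  refine Filter.mem_of_superset (IsOpen.mem_nhds (s := {y | T y}) ?_ ⟨rfl, hdW, hd⟩) ?_
  · refine isOpen_coinduced.2 (isOpen_sum_iff.2 ⟨?_, isOpen_sigma_iff.2 fun j => ?_⟩)
    · exact isOpen_empty
    · by_cases hj : j = i
      · convert! hW.inter (isOpen_ne_fun K.continuous_nrm continuous_const) using 1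
        ext d
        exact ⟨fun h => h.2, fun h => ⟨hj, h⟩⟩
      · convert! isOpen_empty using 1
        ext d
        exact ⟨fun h => hj h.1, fun h => h.elim⟩
  · intro y
    induction y using Glued.ind with
    | h₁ x => exact fun h => h.elim
    | h₂ j d =>
      rintro ⟨rfl, h, -⟩
      exact ⟨d, hWO h, rfl⟩

/-- A path in the interiors of the cells stays in one cell. -/
theorem exists_lift_path (γ : C(I, K.Glued f)) (hγ : ∀ t, K.rad f (γ t) ≠ 1) :
    ∃ (i : ι) (p : C(I, D)), γ = (K.newMap f i).comp p := by
  classical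
  have hex : ∀ y : K.Glued f, K.rad f y ≠ 1 → ∃ b : Σ _ : ι, D, K.newMap f b.1 b.2 = y := by
    intro y hy
    induction y using Glued.ind with
    | h₁ x => exact (hy rfl).elim
    | h₂ i d => exact ⟨⟨i, d⟩, rfl⟩
  let b₀ := (hex _ (hγ 0)).choose
  -- The inverse of the cell maps on the open cells; the default `b₀` is never met along γ. A
  -- continuous map from the connected interval to a disjoint union stays in one summand.
  let pos : K.Glued f → Σ _ : ι, D := K.lift f (fun _ => b₀)
    (fun i d => if K.nrm d = 1 then b₀ else ⟨i, d⟩) fun i d h => by simp [h]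
  have hpos : ∀ i d, K.nrm d ≠ 1 → pos (K.newMap f i d) = ⟨i, d⟩ := fun i d h => if_neg h
  have hcont : Continuous fun t => pos (γ t) := by
    rw [continuous_iff_continuousAt]
    intro t
    refine ContinuousAt.comp (g := pos) ?_ γ.continuous.continuousAt
    obtain ⟨⟨i, d⟩, hb⟩ := hex _ (hγ t)
    have hd : K.nrm d ≠ 1 := by
      have := hγ t
      rwa [← hb] at this
    rw [← hb]
    intro O hO
    rw [hpos i d hd] at hO
    have h1 : (Sigma.mk i ⁻¹' O) ∩ {d | K.nrm d ≠ 1} ∈ 𝓝 d :=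
      Filter.inter_mem (continuous_sigmaMk.continuousAt.preimage_mem_nhds hO)
        ((isOpen_ne_fun K.continuous_nrm continuous_const).mem_nhds hd)
    change pos ⁻¹' O ∈ 𝓝 (K.newMap f i d)
    refine Filter.mem_of_superset (K.nhds_newMap hd h1) ?_
    rintro _ ⟨d', ⟨h, h'⟩, rfl⟩
    simpa only [Filter.mem_map, Set.mem_preimage, hpos i d' h'] using h
  obtain ⟨i, p, hp, hip⟩ := hcont.exists_lift_sigma
  refine ⟨i, ⟨p, hp⟩, ContinuousMap.ext fun t => ?_⟩
  obtain ⟨⟨j, d⟩, hb⟩ := hex _ (hγ t)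
  have hd : K.nrm d ≠ 1 := by
    have := hγ t
    rwa [← hb] at this
  have h2 : pos (γ t) = ⟨i, p t⟩ := congrFun hip t
  rw [← hb, hpos j d hd] at h2
  obtain ⟨rfl, h3⟩ := Sigma.mk.inj_iff.1 h2
  rw [← hb, eq_of_heq h3]
  rfl

variable {f}

/-- Flat functions extend over cells with path connected boundary. -/
theorem exists_flat_extension [SimplyConnectedSpace D] (hK : IsPathConnected K.bdry)
    (hf : ContinuousOn f (K.bdrySigma ι)) (R : Holonomy (K.Glued f) Q) {N : X → S}
    (hN : (R.comap (K.oldMap f)).Flat N) :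
    ∃ N' : K.Glued f → S, R.Flat N' ∧ ∀ x, N' (K.oldMap f x) = N x := by
  obtain ⟨a₀, ha₀⟩ := hK.nonempty
  -- In a cell the value is transported from one boundary point a₀. On the boundary this agrees with
  -- `N`, since a₀ can be reached inside the boundary and `N` is flat there.
  let N' : K.Glued f → S := K.lift f N (fun i d => R.along (K.newMap f i) d a₀ • N (f ⟨i, a₀⟩)) (by
    intro i d hd
    obtain ⟨p, hp⟩ := hK.joinedIn d hd a₀ ha₀
    let q : C(I, X) := ⟨fun t => f ⟨i, p t⟩, (K.continuousOn_bdry hf i).comp_continuous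
      p.continuous hp⟩
    have h1 := hN q
    have h2 : (K.oldMap f).comp q = (K.newMap f i).comp p.toContinuousMap :=
      ContinuousMap.ext fun t => (K.glue (hp t)).symm
    rw [R.comap_along, h2, R.along_comp] at h1
    simpa [q] using h1.symm)
  have hnew : ∀ i d, N' (K.newMap f i d) = R.along (K.newMap f i) d a₀ • N (f ⟨i, a₀⟩) :=
    fun i d => rfl
  have hcell : ∀ i (p : C(I, D)), N' (K.newMap f i (p 0)) =
      R.along ((K.newMap f i).comp p) 0 1 • N' (K.newMap f i (p 1)) := by
    intro i p
    rw [hnew, hnew, R.along_comp, ← mul_smul, R.along_trans]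
  refine ⟨N', R.flat_of_local fun y => ?_, fun x => rfl⟩
  -- A path near a core stays in the interior of one simply connected cell; a path off the cores is
  -- pushed by the flow into the old space, where `N` is flat.
  by_cases hy : K.rad f y = 0
  · refine ⟨{y | K.rad f y ≠ 1}, (K.isOpen_rad_ne f 1).mem_nhds (by simp [hy]), fun γ hγ => ?_⟩
    obtain ⟨i, p, rfl⟩ := K.exists_lift_path f γ hγ
    exact hcell i p
  · refine ⟨{y | K.rad f y ≠ 0}, (K.isOpen_rad_ne f 0).mem_nhds hy, fun γ hγ => ?_⟩
    refine R.flat_of_homotopy (K.continuousOn_flow f) (K.flow_zero f) ?_ γ hγ ?_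
    · intro y _
      induction y using Glued.ind with
      | h₁ x =>
        rw [R.along_eq_one_of_const _ (fun _ _ => rfl), one_smul]
        rfl
      | h₂ i d =>
        have := hcell i (K.ray d)
        rwa [K.ray_zero] at this
    · intro γ₁ hγ₁
      let q : C(I, X) := ⟨fun t => K.toOld f (γ t),
        (K.continuousOn_toOld hf).comp_continuous γ.continuous hγ⟩
      have h1 : γ₁ = (K.oldMap f).comp q :=
        ContinuousMap.ext fun t => (hγ₁ t).trans (K.flow_one f (hγ t))
      rw [h1]
      exact hN q

/-- Local systems that are trivial on the boundaries of the cells extend. -/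
theorem exists_locSys_extension (hf : ContinuousOn f (K.bdrySigma ι)) (L : LocSys X P)
    (hL : ∀ i, ∃ ψ : K.bdry → P, L.IsSection (fun a : K.bdry => f ⟨i, a⟩) ψ) :
    ∃ L' : LocSys (K.Glued f) P, ∀ (Z : Type) [TopologicalSpace Z] (g : C(Z, X)) (ψ : Z → P),
      L.IsSection g ψ → L'.IsSection ((K.oldMap f).comp g) ψ := by
  classical
  choose ψ hψ using hL
  let ψ' : ι → D → P := fun i d => if h : d ∈ K.bdry then ψ i ⟨d, h⟩ else 1
  -- The boundary section extended constantly along rays. The values on the old space and on cell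
  -- boundaries are never used; those on a core only name coordinates in the fibres there.
  let Ψ : K.Glued f → P := K.lift f (fun _ => 1)
    (fun i d => if K.nrm d = 1 then 1 else ψ' i (K.retr d)) fun i d h => by simp [h]
  have hU := K.isOpen_rad_ne f 0
  have hcont : ∀ y, K.rad f y ≠ 0 → ContinuousAt (K.toOld f) y := fun y hy =>
    (K.continuousOn_toOld hf).continuousAt (hU.mem_nhds hy)
  -- Off the cores the system is pulled back by the retraction. At a core its germ is Ψ, which
  -- agrees nearby with the pulled back germs up to left constants because ψ is a section.
  refine ⟨⟨fun y => if K.rad f y = 0 then Ψ else fun z => L.germ (K.toOld f y) (K.toOld f z),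
    fun y => ?_⟩, fun Z _ g χ hχ z => ?_⟩
  · by_cases hy : K.rad f y = 0
    · filter_upwards [(K.isOpen_rad_ne f 1).mem_nhds (by simp [hy] : K.rad f y ≠ 1)] with z hz
      simp only [hy, if_true]
      by_cases hz0 : K.rad f z = 0
      · exact ⟨1, by simp [hz0]⟩
      simp only [hz0, if_false]
      induction z using Glued.ind with
      | h₁ x => exact (hz rfl).elim
      | h₂ i d =>
        have ha : K.retr d ∈ K.bdry := K.nrm_retr d hz0
        obtain ⟨c, hc⟩ := hψ i ⟨K.retr d, ha⟩
        refine ⟨c⁻¹, ?_⟩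
        rw [Filter.EventuallyEq, nhds_subtype_eq_comap, Filter.eventually_comap] at hc
        have hr : ContinuousAt K.retr d := K.continuousOn_retr.continuousAt
          ((isOpen_ne_fun K.continuous_nrm continuous_const).mem_nhds hz0)
        have h1 := K.nhds_newMap (f := f) (i := i) hz (Filter.inter_mem
          (hr.eventually hc) (Filter.inter_mem
            ((isOpen_ne_fun K.continuous_nrm continuous_const).mem_nhds hz)
            ((isOpen_ne_fun K.continuous_nrm continuous_const).mem_nhds hz0)))
        refine Filter.mem_of_superset h1 ?_
        rintro _ ⟨d', ⟨h, h', h''⟩, rfl⟩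
        have h3 : K.retr d' ∈ K.bdry := K.nrm_retr d' h''
        have h4 := h ⟨K.retr d', h3⟩ rfl
        have h5 : Ψ (K.newMap f i d') = ψ i ⟨K.retr d', h3⟩ :=
          (if_neg h').trans (dif_pos h3)
        simp only [h5, h4, Set.mem_ofPred_eq]
        exact (inv_mul_cancel_left c _).symm
    · filter_upwards [hU.mem_nhds hy, (hcont y hy).eventually (L.compat (K.toOld f y))] with z hz
      rintro ⟨c, hc⟩
      refine ⟨c, ?_⟩
      simp only [hy, if_false, (show K.rad f z ≠ 0 from hz)]
      exact (hcont z hz).eventually hc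
  · obtain ⟨c, hc⟩ := hχ z
    refine ⟨c, hc.mono fun w hw => ?_⟩
    have h1 : K.rad f (K.oldMap f (g z)) ≠ 0 := one_ne_zero
    simp only [ContinuousMap.comp_apply, h1, if_false]
    exact hw

end Cell

theorem ContinuousMap.continuousOn_of_uncurry {X Y Z : Type*} [TopologicalSpace X]
    [TopologicalSpace Y] [TopologicalSpace Z] {F : X → C(Y, Z)} {s : Set X}
    (h : ContinuousOn (fun p : X × Y => F p.1 p.2) (s ×ˢ Set.univ)) : ContinuousOn F s := by
  rw [continuousOn_iff_continuous_domRestrict]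
  refine ContinuousMap.continuous_of_continuous_uncurry _ ?_
  exact h.comp_continuous (f := fun p : s × Y => ((p.1 : X), p.2)) (by fun_prop)
    fun p => ⟨p.1.2, trivial⟩

/-! ### Balls and handles as cells -/

namespace Cell

/-- The closed unit ball. -/
noncomputable def ball (E : Type*) [NormedAddCommGroup E] [NormedSpace ℝ E] :
    Cell (Metric.closedBall (0 : E) 1) where
  nrm d := ‖(d : E)‖
  continuous_nrm := by fun_prop
  retr d := ⟨‖(d : E)‖⁻¹ • (d : E), by
    rw [mem_closedBall_zero_iff, norm_smul, norm_inv, norm_norm]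
    exact inv_mul_le_one⟩
  continuousOn_retr := by
    rw [IsInducing.subtypeVal.continuousOn_iff]
    exact ContinuousOn.smul (ContinuousOn.inv₀ (by fun_prop) fun d hd => hd) (by fun_prop)
  nrm_retr d hd := by
    simp only [norm_smul, norm_inv, norm_norm]
    exact inv_mul_cancel₀ hd
  retr_eq d hd := by ext; simp [hd]
  -- The straight path from d to d/‖d‖; as 0⁻¹ = 0, it stays put at the centre, so the bound on the
  -- norm needs no case distinction.
  ray d := ⟨fun t => ⟨((1 - t) + t * ‖(d : E)‖⁻¹) • (d : E), by
    rw [mem_closedBall_zero_iff, norm_smul, Real.norm_of_nonneg (add_nonneg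
      (sub_nonneg.2 t.2.2) (mul_nonneg t.2.1 (by positivity))), add_mul, mul_assoc]
    have h1 : ‖(d : E)‖⁻¹ * ‖(d : E)‖ ≤ 1 := inv_mul_le_one
    have h2 : ‖(d : E)‖ ≤ 1 := mem_closedBall_zero_iff.1 d.2
    nlinarith [mul_le_mul_of_nonneg_left h1 t.2.1,
      mul_le_mul_of_nonneg_left h2 (sub_nonneg.2 t.2.2)]⟩, by fun_prop⟩
  continuousOn_ray := by
    refine ContinuousMap.continuousOn_of_uncurry ?_
    rw [IsInducing.subtypeVal.continuousOn_iff]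
    refine ContinuousOn.smul (ContinuousOn.add (by fun_prop) (ContinuousOn.mul (by fun_prop)
      (ContinuousOn.inv₀ (by fun_prop) fun d hd => hd.1))) (by fun_prop)
  ray_zero d := by ext; simp
  ray_one d hd := by ext; simp
  ray_eq d t hd := by ext; simp [hd]

/-- The product of a cell and a space. -/
def prod {D : Type*} [TopologicalSpace D] (K : Cell D) (Y : Type*) [TopologicalSpace Y] :
    Cell (D × Y) where
  nrm d := K.nrm d.1
  continuous_nrm := K.continuous_nrm.comp continuous_fst
  retr d := (K.retr d.1, d.2)
  continuousOn_retr := (K.continuousOn_retr.comp continuousOn_fst fun d hd => hd).prodMk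
    continuousOn_snd
  nrm_retr d := K.nrm_retr d.1
  retr_eq d hd := Prod.ext (K.retr_eq d.1 hd) rfl
  ray d := (K.ray d.1).prodMk (ContinuousMap.const I d.2)
  continuousOn_ray := by
    refine ContinuousMap.continuousOn_of_uncurry ?_
    refine ContinuousOn.prodMk ?_ (by fun_prop)
    have h := K.continuousOn_ray.comp (t := {d | K.nrm d ≠ 0})
      (s := {d : D × Y | K.nrm d.1 ≠ 0} ×ˢ (Set.univ : Set I)) (f := fun p : (D × Y) × I => p.1.1)
      (by fun_prop) fun p hp => hp.1
    exact continuous_eval.comp_continuousOn (h.prodMk continuousOn_snd)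
  ray_zero d := Prod.ext (K.ray_zero d.1) rfl
  ray_one d hd := Prod.ext (K.ray_one d.1 hd) rfl
  ray_eq d t hd := Prod.ext (K.ray_eq d.1 t hd) rfl

variable {E : Type*} [NormedAddCommGroup E] [NormedSpace ℝ E]

instance : ContractibleSpace (Metric.closedBall (0 : E) 1) :=
  (convex_closedBall (0 : E) 1).contractibleSpace ⟨0, by simp⟩

/-- The unit sphere as the boundary of the unit ball. -/
def sphereToBdry : C(Metric.sphere (0 : E) 1, (ball E).bdry) :=
  ⟨fun z => ⟨⟨z, Metric.sphere_subset_closedBall z.2⟩, mem_sphere_zero_iff_norm.1 z.2⟩,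
    by fun_prop⟩

/-- The boundary of the unit ball as the unit sphere. -/
def bdryToSphere : C((ball E).bdry, Metric.sphere (0 : E) 1) :=
  ⟨fun z => ⟨z, mem_sphere_zero_iff_norm.2 z.2⟩, by fun_prop⟩

theorem isPathConnected_bdry_ball (h : 1 < Module.rank ℝ E) : IsPathConnected (ball E).bdry := by
  have := isPathConnected_iff_pathConnectedSpace.1 (isPathConnected_sphere h 0 zero_le_one)
  rw [isPathConnected_iff_pathConnectedSpace]
  refine Function.Surjective.pathConnectedSpace (f := sphereToBdry (E := E)) ?_
    (sphereToBdry (E := E)).continuous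
  exact fun z => ⟨bdryToSphere z, rfl⟩

theorem isPathConnected_bdry_prod {D : Type*} [TopologicalSpace D] {K : Cell D}
    (h : IsPathConnected K.bdry) (Y : Type*) [TopologicalSpace Y] [PathConnectedSpace Y] :
    IsPathConnected (K.prod Y).bdry := by
  convert! h.prod (isPathConnected_univ (X := Y)) using 1
  ext d
  simp [bdry, prod]

end Cell

/-! ### Local systems on the 2-sphere -/

namespace LocSys

variable {X Z P V : Type*} [TopologicalSpace X] [TopologicalSpace Z] [Group P]
  [TopologicalSpace V] {L : LocSys X P}

/-- Each chart domain is simply connected and carries a section. On the connected overlap the two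
differ by a left constant, and correcting one of them makes them match. -/
theorem exists_section_of_cover (φ₁ φ₂ : OpenPartialHomeomorph Z V)
    [SimplyConnectedSpace V] [LocallyPathConnectedSpace V] (h₁ : φ₁.target = Set.univ)
    (h₂ : φ₂.target = Set.univ) (hU : φ₁.source ∪ φ₂.source = Set.univ)
    (hc : IsPreconnected (φ₁.source ∩ φ₂.source)) (g : C(Z, X)) :
    ∃ ψ : Z → P, L.IsSection g ψ := by
  classical
  have aux : ∀ φ : OpenPartialHomeomorph Z V, φ.target = Set.univ → ∃ ψ : Z → P,
      ∀ z ∈ φ.source, ∃ c, ψ =ᶠ[𝓝 z] fun w => c * L.germ (g z) (g w) := by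
    intro φ hφ
    have hs : Continuous φ.symm := by
      have := φ.continuousOn_symm
      rwa [hφ, continuousOn_univ] at this
    obtain ⟨ψ, hψ⟩ := L.exists_section (g.comp ⟨φ.symm, hs⟩)
    refine ⟨ψ ∘ φ, fun z hz => ?_⟩
    obtain ⟨c, hc⟩ := hψ (φ z)
    refine ⟨c, ?_⟩
    filter_upwards [(φ.continuousAt hz).eventually hc, φ.open_source.mem_nhds hz] with w hw hw'
    simpa [φ.left_inv hz, φ.left_inv hw'] using hw
  obtain ⟨ψ₁, hψ₁⟩ := aux φ₁ h₁
  obtain ⟨ψ₂, hψ₂⟩ := aux φ₂ h₂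
  have hconst : ∃ k, ∀ z ∈ φ₁.source ∩ φ₂.source, ψ₁ z = k * ψ₂ z := by
    rcases (φ₁.source ∩ φ₂.source).eq_empty_or_nonempty with he | ⟨z₀, hz₀⟩
    · exact ⟨1, by simp [he]⟩
    refine ⟨ψ₁ z₀ * (ψ₂ z₀)⁻¹, fun z hz => ?_⟩
    have := isPreconnected_iff_preconnectedSpace.1 hc
    have key : IsLocallyConstant fun z : ↥(φ₁.source ∩ φ₂.source) => ψ₁ z * (ψ₂ z)⁻¹ := by
      rw [IsLocallyConstant.iff_eventually_eq]
      rintro ⟨z, hz⟩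
      obtain ⟨c, hc⟩ := hψ₁ z hz.1
      obtain ⟨c', hc'⟩ := hψ₂ z hz.2
      refine continuous_subtype_val.continuousAt.eventually
        (p := fun w => ψ₁ w * (ψ₂ w)⁻¹ = ψ₁ z * (ψ₂ z)⁻¹) ?_
      change ∀ᶠ w in 𝓝 z, _
      filter_upwards [hc, hc'] with w h1 h2
      rw [h1, h2, hc.self_of_nhds, hc'.self_of_nhds]
      group
    have := key.apply_eq_of_preconnectedSpace ⟨z, hz⟩ ⟨z₀, hz₀⟩
    simp only at this
    rw [← this]
    group
  obtain ⟨k, hk⟩ := hconst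
  have hmem : ∀ z, z ∈ φ₁.source ∨ z ∈ φ₂.source := fun z => by
    have : z ∈ φ₁.source ∪ φ₂.source := by simp [hU]
    exact this
  refine ⟨fun z => if z ∈ φ₁.source then ψ₁ z else k * ψ₂ z, fun z => ?_⟩
  rcases hmem z with hz | hz
  · obtain ⟨c, hc⟩ := hψ₁ z hz
    refine ⟨c, ?_⟩
    filter_upwards [hc, φ₁.open_source.mem_nhds hz] with w h1 h2
    rw [if_pos h2, h1]
  · obtain ⟨c, hc⟩ := hψ₂ z hz
    refine ⟨k * c, ?_⟩
    filter_upwards [hc, φ₂.open_source.mem_nhds hz] with w h1 h2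
    split_ifs with h
    · rw [hk w ⟨h, h2⟩, h1, mul_assoc]
    · rw [h1, mul_assoc]

/-- The two charts are stereographic projections from antipodal points. This is why attaching
3-balls imposes no relation. -/
theorem exists_section_sphere (g : C(Metric.sphere (0 : EuclideanSpace ℝ (Fin 3)) 1, X)) :
    ∃ ψ, L.IsSection g ψ := by
  have : Fact (Module.finrank ℝ (EuclideanSpace ℝ (Fin 3)) = 2 + 1) := ⟨by simp⟩
  let v : Metric.sphere (0 : EuclideanSpace ℝ (Fin 3)) 1 :=
    ⟨EuclideanSpace.single 0 1, by simp⟩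
  have hv : v ≠ -v := by
    intro h
    have := congrArg (fun w : Metric.sphere (0 : EuclideanSpace ℝ (Fin 3)) 1 => w.1 0) h
    norm_num [v] at this
  refine exists_section_of_cover (stereographic' 2 v) (stereographic' 2 (-v)) (by simp) (by simp)
    ?_ ?_ g
  · ext z
    simp only [stereographic'_source, Set.mem_union, Set.mem_compl_iff, Set.mem_singleton_iff,
      Set.mem_univ, iff_true]
    by_contra! h
    exact hv (h.1.symm.trans h.2)
  · have h1 : (stereographic' 2 v).source ∩ (stereographic' 2 (-v)).source =
        (stereographic' 2 v).symm '' {stereographic' 2 v (-v)}ᶜ := by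
      ext z
      constructor
      · rintro ⟨h2, h3⟩
        refine ⟨stereographic' 2 v z, fun h4 => ?_, (stereographic' 2 v).left_inv h2⟩
        have h5 := (stereographic' 2 v).injOn h2 (by simpa using hv.symm) h4
        simp [h5] at h3
      · rintro ⟨w, hw, rfl⟩
        refine ⟨(stereographic' 2 v).map_target (by simp), ?_⟩
        simp only [stereographic'_source, Set.mem_compl_iff, Set.mem_singleton_iff]
        intro h
        apply hw
        rw [← h, (stereographic' 2 v).right_inv (by simp)]
        rfl
    rw [h1]
    -- The overlap is a punctured plane, connected because the dimension is 2.
    refine (isConnected_compl_singleton_of_one_lt_rank ?_ _).isPreconnected.image _ ?_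
    · rw [← Module.finrank_eq_rank, finrank_euclideanSpace_fin]; norm_num
    · refine (stereographic' 2 v).continuousOn_symm.mono (by simp)

end LocSys

/-! ### Loops that bound in a cell -/

namespace Cell

variable {D X ι P Q : Type*} [TopologicalSpace D] [TopologicalSpace X] [Group P] [Group Q]
  (K : Cell D) {f : (Σ _ : ι, D) → X}

theorem continuousOn_bdrySigma (h : ∀ i, ContinuousOn (fun d => f ⟨i, d⟩) K.bdry) :
    ContinuousOn f (K.bdrySigma ι) := by
  rintro ⟨i, d⟩ hd
  have hσ : IsOpenEmbedding (@Sigma.mk ι (fun _ => D) i) := .sigmaMk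
  have := hσ.map_nhdsWithin_preimage_eq (K.bdrySigma ι) d
  rw [ContinuousWithinAt, ← this]
  exact h i d hd

/-- Loops in the boundaries of cells are trivial in the space with the cells attached. -/
theorem along_attaching_loop [SimplyConnectedSpace D] (R : Holonomy (K.Glued f) Q)
    (i : ι) (e : C(ℝ, D)) (he : ∀ t, K.nrm (e t) = 1) (w : C(ℝ, X)) (hw : ∀ t, f ⟨i, e t⟩ = w t)
    {k : ℝ} (hk : e k = e 0) : (R.comap (K.oldMap f)).along w 0 k = 1 := by
  -- In the glued space the loop is the image of a closed curve in the simply connected cell.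
  have : (K.oldMap f).comp w = (K.newMap f i).comp e :=
    ContinuousMap.ext fun t => by simp [K.glue (he t), hw]
  rw [R.comap_along, this, R.along_comp, hk, R.along_self]

end Cell

/-! ### Periodic maps of the line as maps of the circle -/

namespace GaussDiagram

/-- `Complex.arg` jumps by 2π on the negative axis, so `angle k` jumps by k. There the argument of
-z, increased by π, is a continuous branch. -/
theorem exists_local_angle (k : ℕ) {z₀ : ℂ} (hz₀ : z₀ ≠ 0) : ∃ θ : ℂ → ℝ, ContinuousAt θ z₀ ∧
    ∀ z, z ≠ 0 → ∃ m : ℤ, angle k z = θ z + m * k := by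
  by_cases h : z₀ ∈ Complex.slitPlane
  · refine ⟨angle k, ?_, fun z _ => ⟨0, by simp⟩⟩
    exact continuousAt_const.mul ((Complex.continuousAt_arg h).div_const _)
  · have h' : -z₀ ∈ Complex.slitPlane := by
      rw [Complex.mem_slitPlane_iff_arg] at h ⊢
      have : z₀.arg = Real.pi := by tauto
      have h2 := Complex.arg_eq_pi_iff.1 this
      refine ⟨fun h3 => ?_, neg_ne_zero.2 hz₀⟩
      have h3 := Complex.arg_eq_pi_iff.1 h3
      simp at h3
      linarith [h2.1, h3.1]
    refine ⟨fun z => k * (((-z).arg + Real.pi) / (2 * Real.pi)), ?_, fun z hz => ?_⟩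
    · refine continuousAt_const.mul (ContinuousAt.div_const (ContinuousAt.add ?_
        continuousAt_const) _)
      exact (Complex.continuousAt_arg h').comp continuous_neg.continuousAt
    · have := Complex.arg_neg_coe_angle hz
      rw [← Real.Angle.coe_add, Real.Angle.angle_eq_iff_two_pi_dvd_sub] at this
      obtain ⟨m, hm⟩ := this
      refine ⟨-(m + 1), ?_⟩
      have h1 : (-z).arg = z.arg + Real.pi + 2 * Real.pi * m := by linarith
      simp only [h1, angle]
      field_simp
      push_cast
      ring

theorem exists_angle_exp {k : ℕ} (hk : k ≠ 0) (t : ℝ) : ∃ m : ℤ,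
    angle k (Complex.exp ((2 * Real.pi * (t / k) : ℝ) * Complex.I)) = t + m * k := by
  have hk' : (k : ℝ) ≠ 0 := Nat.cast_ne_zero.2 hk
  rw [angle, Complex.arg_exp_mul_I]
  refine ⟨-toIocDiv Real.two_pi_pos (-Real.pi) (2 * Real.pi * (t / k)), ?_⟩
  rw [toIocMod]
  field_simp
  push_cast
  simp
  ring

variable {X Y T P : Type*} [TopologicalSpace X] [TopologicalSpace Y] [TopologicalSpace T]
  [Group P] {k : ℕ}

theorem periodic_int {A B : Type*} {w : ℝ × B → A} (hw : ∀ t y, w (t + k, y) = w (t, y)) (t : ℝ)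
    (m : ℤ) (y : B) : w (t + m * k, y) = w (t, y) := by
  have : Function.Periodic (fun t => w (t, y)) k := fun t => hw t y
  exact this.int_mul m t

/-- The multiples of k by which the angle differs from a continuous local branch are absorbed by the
period. -/
theorem continuous_periodic {w : C(ℝ × Y, X)} (hw : ∀ t y, w (t + k, y) = w (t, y))
    {u : T → ℂ} (hu : Continuous u) (hu0 : ∀ a, u a ≠ 0) {y : T → Y} (hy : Continuous y) :
    Continuous fun a => w (angle k (u a), y a) := by
  rw [continuous_iff_continuousAt]
  intro a
  obtain ⟨θ, hθ, hm⟩ := exists_local_angle k (hu0 a)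
  have h : (fun a => w (angle k (u a), y a)) = fun a => w (θ (u a), y a) := by
    ext a
    obtain ⟨m, hm⟩ := hm _ (hu0 a)
    rw [hm, periodic_int hw]
  rw [h]
  exact w.continuous.continuousAt.comp ((hθ.comp hu.continuousAt).prodMk hy.continuousAt)

/-- A section over the line times Y and its shift by k are sections over the same map, so they
differ by a left constant. Trivial holonomy around one period makes that constant 1, and the section
descends. -/
theorem exists_section_periodic [ContractibleSpace Y] [LocallyPathConnectedSpace Y]
    (L : LocSys X P) {w : C(ℝ × Y, X)} (hw : ∀ t y, w (t + k, y) = w (t, y))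
    {u : T → ℂ} (hu : Continuous u) (hu0 : ∀ a, u a ≠ 0) {y : T → Y} (hy : Continuous y)
    (y₀ : Y) (hL : L.holonomy.along (w.comp ⟨fun t => (t, y₀), by fun_prop⟩) (0 : ℝ) k = 1) :
    ∃ ψ, L.IsSection (fun a => w (angle k (u a), y a)) ψ := by
  obtain ⟨ψ, hψ⟩ := L.exists_section w
  have hper : ∀ t y, ψ (t + k, y) = ψ (t, y) := by
    intro t y
    have h1 := hψ.comp (f := fun p : ℝ × Y => (p.1 + k, p.2)) (by fun_prop)
    have h2 : w ∘ (fun p : ℝ × Y => (p.1 + k, p.2)) = w := by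
      ext p
      exact hw p.1 p.2
    rw [h2] at h1
    have h3 := h1.div_eq hψ (t, y) (0, y₀)
    have h4 : ψ (0, y₀) = ψ (k, y₀) := by
      have h5 := (hψ.comp (f := fun t : ℝ => (t, y₀)) (by fun_prop)).along_eq
        (g := w.comp ⟨fun t => (t, y₀), by fun_prop⟩) 0 k
      rw [hL] at h5
      simpa [eq_inv_mul_iff_mul_eq] using h5
    simp only [Function.comp_apply, zero_add, ← h4, mul_inv_cancel] at h3
    exact mul_inv_eq_one.1 h3
  refine ⟨fun a => ψ (angle k (u a), y a), fun a => ?_⟩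
  obtain ⟨θ, hθ, hm⟩ := exists_local_angle k (hu0 a)
  obtain ⟨c, hc⟩ := hψ (θ (u a), y a)
  refine ⟨c, ?_⟩
  have h1 : ContinuousAt (fun a => (θ (u a), y a)) a :=
    (hθ.comp hu.continuousAt).prodMk hy.continuousAt
  filter_upwards [h1.eventually hc] with b hb
  obtain ⟨m, hma⟩ := hm _ (hu0 a)
  obtain ⟨m', hmb⟩ := hm _ (hu0 b)
  rw [hma, hmb, periodic_int hper, periodic_int hw, periodic_int hw]
  exact hb

end GaussDiagram

namespace GaussDiagram

variable (G : GaussDiagram)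

/-! ### Functions on the ribbon graph -/

theorem strip_seam_height (v : G.Vertex) (y : ℝ) :
    G.strip v 3 y = G.strip (G.after v) (-1) y := by
  have := Quot.sound (RibbonRel.seam (G := G) v (Set.projIcc (-1) 1 (by norm_num) y))
  have h3 : max (-1 : ℝ) 3 = 3 := max_eq_right (by norm_num)
  simp only [strip, Set.projIcc] at this ⊢
  simpa [h3, Ribbon] using this

theorem sgn_eq (h : Fin G.n) : G.sgn h = 1 ∨ G.sgn h = -1 := by
  unfold sgn
  split_ifs <;> simp

theorem strip_coupon (h : Fin G.n) {x y : ℝ} (hx : x ∈ Set.Icc (-1 : ℝ) 1)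
    (hy : y ∈ Set.Icc (-1 : ℝ) 1) :
    G.strip (G.chordEnd h true) x y =
      G.strip (G.chordEnd h false) (G.sgn h * y) (-(G.sgn h * x)) := by
  obtain ⟨hx1, hx2⟩ := hx
  obtain ⟨hy1, hy2⟩ := hy
  refine Quot.sound (RibbonRel.coupon h _ _ _ _ ?_ ?_) <;> simp only [Set.projIcc] <;>
    rcases G.sgn_eq h with hs | hs <;> rw [hs]
  · rw [max_eq_right, min_eq_right, max_eq_right, min_eq_right] <;> first | linarith | skip
    all_goals rw [min_eq_right] <;> linarith
  · rw [max_eq_right, min_eq_right, max_eq_right, min_eq_right] <;> first | linarith | skip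
    all_goals rw [min_eq_right] <;> linarith
  · rw [max_eq_right, min_eq_right, max_eq_right, min_eq_right] <;> first | linarith | skip
    all_goals rw [min_eq_right] <;> linarith
  · rw [max_eq_right, min_eq_right, max_eq_right, min_eq_right] <;> first | linarith | skip
    all_goals rw [min_eq_right] <;> linarith

/-- The coordinates of a strip. -/
noncomputable def stripMap (v : G.Vertex) : C(ℝ × ℝ, G.Ribbon) where
  toFun p := G.strip v p.1 p.2
  continuous_toFun := continuous_quot_mk.comp <| continuous_sigmaMk.comp <|
    (continuous_projIcc.comp continuous_fst).prodMk (continuous_projIcc.comp continuous_snd)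

@[simp] theorem stripMap_apply (v : G.Vertex) (x y : ℝ) : G.stripMap v (x, y) = G.strip v x y :=
  rfl

theorem mk_eq_strip (v : G.Vertex) (p : Set.Icc (-1 : ℝ) 3 × Set.Icc (-1 : ℝ) 1) :
    (Quot.mk _ ⟨v, p⟩ : G.Ribbon) = G.strip v p.1 p.2 := by
  simp only [strip, Set.projIcc_val]

variable {G} in
@[elab_as_elim]
theorem Ribbon.ind {p : G.Ribbon → Prop}
    (h : ∀ v x y, x ∈ Set.Icc (-1 : ℝ) 3 → y ∈ Set.Icc (-1 : ℝ) 1 → p (G.strip v x y))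
    (r : G.Ribbon) : p r := by
  rcases r with ⟨v, x, y⟩
  have := h v x y x.2 y.2
  rwa [← mk_eq_strip G v (x, y)] at this

section lift

variable {Z : Type*} (g : G.Vertex → ℝ → ℝ → Z)
  (hs : ∀ v, ∀ y ∈ Set.Icc (-1 : ℝ) 1, g v 3 y = g (G.after v) (-1) y)
  (hc : ∀ h, ∀ x ∈ Set.Icc (-1 : ℝ) 1, ∀ y ∈ Set.Icc (-1 : ℝ) 1,
    g (G.chordEnd h true) x y = g (G.chordEnd h false) (G.sgn h * y) (-(G.sgn h * x)))

/-- Functions on the ribbon graph. -/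
def ribbonLift : G.Ribbon → Z :=
  Quot.lift (fun p => g p.1 p.2.1 p.2.2) (by
    rintro _ _ (⟨v, y⟩ | ⟨h, x, x', y, y', hx, hy⟩)
    · exact hs v y y.2
    -- The relation allows x up to 3 a priori, but y' = ±x lies in [-1,1].
    · have : (x : ℝ) ∈ Set.Icc (-1 : ℝ) 1 := by
        have := y'.2
        rw [hy] at this
        rcases G.sgn_eq h with hs | hs <;> rw [hs] at this <;>
          constructor <;> linarith [this.1, this.2]
      simp only [hx, hy]
      exact hc h x this y y.2)

theorem ribbonLift_strip {v : G.Vertex} {x y : ℝ} (hx : x ∈ Set.Icc (-1 : ℝ) 3)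
    (hy : y ∈ Set.Icc (-1 : ℝ) 1) : G.ribbonLift g hs hc (G.strip v x y) = g v x y := by
  simp [ribbonLift, strip, Set.projIcc_of_mem _ hx, Set.projIcc_of_mem _ hy]

variable {g} in
theorem continuousOn_ribbonLift [TopologicalSpace Z] {O : Set G.Ribbon} (hO : IsOpen O)
    (h : ∀ v, ContinuousOn (fun p : ℝ × ℝ => g v p.1 p.2)
      {p | p.1 ∈ Set.Icc (-1 : ℝ) 3 ∧ p.2 ∈ Set.Icc (-1 : ℝ) 1 ∧ G.strip v p.1 p.2 ∈ O}) :
    ContinuousOn (G.ribbonLift g hs hc) O := by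
  have hq : IsQuotientMap (fun p : G.Strips => (Quot.mk _ p : G.Ribbon)) := isQuotientMap_quot_mk
  have hO' := hO.preimage hq.continuous
  refine (hq.continuousOn_isOpen_iff hO).2 ((continuousOn_open_iff hO').2 fun W hW =>
    isOpen_sigma_iff.2 fun v => ?_)
  refine (continuousOn_open_iff (hO'.preimage continuous_sigmaMk)).1 ?_ W hW
  refine (h v).comp (f := fun p : Set.Icc (-1 : ℝ) 3 × Set.Icc (-1 : ℝ) 1 => ((p.1 : ℝ), (p.2 : ℝ)))
    (by fun_prop) fun p hp => ⟨p.1.2, p.2.2, ?_⟩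
  change G.strip v p.1 p.2 ∈ O
  rw [← mk_eq_strip]
  exact hp

theorem isOpen_ribbonLift {g : G.Vertex → ℝ → ℝ → Prop} (hs) (hc)
    (h : ∀ v, IsOpen {p : ℝ × ℝ | g v p.1 p.2}) :
    IsOpen {r | G.ribbonLift g hs hc r} :=
  isOpen_coinduced.2 (isOpen_sigma_iff.2 fun v => (h v).preimage
    (f := fun p : Set.Icc (-1 : ℝ) 3 × Set.Icc (-1 : ℝ) 1 => ((p.1 : ℝ), (p.2 : ℝ))) (by fun_prop))

end lift

theorem abs_coupon {h : Fin G.n} {y : ℝ} (hy : y ∈ Set.Icc (-1 : ℝ) 1) :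
    G.sgn h * y ∈ Set.Icc (-1 : ℝ) 1 := by
  rcases G.sgn_eq h with hs | hs <;> rw [hs] <;> constructor <;> linarith [hy.1, hy.2]

/-- The part with `a < x < b` of the ribbon along an arc, where `1 ≤ a` and `b ≤ 3`. -/
def band (v : G.Vertex) (a b : Set.Icc (1 : ℝ) 3) : Set G.Ribbon :=
  {r | G.ribbonLift (fun v' x _ => v' = v ∧ (a : ℝ) < x ∧ x < b)
    -- Strict inequalities with 1 ≤ a and b ≤ 3 exclude seams and squares, so the conditions at both
    -- ends of an identification are false.
    (fun v' y _ => by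
      have ha := a.2
      have hb := b.2
      simp only [eq_iff_iff]
      constructor <;> rintro ⟨-, h1, h2⟩ <;> linarith [ha.1, hb.2])
    (fun h x hx y hy => by
      have ha := a.2
      have := G.abs_coupon (h := h) hy
      simp only [eq_iff_iff]
      constructor <;> rintro ⟨-, h1, h2⟩ <;> linarith [ha.1, hx.2, this.2]) r}

theorem isOpen_band (v : G.Vertex) (a b : Set.Icc (1 : ℝ) 3) : IsOpen (G.band v a b) := by
  refine G.isOpen_ribbonLift _ _ fun v' => ?_
  by_cases h : v' = v
  · simp only [h, true_and]
    exact (isOpen_lt continuous_const continuous_fst).inter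
      (isOpen_lt continuous_fst continuous_const)
  · simp [h]

theorem mem_band {v v' : G.Vertex} {a b : Set.Icc (1 : ℝ) 3} {x y : ℝ}
    (hx : x ∈ Set.Icc (-1 : ℝ) 3) (hy : y ∈ Set.Icc (-1 : ℝ) 1) :
    G.strip v' x y ∈ G.band v a b ↔ v' = v ∧ (a : ℝ) < x ∧ x < b := by
  rw [band, Set.mem_ofPred_eq, G.ribbonLift_strip _ _ _ hx hy]

/-- The complement of the lines that cut the ribbons across. -/
def uncut : Set G.Ribbon :=
  {r | G.ribbonLift (fun _ x _ => x ≠ 2) (fun v' y _ => by norm_num)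
    (fun h x hx y hy => by
      have := G.abs_coupon (h := h) hy
      simp only [ne_eq, eq_iff_iff]
      constructor <;> intro _ h2 <;> linarith [hx.2, this.2]) r}

theorem isOpen_uncut : IsOpen G.uncut :=
  G.isOpen_ribbonLift _ _ fun _ => isOpen_ne_fun continuous_fst continuous_const

theorem mem_uncut {v : G.Vertex} {x y : ℝ}
    (hx : x ∈ Set.Icc (-1 : ℝ) 3) (hy : y ∈ Set.Icc (-1 : ℝ) 1) :
    G.strip v x y ∈ G.uncut ↔ x ≠ 2 := by
  rw [uncut, Set.mem_ofPred_eq, G.ribbonLift_strip _ _ _ hx hy]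

theorem strip_eq_proj (v : G.Vertex) (x y : ℝ) : G.strip v x y =
    G.strip v (Set.projIcc (-1 : ℝ) 3 (by norm_num) x) (Set.projIcc (-1 : ℝ) 1 (by norm_num) y) := by
  simp only [strip, Set.projIcc_val]
  rfl

/-! ### Local systems on the ribbon graph -/

section LocSys

variable {P : Type*} [Group P] (l : G.Vertex → P)

open Classical in
/-- The function that jumps at the cut of the arc from `v` by the letter of `v`. -/
noncomputable def step : G.Ribbon → P :=
  -- The value returns to 1 at x = 3 to match the next strip. This second jump is harmless: `step`
  -- serves as a germ only at the cuts x = 2.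
  G.ribbonLift (fun v x _ => if 2 ≤ x ∧ x < 3 then l v else 1)
    (fun v y _ => by norm_num)
    (fun h x hx y hy => by
      have := G.abs_coupon (h := h) hy
      rw [if_neg fun h => by linarith [hx.2, h.1], if_neg fun h => by linarith [this.2, h.1]])

theorem step_strip {v : G.Vertex} {x y : ℝ} (hx : x ∈ Set.Icc (-1 : ℝ) 3)
    (hy : y ∈ Set.Icc (-1 : ℝ) 1) :
    G.step l (G.strip v x y) = if 2 ≤ x ∧ x < 3 then l v else 1 := by
  rw [step, G.ribbonLift_strip _ _ _ hx hy]

open Classical in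
/-- The local system on the ribbon graph with prescribed holonomies of the arcs. -/
noncomputable def ribbonSys : LocSys G.Ribbon P where
  -- Trivial away from the cuts; comparison with `step` across a cut produces the transport `l v`.
  germ r := if r ∈ G.uncut then 1 else G.step l
  compat r := by
    by_cases hr : r ∈ G.uncut
    · filter_upwards [G.isOpen_uncut.mem_nhds hr] with z hz
      exact ⟨1, by simp only [hr, hz, if_true, Pi.one_apply, mul_one]; rfl⟩
    · induction r using Ribbon.ind with
      | h v x y hx hy =>
        have hx2 : x = 2 := by rwa [G.mem_uncut hx hy, not_not] at hr
        subst hx2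
        let a1 : Set.Icc (1 : ℝ) 3 := ⟨1, by norm_num⟩
        let a2 : Set.Icc (1 : ℝ) 3 := ⟨2, by norm_num⟩
        let a3 : Set.Icc (1 : ℝ) 3 := ⟨3, by norm_num⟩
        have hband : ∀ (a b : Set.Icc (1 : ℝ) 3) (k : P),
            (∀ x, (a : ℝ) < x → x < b → (if 2 ≤ x ∧ x < 3 then l v else 1) = k) →
            ∀ z ∈ G.band v a b, ∃ c, (1 : G.Ribbon → P) =ᶠ[𝓝 z] fun w => c * G.step l w := by
          intro a b k hk z hz
          refine ⟨k⁻¹, ?_⟩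
          filter_upwards [(G.isOpen_band v a b).mem_nhds hz] with w hw
          induction w using Ribbon.ind with
          | h v' x y hx hy =>
            obtain ⟨rfl, h1, h2⟩ := (G.mem_band hx hy).1 hw
            rw [G.step_strip l hx hy, hk x h1 h2]
            simp
        filter_upwards [(G.isOpen_band v a1 a3).mem_nhds
          ((G.mem_band hx hy).2 ⟨rfl, by norm_num [a1], by norm_num [a3]⟩)] with z hz
        by_cases hz' : z ∈ G.uncut
        · simp only [hr, hz', if_true, if_false]
          induction z using Ribbon.ind with
          | h v' x y hx hy =>
            obtain ⟨rfl, h1, h2⟩ := (G.mem_band hx hy).1 hz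
            rcases lt_or_gt_of_ne ((G.mem_uncut hx hy).1 hz') with h3 | h3
            -- Before the cut `step` is constantly 1, after it constantly `l v'`.
            · exact hband a1 a2 1 (fun x _ h => if_neg fun h' => not_le.2 h h'.1) _
                ((G.mem_band hx hy).2 ⟨rfl, h1, h3⟩)
            · exact hband a2 a3 (l v') (fun x h h' => if_pos ⟨le_of_lt h, h'⟩) _
                ((G.mem_band hx hy).2 ⟨rfl, h3, h2⟩)
        · exact ⟨1, by simp [hr, hz']⟩

open Classical in
-- For x ≥ 3 the strip map is clamped to the seam, where the germ is trivial, so the constant `l v`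
-- remains a section although `step` has returned to 1.
theorem isSection_strip (v : G.Vertex) : (G.ribbonSys l).IsSection (G.stripMap v)
    fun p => if 2 ≤ p.1 then l v else 1 := by
  rintro ⟨x, y⟩
  have hx' := (Set.projIcc (-1 : ℝ) 3 (by norm_num) x).2
  have hy' := (Set.projIcc (-1 : ℝ) 1 (by norm_num) y).2
  have hcut : G.strip v x y ∈ G.uncut ↔ x ≠ 2 := by
    rw [strip_eq_proj, G.mem_uncut hx' hy', not_iff_not]
    simp only [Set.projIcc]
    constructor
    · intro h
      rcases le_total x (-1) with h1 | h1
      · rw [min_eq_right (by linarith), max_eq_left h1] at h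
        norm_num at h
      · rcases le_total x 3 with h2 | h2
        · rwa [min_eq_right h2, max_eq_right h1] at h
        · rw [min_eq_left h2] at h
          norm_num at h
    · rintro rfl
      norm_num
  simp only [stripMap_apply, ribbonSys]
  rcases lt_trichotomy x 2 with h | h | h
  · rw [if_pos (hcut.2 h.ne)]
    refine ⟨1, ?_⟩
    filter_upwards [(isOpen_lt continuous_fst continuous_const).mem_nhds
      (show ((x, y) : ℝ × ℝ).1 < 2 from h)] with p hp
    simp [not_le.2 hp]
  · rw [if_neg (by rw [hcut, h]; simp)]
    refine ⟨1, ?_⟩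
    filter_upwards [(isOpen_lt continuous_fst continuous_const).mem_nhds
      (show ((x, y) : ℝ × ℝ).1 < 3 by simp [h]; norm_num),
      (isOpen_lt continuous_const continuous_fst).mem_nhds
      (show 1 < ((x, y) : ℝ × ℝ).1 by simp [h])] with p hp hp'
    have hp1 : p.1 < 3 := hp
    have hp2 : 1 < p.1 := hp'
    have h4 : G.step l (G.stripMap v p) = if 2 ≤ p.1 ∧ p.1 < 3 then l v else 1 := by
      change G.step l (G.strip v p.1 p.2) = _
      rw [strip_eq_proj, G.step_strip l (Set.projIcc (-1 : ℝ) 3 (by norm_num) p.1).2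
        (Set.projIcc (-1 : ℝ) 1 (by norm_num) p.2).2,
        Set.projIcc_of_mem _ ⟨by linarith, hp1.le⟩]
    rw [h4]
    simp [hp1]
  · rw [if_pos (hcut.2 h.ne')]
    refine ⟨l v, ?_⟩
    filter_upwards [(isOpen_lt continuous_const continuous_fst).mem_nhds
      (show 2 < ((x, y) : ℝ × ℝ).1 from h)] with p hp
    simp [(show 2 < p.1 from hp).le]

open Classical in
theorem ribbonSys_along_strip (v : G.Vertex) (p q : ℝ × ℝ) :
    (G.ribbonSys l).holonomy.along (G.stripMap v) p q =
      (if 2 ≤ p.1 then l v else 1)⁻¹ * if 2 ≤ q.1 then l v else 1 :=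
  (G.isSection_strip l v).along_eq p q

end LocSys

end GaussDiagram

/-! ### Holonomy inside the strips -/

namespace GaussDiagram

variable (G : GaussDiagram) {Q S : Type*} [Group Q] [MulAction Q S] (R : Holonomy G.Ribbon Q)

/-- The holonomy of paths in a strip. -/
noncomputable def stripHol (v : G.Vertex) (p q : ℝ × ℝ) : Q := R.along (G.stripMap v) p q

theorem stripHol_trans (v : G.Vertex) (p q r : ℝ × ℝ) :
    G.stripHol R v p q * G.stripHol R v q r = G.stripHol R v p r := R.along_trans _ _ _ _

theorem stripHol_self (v : G.Vertex) (p : ℝ × ℝ) : G.stripHol R v p p = 1 := R.along_self _ _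

theorem stripHol_symm (v : G.Vertex) (p q : ℝ × ℝ) :
    (G.stripHol R v p q)⁻¹ = G.stripHol R v q p := R.along_symm _ _ _

/-- Two paths with equal images in the ribbon graph have the same holonomy. -/
theorem stripHol_congr {Z : Type*} [TopologicalSpace Z] [SimplyConnectedSpace Z] {v w : G.Vertex}
    (g h : C(Z, ℝ × ℝ)) (hgh : ∀ z, G.stripMap v (g z) = G.stripMap w (h z)) (a b : Z) :
    G.stripHol R v (g a) (g b) = G.stripHol R w (h a) (h b) := by
  rw [stripHol, stripHol, ← R.along_comp, ← R.along_comp]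
  congr 1
  exact ContinuousMap.ext hgh

theorem stripHol_seam (v : G.Vertex) (y z : ℝ) :
    G.stripHol R v (3, y) (3, z) = G.stripHol R (G.after v) (-1, y) (-1, z) :=
  G.stripHol_congr R (⟨fun y => (3, y), by fun_prop⟩ : C(ℝ, ℝ × ℝ)) ⟨fun y => (-1, y), by fun_prop⟩
    (fun y => G.strip_seam_height v y) y z

theorem scale_mem {t : I} {a b x : ℝ} (ha : a ≤ 0) (hb : 0 ≤ b) (hx : x ∈ Set.Icc a b) :
    (1 - t) * x ∈ Set.Icc a b := by
  have h0 := t.2.1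
  have h1 := t.2.2
  constructor <;> nlinarith [hx.1, hx.2]

/-- The gluing of squares is linear, so it carries the straight path to the origin to the straight
path to the origin. -/
theorem stripHol_coupon (h : Fin G.n) {x y : ℝ} (hx : x ∈ Set.Icc (-1 : ℝ) 1)
    (hy : y ∈ Set.Icc (-1 : ℝ) 1) : G.stripHol R (G.chordEnd h true) (x, y) (0, 0) =
      G.stripHol R (G.chordEnd h false) (G.sgn h * y, -(G.sgn h * x)) (0, 0) := by
  have := G.stripHol_congr R (v := G.chordEnd h true) (w := G.chordEnd h false)
    (⟨fun t => ((1 - t) * x, (1 - t) * y), by fun_prop⟩ : C(I, ℝ × ℝ))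
    ⟨fun t => ((1 - t) * (G.sgn h * y), (1 - t) * (-(G.sgn h * x))), by fun_prop⟩ (fun t => by
      have := G.strip_coupon h (scale_mem (t := t) (by norm_num) (by norm_num) hx)
        (scale_mem (t := t) (by norm_num) (by norm_num) hy)
      simp only [ContinuousMap.coe_mk, stripMap_apply, this]
      congr 1 <;> ring) 0 1
  simpa using this

/-- The holonomy of an arc, transported by `ρ`. -/
noncomputable def arcHol (ρ : G.Vertex → Q) (v : G.Vertex) : Q :=
  ρ v * (G.stripHol R v (0, 0) (3, 0) * G.stripHol R (G.after v) (-1, 0) (0, 0)) *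
    (ρ (G.after v))⁻¹

/-! ### The contraction of the ribbon graph, cut across, to the vertices -/

open Classical in
/-- The strip of `v`, preceded by the last part of the previous one. -/
noncomputable def extMap (v : G.Vertex) : C(ℝ × ℝ, G.Ribbon) where
  -- A strip has length 4, so the point x of the strip of `v` sits at x - 4 in the coordinates of
  -- the next one.
  toFun p := if p.1 ≤ -1 then G.stripMap v (p.1 + 4, p.2) else G.stripMap (G.after v) p
  continuous_toFun := by
    refine Continuous.if_le (by fun_prop) (by fun_prop) continuous_fst continuous_const ?_
    rintro ⟨x, y⟩ (rfl : x = -1)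
    norm_num
    exact G.strip_seam_height v y

theorem extMap_of_le (v : G.Vertex) {x : ℝ} (y : ℝ) (hx : x ≤ -1) :
    G.extMap v (x, y) = G.strip v (x + 4) y := if_pos hx

theorem extMap_of_ge (v : G.Vertex) {x : ℝ} (y : ℝ) (hx : -1 ≤ x) :
    G.extMap v (x, y) = G.strip (G.after v) x y := by
  rcases hx.eq_or_lt with rfl | hx
  · rw [G.extMap_of_le v y le_rfl, ← strip_seam_height]
    norm_num
  · exact if_neg (not_le.2 hx)

/-- The straight path from `p` to the origin. -/
def shrink (p : ℝ × ℝ) : C(I, ℝ × ℝ) := ⟨fun t => ((1 - t) * p.1, (1 - t) * p.2), by fun_prop⟩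

theorem continuous_shrink : Continuous shrink :=
  ContinuousMap.continuous_of_continuous_uncurry _ (by
    change Continuous fun p : (ℝ × ℝ) × I =>
      ((1 - (p.2 : ℝ)) * p.1.1, (1 - (p.2 : ℝ)) * p.1.2)
    fun_prop)

@[simp] theorem shrink_zero (p : ℝ × ℝ) : shrink p 0 = p := by simp [shrink]

@[simp] theorem shrink_one (p : ℝ × ℝ) : shrink p 1 = (0, 0) := by simp [shrink]

open Classical in
/-- The paths along which the cut ribbon graph contracts to the vertices. -/
noncomputable def contraction : G.Ribbon → C(I, G.Ribbon) :=
  G.ribbonLift (fun v x y => if x < 2 then (G.stripMap v).comp (shrink (x, y))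
      else (G.extMap v).comp (shrink (x - 4, y)))
    (fun v y hy => by
      ext t
      rw [if_neg (by norm_num), if_pos (by norm_num)]
      have : (-1 : ℝ) ≤ (1 - t) * (3 - 4) := by linarith [t.2.1]
      simp only [ContinuousMap.comp_apply, shrink, ContinuousMap.coe_mk, G.extMap_of_ge v _ this]
      norm_num)
    -- On the squares the contraction is scaling, which commutes with the linear gluing.
    (fun h x hx y hy => by
      ext t
      rw [if_pos (by linarith [hx.2]), if_pos (by linarith [(G.abs_coupon (h := h) hy).2])]
      have := G.strip_coupon h (scale_mem (t := t) (by norm_num) (by norm_num) hx)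
        (scale_mem (t := t) (by norm_num) (by norm_num) hy)
      simp only [ContinuousMap.comp_apply, shrink, ContinuousMap.coe_mk, stripMap_apply, this]
      congr 1 <;> ring)

open Classical in
theorem contraction_strip {v : G.Vertex} {x y : ℝ} (hx : x ∈ Set.Icc (-1 : ℝ) 3)
    (hy : y ∈ Set.Icc (-1 : ℝ) 1) : G.contraction (G.strip v x y) =
      if x < 2 then (G.stripMap v).comp (shrink (x, y))
      else (G.extMap v).comp (shrink (x - 4, y)) := by
  rw [contraction, G.ribbonLift_strip _ _ _ hx hy]

theorem contraction_zero (r : G.Ribbon) : G.contraction r 0 = r := by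
  induction r using Ribbon.ind with
  | h v x y hx hy =>
    rw [G.contraction_strip hx hy]
    split_ifs
    · simp
    · simp only [ContinuousMap.comp_apply, shrink_zero]
      rw [G.extMap_of_le v y (by linarith [hx.2])]
      norm_num

theorem continuousOn_contraction : ContinuousOn G.contraction G.uncut := by
  refine G.continuousOn_ribbonLift _ _ G.isOpen_uncut fun v => ?_
  rintro ⟨x, y⟩ ⟨hx, hy, hxy⟩
  refine ContinuousAt.continuousWithinAt ?_
  rcases lt_or_gt_of_ne ((G.mem_uncut hx hy).1 hxy) with h | h
  · have hc : Continuous fun p : ℝ × ℝ => (G.stripMap v).comp (shrink p) :=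
      (G.stripMap v).continuous_postcomp.comp continuous_shrink
    refine hc.continuousAt.congr ?_
    filter_upwards [(isOpen_lt continuous_fst continuous_const).mem_nhds
      (show ((x, y) : ℝ × ℝ).1 < 2 from h)] with p hp
    exact (if_pos hp).symm
  · have hc : Continuous fun p : ℝ × ℝ => (G.extMap v).comp (shrink (p.1 - 4, p.2)) :=
      (G.extMap v).continuous_postcomp.comp (continuous_shrink.comp (by fun_prop))
    refine hc.continuousAt.congr ?_
    filter_upwards [(isOpen_lt continuous_const continuous_fst).mem_nhds
      (show 2 < ((x, y) : ℝ × ℝ).1 from h)] with p hp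
    exact (if_neg (not_lt.2 (le_of_lt hp))).symm

theorem contraction_one_strip {v : G.Vertex} {x y : ℝ} (hx : x ∈ Set.Icc (-1 : ℝ) 3)
    (hy : y ∈ Set.Icc (-1 : ℝ) 1) : G.contraction (G.strip v x y) 1 =
      if x < 2 then G.strip v 0 0 else G.strip (G.after v) 0 0 := by
  rw [G.contraction_strip hx hy]
  split_ifs
  · simp
  · simp [G.extMap_of_ge v 0 (by norm_num : (-1 : ℝ) ≤ 0)]

/-- Off the cuts the end of the contraction is locally constant, so a short path contracts to a
constant one. -/
theorem isOpen_contraction_one (c : G.Ribbon) :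
    IsOpen (G.uncut ∩ {r | G.contraction r 1 = c}) := by
  refine isOpen_coinduced.2 (isOpen_sigma_iff.2 fun v => ?_)
  have h2 : IsOpen {p : ℝ × ℝ | (p.1 < 2 ∧ G.strip v 0 0 = c) ∨
      (2 < p.1 ∧ G.strip (G.after v) 0 0 = c)} :=
    ((isOpen_lt continuous_fst continuous_const).and isOpen_const).union
      ((isOpen_lt continuous_const continuous_fst).and isOpen_const)
  convert! h2.preimage (f := fun p : Set.Icc (-1 : ℝ) 3 × Set.Icc (-1 : ℝ) 1 =>
    ((p.1 : ℝ), (p.2 : ℝ))) (by fun_prop) using 1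
  ext p
  have key : ∀ r, r = G.strip v p.1 p.2 → (r ∈ G.uncut ∧ G.contraction r 1 = c ↔
      ((p.1 : ℝ) < 2 ∧ G.strip v 0 0 = c) ∨ (2 < (p.1 : ℝ) ∧ G.strip (G.after v) 0 0 = c)) := by
    rintro _ rfl
    rw [G.mem_uncut p.1.2 p.2.2, G.contraction_one_strip p.1.2 p.2.2]
    split_ifs with h
    · simp [h, h.ne, h.le]
    · simp [h, lt_iff_le_and_ne, not_lt.1 h, eq_comm]
  exact key _ (G.mk_eq_strip v p)

/-! ### Flat functions on the ribbon graph -/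

/-- A point fixed by the holonomies of the arcs spreads to a flat function. -/
theorem exists_flat_ribbon (ρ : G.Vertex → Q)
    (hρ : ∀ h, ρ (G.chordEnd h true) = ρ (G.chordEnd h false)) (s : S)
    (hs : ∀ v, G.arcHol R ρ v • s = s) :
    ∃ N : G.Ribbon → S, R.Flat N ∧ ∀ v, N (G.strip v 0 0) = (ρ v)⁻¹ • s := by
  -- The value (ρ v)⁻¹ • s at the marked point, transported within the strip.
  let N : G.Ribbon → S := G.ribbonLift
    (fun v x y => (G.stripHol R v (x, y) (0, 0) * (ρ v)⁻¹) • s)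
    (fun v y hy => by
      -- Invariance of s under the arc makes the values coming from the two marked points agree on
      -- the seam.
      have h1 : (ρ (G.after v))⁻¹ • s = ((ρ (G.after v))⁻¹ * (G.arcHol R ρ v)⁻¹) • s := by
        rw [mul_smul, inv_smul_eq_iff.2 (hs v).symm]
      rw [mul_smul _ (ρ (G.after v))⁻¹, h1, ← mul_smul, arcHol, ← G.stripHol_trans R v _ (3, 0),
        G.stripHol_seam, (G.stripHol_trans R (G.after v) (-1, y) (-1, 0) (0, 0)).symm,
        ← G.stripHol_symm R v (0, 0)]
      congr 1
      group)
    (fun h x hx y hy => by rw [G.stripHol_coupon R h hx hy, hρ])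
  have hN : ∀ v x y, x ∈ Set.Icc (-1 : ℝ) 3 → y ∈ Set.Icc (-1 : ℝ) 1 →
      N (G.strip v x y) = (G.stripHol R v (x, y) (0, 0) * (ρ v)⁻¹) • s :=
    fun v x y hx hy => G.ribbonLift_strip _ _ _ hx hy
  have hstrip : ∀ v x y x' y', x ∈ Set.Icc (-1 : ℝ) 3 → y ∈ Set.Icc (-1 : ℝ) 1 →
      x' ∈ Set.Icc (-1 : ℝ) 3 → y' ∈ Set.Icc (-1 : ℝ) 1 →
      N (G.strip v x y) = G.stripHol R v (x, y) (x', y') • N (G.strip v x' y') := by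
    intro v x y x' y' hx hy hx' hy'
    rw [hN v x y hx hy, hN v x' y' hx' hy', ← mul_smul, ← mul_assoc, G.stripHol_trans]
  refine ⟨N, R.flat_of_local fun r => ?_, fun v => ?_⟩
  -- Off the cuts the contraction reduces to a constant path; near a cut a path stays in a band of
  -- one strip, where its coordinates can be read off by `pos`.
  · by_cases hr : r ∈ G.uncut
    · refine ⟨_, (G.isOpen_contraction_one (G.contraction r 1)).mem_nhds ⟨hr, rfl⟩, fun γ hγ => ?_⟩
      refine R.flat_of_homotopy G.continuousOn_contraction G.contraction_zero ?_ γ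
        (fun t => (hγ t).1) fun γ₁ hγ₁ => ?_
      · intro r hr
        induction r using Ribbon.ind with
        | h v x y hx hy =>
          rw [G.contraction_one_strip hx hy, G.contraction_strip hx hy]
          have h0 : (0 : ℝ) ∈ Set.Icc (-1 : ℝ) 3 := by norm_num
          have h0' : (0 : ℝ) ∈ Set.Icc (-1 : ℝ) 1 := by norm_num
          split_ifs with h
          · rw [R.along_comp, shrink_zero, shrink_one]
            exact hstrip v x y 0 0 hx hy h0 h0'
          -- The contracting path crosses a seam. Its holonomy is computed through the seam point
          -- (-1, y), with one factor in each strip.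
          · rw [R.along_comp, shrink_zero, shrink_one, ← R.along_trans _ _ (-1, y)]
            have e1 : R.along (G.extMap v) (x - 4, y) (-1, y) =
                G.stripHol R v (x, y) (3, y) := by
              let j : C(ℝ, ℝ × ℝ) := ⟨fun u => (min u (-1), y), by fun_prop⟩
              let j' : C(ℝ, ℝ × ℝ) := ⟨fun u => (min u (-1) + 4, y), by fun_prop⟩
              have hj : (G.extMap v).comp j = (G.stripMap v).comp j' :=
                ContinuousMap.ext fun u => G.extMap_of_le v y (min_le_right _ _)
              have h1 := R.along_comp (G.extMap v) j (x - 4) (-1)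
              rw [hj, R.along_comp] at h1
              simp only [j, j', ContinuousMap.coe_mk, min_self,
                min_eq_left (by linarith [hx.2] : x - 4 ≤ -1)] at h1
              rw [← h1, stripHol]
              norm_num
            have e2 : R.along (G.extMap v) (-1, y) (0, 0) =
                G.stripHol R (G.after v) (-1, y) (0, 0) := by
              let j : C(I, ℝ × ℝ) := shrink (-1, y)
              have hj : (G.extMap v).comp j = (G.stripMap (G.after v)).comp j :=
                ContinuousMap.ext fun t => G.extMap_of_ge v _ (by
                  simp only; linarith [t.2.1])
              have h1 := R.along_comp (G.extMap v) j 0 1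
              rw [hj, R.along_comp] at h1
              simpa [j, stripHol] using h1.symm
            rw [e1, e2, mul_smul, ← hstrip (G.after v) (-1) y 0 0 (by norm_num) hy h0 h0',
              ← strip_seam_height]
            exact hstrip v x y 3 y hx hy (by norm_num) hy
      · have h1 : ∀ t, γ₁ t = G.contraction r 1 := fun t => (hγ₁ t).trans (hγ t).2
        rw [R.along_eq_one_of_const γ₁ fun z w => by rw [h1, h1], one_smul, h1, h1]
    · induction r using Ribbon.ind with
      | h v x y hx hy =>
        have hx2 : x = 2 := by rwa [G.mem_uncut hx hy, not_not] at hr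
        let a : Set.Icc (1 : ℝ) 3 := ⟨1, by norm_num⟩
        let b : Set.Icc (1 : ℝ) 3 := ⟨3, by norm_num⟩
        refine ⟨G.band v a b, (G.isOpen_band v a b).mem_nhds
          ((G.mem_band hx hy).2 ⟨rfl, by norm_num [a, hx2], by norm_num [b, hx2]⟩), fun γ hγ => ?_⟩
        classical
        let pos : G.Ribbon → ℝ × ℝ := G.ribbonLift
          (fun _ x y => if 1 < x ∧ x < 3 then (x, y) else (0, 0))
          (fun v y _ => by norm_num)
          (fun h x hx y hy => by
            have := G.abs_coupon (h := h) hy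
            rw [if_neg fun h => by linarith [hx.2, h.1], if_neg fun h => by linarith [this.2, h.1]])
        have hpos : ContinuousOn pos (G.band v a b) := by
          refine G.continuousOn_ribbonLift _ _ (G.isOpen_band v a b) fun v' => ?_
          refine continuousOn_id.congr ?_
          rintro ⟨x, y⟩ ⟨hx, hy, h⟩
          exact if_pos ((G.mem_band hx hy).1 h).2
        have hback : ∀ r ∈ G.band v a b, G.stripMap v (pos r) = r ∧
            (pos r).1 ∈ Set.Icc (-1 : ℝ) 3 ∧ (pos r).2 ∈ Set.Icc (-1 : ℝ) 1 := by
          intro r hr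
          induction r using Ribbon.ind with
          | h v' x y hx hy =>
            obtain ⟨rfl, h1⟩ := (G.mem_band hx hy).1 hr
            have h2 : pos (G.strip v' x y) = (x, y) := by
              simp only [pos]
              rw [G.ribbonLift_strip _ _ _ hx hy, if_pos h1]
            rw [h2]
            exact ⟨rfl, hx, hy⟩
        let p : C(I, ℝ × ℝ) := ⟨fun t => pos (γ t), hpos.comp_continuous γ.continuous hγ⟩
        have hγp : γ = (G.stripMap v).comp p :=
          ContinuousMap.ext fun t => (hback _ (hγ t)).1.symm
        have h0 := hback _ (hγ 0)
        have h1 := hback _ (hγ 1)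
        have h2 := hstrip v (p 0).1 (p 0).2 (p 1).1 (p 1).2 h0.2.1 h0.2.2 h1.2.1 h1.2.2
        rw [hγp, R.along_comp]
        exact h2
  · rw [hN v 0 0 (by norm_num) (by norm_num), G.stripHol_self, one_mul]

end GaussDiagram

/-! ### Words read along the cycles of a permutation -/

section Words

variable {α Γ : Type*} [Group Γ] (π : Equiv.Perm α) (x : α → Γ)

/-- The word read along the cycle of `π` that starts at `d`. -/
noncomputable def orbitWord (d : α) : Γ :=
  ((List.range (Function.minimalPeriod π d)).map fun i => x ((π ^ i) d)).prod

theorem pow_minimalPeriod_apply (d : α) : (π ^ Function.minimalPeriod π d) d = d := by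
  rw [← Equiv.Perm.iterate_eq_pow]
  exact Function.iterate_minimalPeriod

theorem minimalPeriod_ne_zero [Finite α] (d : α) : Function.minimalPeriod π d ≠ 0 := by
  refine (Function.minimalPeriod_pos_of_mem_periodicPts ?_).ne'
  refine ⟨orderOf π, orderOf_pos π, ?_⟩
  rw [Function.IsPeriodicPt, Equiv.Perm.iterate_eq_pow, pow_orderOf_eq_one]
  rfl

/-- The first letter followed by the shifted word, and the word followed by its first letter, are
both the word of one letter more than a period. -/
theorem orbitWord_apply [Finite α] (d : α) :
    orbitWord π x (π d) = (x d)⁻¹ * orbitWord π x d * x d := by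
  have h := minimalPeriod_ne_zero π d
  have hk : Function.minimalPeriod π (π d) = Function.minimalPeriod π d :=
    Function.minimalPeriod_apply (Function.minimalPeriod_pos_iff_mem_periodicPts.1
      (Nat.pos_of_ne_zero h))
  have h1 := List.prod_range_succ (fun i => x ((π ^ i) d)) (Function.minimalPeriod π d)
  have h2 := List.prod_range_succ' (fun i => x ((π ^ i) d)) (Function.minimalPeriod π d)
  rw [pow_minimalPeriod_apply] at h1
  simp only [pow_zero, Equiv.Perm.one_apply, Nat.succ_eq_add_one] at h1 h2
  rw [orbitWord, orbitWord, hk, mul_assoc, eq_inv_mul_iff_mul_eq, ← h1, h2]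
  simp only [pow_succ, Equiv.Perm.mul_apply]

theorem orbitWord_eq_one_of_sameCycle [Finite α] {d d' : α} (h : π.SameCycle d d')
    (hd : orbitWord π x d = 1) : orbitWord π x d' = 1 := by
  obtain ⟨i, -, rfl⟩ := h.exists_pow_eq'
  clear h
  induction i with
  | zero => exact hd
  | succ i ih =>
    rw [pow_succ', Equiv.Perm.mul_apply, orbitWord_apply, ih]
    simp

end Words

/-! ### Piecewise paths -/

section Walks

variable {B Y Q : Type*} [TopologicalSpace B] [TopologicalSpace Y] [Group Q]

/-- The concatenation of pieces, each taking one unit of time. -/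
noncomputable def walk (p : ℤ → C(ℝ × Y, B)) (h : ∀ i y, p i (1, y) = p (i + 1) (0, y)) :
    C(ℝ × Y, B) where
  toFun q := p ⌊q.1⌋ (Int.fract q.1, q.2)
  continuous_toFun := by
    classical
    rw [continuous_iff_continuousAt]
    rintro ⟨t, y⟩
    obtain ⟨i, hi⟩ : ∃ i, ⌊t⌋ = i := ⟨_, rfl⟩
    -- Around t, with floor i, only the pieces i - 1 and i occur; they are pasted along time i.
    have hF : Continuous fun q : ℝ × Y => if q.1 ≤ i then p (i - 1) (q.1 - (i - 1 : ℤ), q.2)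
        else p i (q.1 - i, q.2) := by
      refine Continuous.if_le (by fun_prop) (by fun_prop) continuous_fst continuous_const ?_
      rintro ⟨s, y⟩ (rfl : s = i)
      have := h (i - 1) y
      simpa using this
    refine hF.continuousAt.congr ?_
    have h1 : (i : ℝ) ≤ t := hi ▸ Int.floor_le t
    have h2 : t < i + 1 := hi ▸ Int.lt_floor_add_one t
    filter_upwards [(isOpen_lt continuous_const continuous_fst).mem_nhds
      (show (i : ℝ) - 1 < ((t, y) : ℝ × Y).1 by simp only; linarith),
      (isOpen_lt continuous_fst continuous_const).mem_nhds
      (show ((t, y) : ℝ × Y).1 < (i : ℝ) + 1 from h2)]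
    rintro ⟨s, z⟩ (h3 : (i : ℝ) - 1 < s) (h4 : s < i + 1)
    rcases lt_trichotomy s i with h5 | h5 | h5
    · have : ⌊s⌋ = i - 1 := Int.floor_eq_iff.2 ⟨by push_cast; linarith, by push_cast; linarith⟩
      simp only [h5.le, if_true, Int.fract, this]
    · have := h (i - 1) z
      subst h5
      simpa using this
    · have : ⌊s⌋ = i := Int.floor_eq_iff.2 ⟨h5.le, h4⟩
      simp only [not_le.2 h5, if_false, Int.fract, this]

variable {p : ℤ → C(ℝ × Y, B)} {h : ∀ i y, p i (1, y) = p (i + 1) (0, y)}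

theorem walk_apply (t : ℝ) (y : Y) : walk p h (t, y) = p ⌊t⌋ (Int.fract t, y) := rfl

theorem walk_add (i : ℤ) (t : I) (y : Y) : walk p h (i + t, y) = p i (t, y) := by
  rw [walk_apply]
  rcases t.2.2.lt_or_eq with ht | ht
  · have : ⌊(i : ℝ) + t⌋ = i := Int.floor_eq_iff.2 ⟨by linarith [t.2.1], by linarith⟩
    simp [Int.fract, this]
  · rw [ht, h]
    simp

/-- The restriction of a walk to a fixed parameter. -/
noncomputable def slice (w : C(ℝ × Y, B)) (y : Y) : C(ℝ, B) := w.comp ⟨fun t => (t, y), by fun_prop⟩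

/-- The factors K between consecutive pieces telescope. -/
theorem along_walk (R : Holonomy B Q) (y : Y) (K g : ℕ → Q) (n : ℕ)
    (hg : ∀ i : ℕ, R.along (slice (p i) y) (0 : ℝ) 1 = K i * g i * (K (i + 1))⁻¹) :
    R.along (slice (walk p h) y) (0 : ℝ) n = K 0 * ((List.range n).map g).prod * (K n)⁻¹ := by
  induction n with
  | zero => simp [R.along_self]
  | succ n ih =>
    have h1 := R.along_comp (slice (walk p h) y) (⟨fun t : I => (n : ℝ) + t, by fun_prop⟩) 0 1
    have h2 := R.along_comp (slice (p n) y) (⟨fun t : I => (t : ℝ), by fun_prop⟩) 0 1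
    have h3 : (slice (walk p h) y).comp ⟨fun t : I => (n : ℝ) + t, by fun_prop⟩ =
        (slice (p n) y).comp ⟨fun t : I => (t : ℝ), by fun_prop⟩ :=
      ContinuousMap.ext fun t => walk_add (h := h) n t y
    rw [h3, h2] at h1
    simp only [ContinuousMap.coe_mk, Set.Icc.coe_zero, Set.Icc.coe_one, add_zero] at h1
    rw [hg] at h1
    rw [← R.along_trans _ _ (n : ℝ), ih, Nat.cast_succ, ← h1, List.prod_range_succ]
    group

end Walks

namespace GaussDiagram

variable (G : GaussDiagram) {Q : Type*} [Group Q] (R : Holonomy G.Ribbon Q)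

/-! ### Sides of arcs -/

/-- The coordinates of a point of a side. -/
noncomputable def sideCoord (d : G.Dart) : C(ℝ, ℝ × ℝ) :=
  if d.2 then ⟨fun t => (G.ribbonStart d.1 + t * (3 - G.ribbonStart d.1), -1), by fun_prop⟩
  else ⟨fun t => (3 - t * (3 - G.ribbonStart d.1), 1), by fun_prop⟩

theorem side_eq (d : G.Dart) (t : ℝ) : G.side d t = G.stripMap d.1 (G.sideCoord d t) := by
  obtain ⟨v, α⟩ := d
  cases α <;> simp [side, sideCoord]

/-- The marked point near the beginning of a side. -/
def startVertex (d : G.Dart) : G.Vertex := if d.2 then d.1 else G.after d.1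

/-- The position of the beginning of a side, relative to the marked point. -/
def startCorner (d : G.Dart) : ℝ × ℝ := if d.2 then (G.ribbonStart d.1, -1) else (-1, 1)

/-- The marked point near the end of a side. -/
def endVertex (d : G.Dart) : G.Vertex := if d.2 then G.after d.1 else d.1

/-- The position of the end of a side, relative to the marked point. -/
def endCorner (d : G.Dart) : ℝ × ℝ := if d.2 then (-1, -1) else (G.ribbonStart d.1, 1)

theorem side_zero (d : G.Dart) :
    G.side d 0 = G.stripMap (G.startVertex d) (G.startCorner d) := by
  obtain ⟨v, α⟩ := d
  cases α <;> simp [side, startVertex, startCorner, strip_seam_height]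

theorem side_one (d : G.Dart) : G.side d 1 = G.stripMap (G.endVertex d) (G.endCorner d) := by
  obtain ⟨v, α⟩ := d
  cases α <;> simp [side, endVertex, endCorner, strip_seam_height]

theorem coupon_shrink (h : Fin G.n) {x y : ℝ} (hx : x ∈ Set.Icc (-1 : ℝ) 1)
    (hy : y ∈ Set.Icc (-1 : ℝ) 1) (t : I) :
    G.stripMap (G.chordEnd h true) (shrink (x, y) t) =
      G.stripMap (G.chordEnd h false) (shrink (G.sgn h * y, -(G.sgn h * x)) t) := by
  have := G.strip_coupon h (scale_mem (t := t) (by norm_num) (by norm_num) hx)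
    (scale_mem (t := t) (by norm_num) (by norm_num) hy)
  simp only [shrink, ContinuousMap.coe_mk, stripMap_apply, this]
  congr 1 <;> ring

/-- A turn passes from one end of a chord q to its other end. -/
theorem exists_turn_chord (τ : Bool) (h : Fin G.n) (α : Bool) :
    ∃ q, (if α then G.next τ h else h) = q ∧
      G.endVertex (⟨τ, Sum.inl h⟩, α) = G.chordEnd q τ ∧
      G.startVertex (G.turn (⟨τ, Sum.inl h⟩, α)) = G.chordEnd q (!τ) := by
  obtain ⟨q, hq⟩ : ∃ q, (if α then G.next τ h else h) = q := ⟨_, rfl⟩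
  refine ⟨q, hq, ?_, ?_⟩
  · subst hq
    cases α <;> rfl
  · change G.startVertex (G.turnFun _) = _
    simp only [turnFun, hq, startVertex]
    cases turnDir τ (G.positive q) α
    · simp [after, succ, chordEnd]
    · rfl

/-- At a chord, the end of a side and the beginning of the next are one corner of the glued square,
seen in the coordinates of the two families. The cases check the right turn rule against the
rotation that glues the squares. -/
theorem stripMap_turn (d : G.Dart) (t : I) :
    G.stripMap (G.endVertex d) (shrink (G.endCorner d) t) =
      G.stripMap (G.startVertex (G.turn d)) (shrink (G.startCorner (G.turn d)) t) := by
  have m1 : (1 : ℝ) ∈ Set.Icc (-1 : ℝ) 1 := by norm_num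
  have m2 : (-1 : ℝ) ∈ Set.Icc (-1 : ℝ) 1 := by norm_num
  obtain ⟨⟨τ, h | b⟩, α⟩ := d
  · obtain ⟨q, hq, e1, e3⟩ := G.exists_turn_chord τ h α
    have e2 : G.endCorner (⟨τ, Sum.inl h⟩, α) = if α then (-1, -1) else (1, 1) := rfl
    have e4 : G.startCorner (G.turn (⟨τ, Sum.inl h⟩, α)) =
        if turnDir τ (G.positive q) α then (1, -1) else (-1, 1) := by
      change G.startCorner (G.turnFun _) = _
      simp only [turnFun, hq, startCorner]
      rfl
    rw [e1, e2, e3, e4]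
    cases τ
    · cases hp : G.positive q <;> cases α
      · have := G.coupon_shrink q (x := 1) (y := -1) m1 m2 t
        simpa [sgn, hp, turnDir] using this.symm
      · have := G.coupon_shrink q (x := -1) (y := 1) m2 m1 t
        simpa [sgn, hp, turnDir] using this.symm
      · have := G.coupon_shrink q (x := -1) (y := 1) m2 m1 t
        simpa [sgn, hp, turnDir] using this.symm
      · have := G.coupon_shrink q (x := 1) (y := -1) m1 m2 t
        simpa [sgn, hp, turnDir] using this.symm
    · cases hp : G.positive q <;> cases α
      · have := G.coupon_shrink q (x := 1) (y := 1) m1 m1 t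
        simpa [sgn, hp, turnDir] using this
      · have := G.coupon_shrink q (x := -1) (y := -1) m2 m2 t
        simpa [sgn, hp, turnDir] using this
      · have := G.coupon_shrink q (x := 1) (y := 1) m1 m1 t
        simpa [sgn, hp, turnDir] using this
      · have := G.coupon_shrink q (x := -1) (y := -1) m2 m2 t
        simpa [sgn, hp, turnDir] using this
  · change _ = G.stripMap (G.startVertex (⟨τ, Sum.inr b⟩, α))
      (shrink (G.startCorner (⟨τ, Sum.inr b⟩, α)) t)
    cases α <;> rfl

theorem side_turn (d : G.Dart) : G.side d 1 = G.side (G.turn d) 0 := by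
  rw [side_one, side_zero]
  simpa using G.stripMap_turn d 0

theorem startVertex_turn {A : Type*} (ρ : G.Vertex → A)
    (hρ : ∀ h, ρ (G.chordEnd h true) = ρ (G.chordEnd h false)) (d : G.Dart) :
    ρ (G.endVertex d) = ρ (G.startVertex (G.turn d)) := by
  have hρ' : ∀ h τ τ', ρ (G.chordEnd h τ) = ρ (G.chordEnd h τ') := by
    intro h τ τ'
    cases τ <;> cases τ' <;> simp [hρ]
  obtain ⟨⟨τ, h | b⟩, α⟩ := d
  · obtain ⟨q, -, e1, e3⟩ := G.exists_turn_chord τ h α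
    rw [e1, e3, hρ' _ τ (!τ)]
  · change _ = ρ (G.startVertex (⟨τ, Sum.inr b⟩, α))
    cases α <;> rfl

section

variable (ρ : G.Vertex → Q)

/-- A side can be pushed to the core: from its first corner to the marked point, along or against
the arc, and out to its last corner. -/
theorem sideHol_eq (d : G.Dart) :
    G.stripHol R d.1 (G.sideCoord d 0) (G.sideCoord d 1) =
      G.stripHol R (G.startVertex d) (G.startCorner d) (0, 0) * (ρ (G.startVertex d))⁻¹ *
        G.arcHol R ρ d.1 ^ (if d.2 then (1 : ℤ) else -1) *
        (G.stripHol R (G.endVertex d) (G.endCorner d) (0, 0) * (ρ (G.endVertex d))⁻¹)⁻¹ := by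
  obtain ⟨v, α⟩ := d
  cases α
  · simp only [sideCoord, startVertex, startCorner, endVertex, endCorner, arcHol]
    simp only [Bool.false_eq_true, if_false, ContinuousMap.coe_mk, zero_mul, sub_zero, one_mul,
      sub_sub_cancel, zpow_neg, zpow_one]
    rw [← G.stripHol_trans R v (3, 1) (3, 0), G.stripHol_seam,
      ← G.stripHol_trans R v (3, 0) (0, 0) (G.ribbonStart v, 1),
      ← G.stripHol_trans R (G.after v) (-1, 1) (-1, 0) (0, 0),
      ← G.stripHol_symm R v (3, 0) (0, 0), ← G.stripHol_symm R v (0, 0) (G.ribbonStart v, 1)]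
    group
  · simp only [sideCoord, startVertex, startCorner, endVertex, endCorner, arcHol]
    simp only [if_true, ContinuousMap.coe_mk, zero_mul, add_zero, one_mul, add_sub_cancel, zpow_one]
    rw [← G.stripHol_trans R v (G.ribbonStart v, -1) (3, 0) (3, -1), G.stripHol_seam,
      ← G.stripHol_trans R v (G.ribbonStart v, -1) (0, 0) (3, 0),
      ← G.stripHol_trans R (G.after v) (-1, -1) (-1, 0) (0, 0),
      ← G.stripHol_symm R (G.after v) (-1, 0) (-1, -1)]
    group

/-- The pieces of the walk along a boundary component of the ribbon graph. -/
noncomputable def boundaryPiece (d : G.Dart) (i : ℤ) : C(ℝ × Unit, G.Ribbon) :=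
  (G.stripMap ((G.turn ^ i) d).1).comp ((G.sideCoord ((G.turn ^ i) d)).comp ContinuousMap.fst)

theorem boundaryPiece_one (d : G.Dart) (i : ℤ) (y : Unit) :
    G.boundaryPiece d i (1, y) = G.boundaryPiece d (i + 1) (0, y) := by
  have := G.side_turn ((G.turn ^ i) d)
  rw [side_eq, side_eq, ← Equiv.Perm.mul_apply, ← zpow_one_add, add_comm] at this
  exact this

/-- The walk along a boundary component of the ribbon graph. -/
noncomputable def boundaryMap (d : G.Dart) : C(ℝ × Unit, G.Ribbon) :=
  walk (G.boundaryPiece d) (G.boundaryPiece_one d)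

theorem boundaryMap_apply (d : G.Dart) (t : ℝ) (y : Unit) :
    G.boundaryMap d (t, y) = G.boundaryWalk d t := by
  rw [boundaryWalk, side_eq]
  rfl

/-- The detours to the marked points cancel at each turn. Since the walk closes up, its holonomy is
the cycle word conjugated by `K d`. -/
theorem along_boundaryMap (hρ : ∀ h, ρ (G.chordEnd h true) = ρ (G.chordEnd h false))
    (d : G.Dart) :
    R.along (slice (G.boundaryMap d) ()) (0 : ℝ) (Function.minimalPeriod G.turn d) = 1 ↔
      orbitWord G.turn (fun d => G.arcHol R ρ d.1 ^ (if d.2 then (1 : ℤ) else -1)) d = 1 := by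
  let K : G.Dart → Q := fun d =>
    G.stripHol R (G.startVertex d) (G.startCorner d) (0, 0) * (ρ (G.startVertex d))⁻¹
  have hK : ∀ d, G.stripHol R (G.endVertex d) (G.endCorner d) (0, 0) * (ρ (G.endVertex d))⁻¹ =
      K (G.turn d) := by
    intro d
    have := G.stripHol_congr R (shrink (G.endCorner d)) (shrink (G.startCorner (G.turn d)))
      (G.stripMap_turn d) 0 1
    simp only [shrink_zero, shrink_one] at this
    rw [this, G.startVertex_turn ρ hρ]
  have key := along_walk (h := G.boundaryPiece_one d) R ()
    (fun i => K ((G.turn ^ i) d))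
    (fun i => G.arcHol R ρ ((G.turn ^ i) d).1 ^ (if ((G.turn ^ i) d).2 then (1 : ℤ) else -1))
    (Function.minimalPeriod G.turn d) (fun i => by
      rw [pow_succ', Equiv.Perm.mul_apply, ← hK, ← sideHol_eq]
      simp only [boundaryPiece, zpow_natCast]
      exact R.along_comp (G.stripMap ((G.turn ^ i) d).1) (G.sideCoord ((G.turn ^ i) d)) 0 1)
  rw [pow_minimalPeriod_apply, pow_zero, Equiv.Perm.one_apply] at key
  rw [boundaryMap, key, orbitWord]
  constructor
  · intro h
    have := mul_inv_eq_one.1 h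
    simpa using this
  · intro h
    rw [h]
    simp

/-- The pieces of the annulus around a circle. -/
noncomputable def annulusPiece {τ : Bool} (s : G.Site τ) (i : ℤ) :
    C(ℝ × Set.Icc (-1 : ℝ) 1, G.Ribbon) :=
  (G.stripMap ⟨τ, (G.succ τ ^ i) s⟩).comp ⟨fun q => (-1 + 4 * q.1, (q.2 : ℝ)), by fun_prop⟩

theorem annulusPiece_one {τ : Bool} (s : G.Site τ) (i : ℤ) (y : Set.Icc (-1 : ℝ) 1) :
    G.annulusPiece s i (1, y) = G.annulusPiece s (i + 1) (0, y) := by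
  have := G.strip_seam_height ⟨τ, (G.succ τ ^ i) s⟩ y
  simp only [annulusPiece, ContinuousMap.comp_apply, ContinuousMap.coe_mk, stripMap_apply]
  norm_num
  rw [this, add_comm, zpow_one_add]
  rfl

/-- The annulus around a circle. -/
noncomputable def annulusMap {τ : Bool} (s : G.Site τ) : C(ℝ × Set.Icc (-1 : ℝ) 1, G.Ribbon) :=
  walk (G.annulusPiece s) (G.annulusPiece_one s)

theorem along_annulusMap {τ : Bool} (s : G.Site τ) :
    R.along (slice (G.annulusMap s) ⟨0, by norm_num⟩) (0 : ℝ)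
        (Function.minimalPeriod (G.succ τ) s) = 1 ↔
      orbitWord (G.succ τ) (fun s => G.arcHol R ρ ⟨τ, s⟩) s = 1 := by
  let K : G.Vertex → Q := fun v => G.stripHol R v (-1, 0) (0, 0) * (ρ v)⁻¹
  have key := along_walk (h := G.annulusPiece_one s) R ⟨0, by norm_num⟩
    (fun i => K ⟨τ, (G.succ τ ^ i) s⟩) (fun i => G.arcHol R ρ ⟨τ, (G.succ τ ^ i) s⟩)
    (Function.minimalPeriod (G.succ τ) s) (fun i => by
      have h1 : R.along (G.stripMap ⟨τ, (G.succ τ ^ i) s⟩) (-1, 0) (3, 0) =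
          K ⟨τ, (G.succ τ ^ i) s⟩ * G.arcHol R ρ ⟨τ, (G.succ τ ^ i) s⟩ *
            (K (G.after ⟨τ, (G.succ τ ^ i) s⟩))⁻¹ := by
        change G.stripHol R _ _ _ = _
        rw [← G.stripHol_trans R _ (-1, 0) (0, 0)]
        simp only [K, arcHol]
        group
      rw [pow_succ', Equiv.Perm.mul_apply]
      simp only [annulusPiece, zpow_natCast]
      refine Eq.trans ?_ h1
      have h2 := R.along_comp (G.stripMap ⟨τ, (G.succ τ ^ i) s⟩)
        (⟨fun t : ℝ => (-1 + 4 * t, 0), by fun_prop⟩) 0 1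
      norm_num at h2
      exact h2)
  simp only [pow_minimalPeriod_apply, pow_zero, Equiv.Perm.one_apply] at key
  rw [annulusMap, key, orbitWord]
  constructor
  · intro h
    have := mul_inv_eq_one.1 h
    simpa using this
  · intro h
    rw [h]
    simp

end

end GaussDiagram

/-! ### Products with an interval -/

instance Set.Icc.contractibleSpace_neg_one_one : ContractibleSpace (Set.Icc (-1 : ℝ) 1) :=
  (convex_Icc (-1 : ℝ) 1).contractibleSpace ⟨0, by simp⟩

instance Set.Icc.locallyPathConnectedSpace_neg_one_one :
    LocallyPathConnectedSpace (Set.Icc (-1 : ℝ) 1) :=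
  (convex_Icc (-1 : ℝ) 1).locallyPathConnectedSpace

/-- The inclusion of a level of a product. -/
def ContinuousMap.atLevel (X : Type*) {J : Type*} [TopologicalSpace X] [TopologicalSpace J]
    (t : J) : C(X, X × J) := ⟨fun x => (x, t), by fun_prop⟩

/-- The pullback of a local system. -/
def LocSys.comap {X Y P : Type*} [TopologicalSpace X] [TopologicalSpace Y] [Group P]
    (L : LocSys Y P) (g : C(X, Y)) : LocSys X P where
  germ x z := L.germ (g x) (g z)
  compat x := (g.continuous.continuousAt.eventually (L.compat (g x))).mono fun _ ⟨c, hc⟩ =>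
    ⟨c, g.continuous.continuousAt.eventually hc⟩

namespace Holonomy

variable {X J Q S : Type*} [TopologicalSpace X] [TopologicalSpace J] [Group Q] [MulAction Q S]

/-- Values are transported vertically from the level t₀. Along a path all comparisons take place in
the image of the simply connected product of `I` and `J`. -/
theorem exists_flat_prod [ContractibleSpace J] (R : Holonomy (X × J) Q) (t₀ : J) {N : X → S}
    (hN : (R.comap (.atLevel X t₀)).Flat N) :
    ∃ N' : X × J → S, R.Flat N' ∧ ∀ x, N' (x, t₀) = N x := by
  let vert : X → C(J, X × J) := fun x => ⟨fun t => (x, t), by fun_prop⟩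
  refine ⟨fun q => R.along (vert q.1) q.2 t₀ • N q.1, fun γ => ?_, fun x => ?_⟩
  · let p : C(I, X) := ⟨fun t => (γ t).1, by fun_prop⟩
    let q : C(I, J) := ⟨fun t => (γ t).2, by fun_prop⟩
    let k : C(I × J, X × J) := ⟨fun a => (p a.1, a.2), by fun_prop⟩
    have h1 : γ = k.comp ⟨fun t => (t, q t), by fun_prop⟩ := rfl
    have h2 : (ContinuousMap.atLevel X t₀).comp p = k.comp ⟨fun t => (t, t₀), by fun_prop⟩ := rfl
    have h3 : ∀ s : I, vert (γ s).1 = k.comp ⟨fun t => (s, t), by fun_prop⟩ := fun s => rfl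
    have h4 := hN p
    rw [R.comap_along, h2, R.along_comp] at h4
    simp only [h3]
    rw [h1, R.along_comp, R.along_comp, R.along_comp]
    simp only [ContinuousMap.coe_mk, ContinuousMap.comp_apply] at h4 ⊢
    change R.along k (0, q 0) (0, t₀) • N (p 0) =
      R.along k (0, q 0) (1, q 1) • R.along k (1, q 1) (1, t₀) • N (p 1)
    rw [h4, ← mul_smul, ← mul_smul, R.along_trans, R.along_trans]
  · simp only [R.along_self, one_smul]

/-- The two loops bound a cylinder, whose vertical segment is the same at both ends, so their
holonomies are conjugate. -/
theorem along_level_eq_one [ContractibleSpace J] (R : Holonomy (X × J) Q) (s t : J) (p : C(ℝ, X))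
    {k : ℝ} (hp : p k = p 0) (h : R.along ((ContinuousMap.atLevel X s).comp p) 0 k = 1) :
    R.along ((ContinuousMap.atLevel X t).comp p) 0 k = 1 := by
  let f : C(ℝ × J, X × J) := ⟨fun a => (p a.1, a.2), by fun_prop⟩
  have hlevel : ∀ u : J, (ContinuousMap.atLevel X u).comp p =
      f.comp ⟨fun a => (a, u), by fun_prop⟩ := fun u => rfl
  have hvert : f.comp ⟨fun u => (k, u), by fun_prop⟩ = f.comp ⟨fun u => (0, u), by fun_prop⟩ := by
    ext u : 1
    exact Prod.ext hp rfl
  have hv := congrArg (fun g : C(J, X × J) => R.along g s t) hvert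
  rw [hlevel, R.along_comp] at h ⊢
  simp only [R.along_comp] at hv
  change R.along f (0, s) (k, s) = 1 at h
  change R.along f (0, t) (k, t) = 1
  change R.along f (k, s) (k, t) = R.along f (0, s) (0, t) at hv
  rw [← R.along_trans f (0, t) (0, s), ← R.along_trans f (0, s) (k, s), h, hv, one_mul,
    R.along_trans, R.along_self]

end Holonomy

namespace GaussDiagram

variable (G : GaussDiagram) {P Q S : Type*} [Group P] [Group Q] [MulAction Q S]

/-! ### The attaching maps -/

theorem boundaryMap_add_period (d : G.Dart) (t : ℝ) (y : Unit) :
    G.boundaryMap d (t + Function.minimalPeriod G.turn d, y) = G.boundaryMap d (t, y) := by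
  simp only [boundaryMap, walk_apply, Int.floor_add_natCast, Int.fract_add_natCast, boundaryPiece,
    zpow_add, Equiv.Perm.mul_apply, zpow_natCast, pow_minimalPeriod_apply]

theorem annulusMap_add_period {τ : Bool} (s : G.Site τ) (t : ℝ) (y : Set.Icc (-1 : ℝ) 1) :
    G.annulusMap s (t + Function.minimalPeriod (G.succ τ) s, y) = G.annulusMap s (t, y) := by
  simp only [annulusMap, walk_apply, Int.floor_add_natCast, Int.fract_add_natCast, annulusPiece,
    zpow_add, Equiv.Perm.mul_apply, zpow_natCast, pow_minimalPeriod_apply]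

/-- The 2-dimensional cells of the surface. -/
noncomputable abbrev discCell : Cell Disc := Cell.ball ℂ

/-- The 2-handles. -/
noncomputable abbrev handleCell : Cell (Disc × Set.Icc (-1 : ℝ) 1) :=
  discCell.prod (Set.Icc (-1 : ℝ) 1)

/-- The 3-dimensional balls. -/
noncomputable abbrev ballCell : Cell Ball3 := Cell.ball (EuclideanSpace ℝ (Fin 3))

theorem isPathConnected_bdry_disc : IsPathConnected discCell.bdry :=
  Cell.isPathConnected_bdry_ball (by
    rw [← Module.finrank_eq_rank, Complex.finrank_real_complex]; norm_num)

theorem isPathConnected_bdry_handle : IsPathConnected handleCell.bdry :=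
  Cell.isPathConnected_bdry_prod isPathConnected_bdry_disc _

theorem isPathConnected_bdry_ballCell : IsPathConnected ballCell.bdry :=
  Cell.isPathConnected_bdry_ball (by
    rw [← Module.finrank_eq_rank, finrank_euclideanSpace_fin]; norm_num)

theorem coe_ne_zero_of_bdry (a : discCell.bdry) : ((a : Disc) : ℂ) ≠ 0 := by
  have : ‖((a : Disc) : ℂ)‖ = 1 := a.2
  intro h
  simp [h] at this

theorem coe_ne_zero_of_bdry_handle (a : handleCell.bdry) : (a.1.1 : ℂ) ≠ 0 :=
  coe_ne_zero_of_bdry ⟨a.1.1, a.2⟩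

theorem cycleAttach_apply (c : G.Cycle) (z : Disc) :
    G.cycleAttach ⟨c, z⟩ = G.boundaryMap (Quotient.out c)
      (angle (Function.minimalPeriod G.turn (Quotient.out c)) z, ()) := by
  rw [boundaryMap_apply]
  rfl

theorem continuousOn_cycleAttach : ContinuousOn G.cycleAttach (discCell.bdrySigma G.Cycle) := by
  refine discCell.continuousOn_bdrySigma fun c => ?_
  rw [continuousOn_iff_continuous_domRestrict]
  have := continuous_periodic (G.boundaryMap_add_period (Quotient.out c))
    (u := fun a : discCell.bdry => ((a : Disc) : ℂ)) (by fun_prop) coe_ne_zero_of_bdry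
    (y := fun _ => ()) (by fun_prop)
  refine this.congr fun a => ?_
  exact (G.cycleAttach_apply c a).symm

/-- The inclusion of the ribbon graph in the surface. -/
noncomputable def surfaceMap : C(G.Ribbon, G.Surface) :=
  ⟨G.ribbonToSurface, Attach.continuous_old _ _⟩

/-- The annulus of a handle, as a map to the ribbon graph. -/
theorem continuous_handle_annulus (c : G.Circles) : Continuous fun a : handleCell.bdry =>
    G.annulusMap (Quotient.out c.2) (angle (Function.minimalPeriod (G.succ c.1) (Quotient.out c.2))
      a.1.1, a.1.2) :=
  continuous_periodic (G.annulusMap_add_period (Quotient.out c.2))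
    (u := fun a : handleCell.bdry => (a.1.1 : ℂ)) (by fun_prop)
    coe_ne_zero_of_bdry_handle (y := fun a => a.1.2) (by fun_prop)

theorem continuousOn_handleAttach :
    ContinuousOn G.handleAttach (handleCell.bdrySigma G.Circles) := by
  refine handleCell.continuousOn_bdrySigma fun c => ?_
  rw [continuousOn_iff_continuous_domRestrict]
  exact (G.surfaceMap.continuous.comp (G.continuous_handle_annulus c)).prodMk
    (continuous_const (y := level c.1))

/-- The inclusion of the collar in the body. -/
noncomputable def bodyMap : C(G.Surface × Set.Icc (-1 : ℝ) 1, G.Body) :=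
  ⟨G.collarToBody, Attach.continuous_old _ _⟩

/-- The inclusion of the body in the manifold. -/
noncomputable def manifoldMap : C(G.Body, G.Manifold) :=
  ⟨Attach.old _ _, Attach.continuous_old _ _⟩

/-- The attaching map of a ball. -/
noncomputable def ballMap (K : G.SphericalComponent) : C(Sphere2, G.Body) :=
  ⟨fun z => (K.2.2.some z : K.1), by fun_prop⟩

theorem ballAttach_apply (K : G.SphericalComponent) (a : ballCell.bdry) :
    G.ballAttach ⟨K, a⟩ = G.ballMap K (Cell.bdryToSphere a) := by
  have h : ‖((a : Ball3) : EuclideanSpace ℝ (Fin 3))‖ = 1 := a.2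
  rw [ballAttach, dif_pos h]
  rfl

theorem continuousOn_ballAttach :
    ContinuousOn G.ballAttach (ballCell.bdrySigma G.SphericalComponent) := by
  refine ballCell.continuousOn_bdrySigma fun K => ?_
  rw [continuousOn_iff_continuous_domRestrict]
  refine ((G.ballMap K).comp Cell.bdryToSphere).continuous.congr fun a => ?_
  exact (G.ballAttach_apply K a).symm

/-- The ribbon graph in the manifold. -/
noncomputable def coreMap : C(G.Ribbon, G.Manifold) :=
  ⟨G.ribbonToManifold, G.continuous_ribbonToManifold⟩

/-! ### Flat functions on the manifold -/

/-- Discs, handles and balls all have path connected boundary, so no stage creates new generators.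
-/
theorem exists_flat_manifold (R : Holonomy G.Manifold Q) {N : G.Ribbon → S}
    (hN : (R.comap G.coreMap).Flat N) :
    ∃ N' : G.Manifold → S, R.Flat N' ∧ ∀ r, N' (G.coreMap r) = N r := by
  let R₁ : Holonomy G.Body Q := R.comap G.manifoldMap
  let R₂ : Holonomy (G.Surface × Set.Icc (-1 : ℝ) 1) Q := R₁.comap G.bodyMap
  let R₃ : Holonomy G.Surface Q := R₂.comap (.atLevel _ ⟨0, by norm_num⟩)
  obtain ⟨N₁, hN₁, h₁⟩ := discCell.exists_flat_extension (f := G.cycleAttach)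
    isPathConnected_bdry_disc G.continuousOn_cycleAttach R₃ hN
  obtain ⟨N₂, hN₂, h₂⟩ := R₂.exists_flat_prod ⟨0, by norm_num⟩ hN₁
  obtain ⟨N₃, hN₃, h₃⟩ := handleCell.exists_flat_extension (f := G.handleAttach)
    isPathConnected_bdry_handle G.continuousOn_handleAttach R₁ hN₂
  obtain ⟨N₄, hN₄, h₄⟩ := ballCell.exists_flat_extension (f := G.ballAttach)
    isPathConnected_bdry_ballCell G.continuousOn_ballAttach R hN₃
  exact ⟨N₄, hN₄, fun r => (h₄ _).trans ((h₃ _).trans ((h₂ _).trans (h₁ r)))⟩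

/-! ### Local systems on the manifold -/

theorem arcHol_ribbonSys (l : G.Vertex → P) (v : G.Vertex) :
    G.arcHol (G.ribbonSys l).holonomy 1 v = l v := by
  rw [arcHol, stripHol, stripHol, ribbonSys_along_strip, ribbonSys_along_strip]
  norm_num

/-- Discs require the cycle words to vanish, handles the circle words, balls nothing. Recording what
happens to sections over arbitrary maps to the ribbon graph lets each stage supply the
trivializations needed by later ones. -/
theorem exists_locSys_manifold (l : G.Vertex → P)
    (hcycle : ∀ d, orbitWord G.turn (fun d => l d.1 ^ (if d.2 then (1 : ℤ) else -1)) d = 1)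
    (hcircle : ∀ (τ : Bool) (s : G.Site τ), orbitWord (G.succ τ) (fun s => l ⟨τ, s⟩) s = 1) :
    ∃ L : LocSys G.Manifold P, ∀ (Z : Type) [TopologicalSpace Z] (g : C(Z, G.Ribbon)) (ψ : Z → P),
      (G.ribbonSys l).IsSection g ψ → L.IsSection (G.coreMap.comp g) ψ := by
  obtain ⟨L₁, h₁⟩ := discCell.exists_locSys_extension (f := G.cycleAttach)
    G.continuousOn_cycleAttach (G.ribbonSys l) (by
      intro c
      have h := (G.along_boundaryMap (G.ribbonSys l).holonomy 1 (fun _ => rfl)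
        (Quotient.out c)).2 (by
          simp only [arcHol_ribbonSys]
          exact hcycle _)
      obtain ⟨ψ, hψ⟩ := exists_section_periodic (G.ribbonSys l)
        (G.boundaryMap_add_period (Quotient.out c))
        (u := fun a : discCell.bdry => ((a : Disc) : ℂ)) (by fun_prop) coe_ne_zero_of_bdry
        (y := fun _ => ()) (by fun_prop) () h
      refine ⟨ψ, ?_⟩
      simp only [cycleAttach_apply]
      exact hψ)
  obtain ⟨L₂, h₂⟩ := handleCell.exists_locSys_extension (f := G.handleAttach)
    -- On the collar the system is pulled back from the surface, so the level of a handle plays no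
    -- role.
    G.continuousOn_handleAttach (LocSys.comap (Y := G.Surface) L₁ ContinuousMap.fst) (by
      intro c
      have h := (G.along_annulusMap (G.ribbonSys l).holonomy 1 (Quotient.out c.2)).2 (by
        simp only [arcHol_ribbonSys]
        exact hcircle _ _)
      obtain ⟨ψ, hψ⟩ := exists_section_periodic (G.ribbonSys l)
        (G.annulusMap_add_period (Quotient.out c.2))
        (u := fun a : handleCell.bdry => (a.1.1 : ℂ)) (by fun_prop)
        coe_ne_zero_of_bdry_handle (y := fun a => a.1.2) (by fun_prop) _ h
      exact ⟨ψ, h₁ handleCell.bdry ⟨_, G.continuous_handle_annulus c⟩ ψ hψ⟩)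
  obtain ⟨L₃, h₃⟩ := ballCell.exists_locSys_extension (f := G.ballAttach)
    G.continuousOn_ballAttach (X := G.Body) L₂ (by
      intro K
      obtain ⟨ψ, hψ⟩ := LocSys.exists_section_sphere (L := L₂) (G.ballMap K)
      refine ⟨ψ ∘ Cell.bdryToSphere, ?_⟩
      simp only [ballAttach_apply]
      exact hψ.comp Cell.bdryToSphere.continuous)
  refine ⟨L₃, fun Z _ g ψ hψ => ?_⟩
  have e₁ := h₁ Z g ψ hψ
  have e₂ := h₂ Z ((ContinuousMap.atLevel G.Surface (⟨0, by norm_num⟩ : Set.Icc (-1 : ℝ) 1)).comp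
    (G.surfaceMap.comp g)) ψ e₁
  exact h₃ Z (G.bodyMap.comp ((ContinuousMap.atLevel G.Surface
    (⟨0, by norm_num⟩ : Set.Icc (-1 : ℝ) 1)).comp (G.surfaceMap.comp g))) ψ e₂

/-! ### The relators hold in the manifold -/

/-- The loop around the boundary of a disc. -/
noncomputable def circleMap (k : ℕ) : C(ℝ, Disc) where
  toFun t := ⟨Complex.exp ((2 * Real.pi * (t / k) : ℝ) * Complex.I), by
    rw [mem_closedBall_zero_iff, Complex.norm_exp_ofReal_mul_I]⟩
  continuous_toFun := by fun_prop

theorem norm_circleMap (k : ℕ) (t : ℝ) : ‖(circleMap k t : ℂ)‖ = 1 :=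
  Complex.norm_exp_ofReal_mul_I _

theorem circleMap_period {k : ℕ} (hk : k ≠ 0) : circleMap k k = circleMap k 0 := by
  have : (k : ℝ) ≠ 0 := Nat.cast_ne_zero.2 hk
  refine Subtype.ext ?_
  simp [circleMap, div_self this, Complex.exp_two_pi_mul_I, -Complex.ofReal_div]

/-- The boundary walk of a cycle bounds the disc glued to it. -/
theorem cycle_word_eq_one (R : Holonomy G.Manifold Q) (ρ : G.Vertex → Q)
    (hρ : ∀ h, ρ (G.chordEnd h true) = ρ (G.chordEnd h false)) (d : G.Dart) :
    orbitWord G.turn (fun d => G.arcHol (R.comap G.coreMap) ρ d.1 ^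
      (if d.2 then (1 : ℤ) else -1)) d = 1 := by
  -- The disc is attached from the chosen representative of the cycle; another starting place
  -- conjugates the word.
  refine orbitWord_eq_one_of_sameCycle G.turn _ (d := Quotient.out (Quotient.mk
    (Equiv.Perm.SameCycle.setoid G.turn) d)) (Quotient.exact (s := Equiv.Perm.SameCycle.setoid G.turn) (Quotient.out_eq _)) ?_
  generalize (Quotient.mk (Equiv.Perm.SameCycle.setoid G.turn) d) = c
  rw [← along_boundaryMap _ _ ρ hρ]
  have hk := minimalPeriod_ne_zero G.turn (Quotient.out c)
  refine discCell.along_attaching_loop (f := G.cycleAttach) (((R.comap G.manifoldMap).comap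
    G.bodyMap).comap (.atLevel G.Surface ⟨0, by norm_num⟩)) c
    (circleMap (Function.minimalPeriod G.turn (Quotient.out c))) (norm_circleMap _)
    (slice (G.boundaryMap (Quotient.out c)) ()) (fun t => ?_) (circleMap_period hk)
  refine (G.cycleAttach_apply c _).trans ?_
  obtain ⟨m, hm⟩ := exists_angle_exp hk t
  change G.boundaryMap _ (angle _ (Complex.exp _), ()) = _
  rw [hm, periodic_int (G.boundaryMap_add_period _)]
  rfl

theorem circle_word_eq_one (R : Holonomy G.Manifold Q) (ρ : G.Vertex → Q) (τ : Bool)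
    (s : G.Site τ) :
    orbitWord (G.succ τ) (fun s => G.arcHol (R.comap G.coreMap) ρ ⟨τ, s⟩) s = 1 := by
  refine orbitWord_eq_one_of_sameCycle (G.succ τ) _ (d := Quotient.out (Quotient.mk
    (Equiv.Perm.SameCycle.setoid (G.succ τ)) s)) (Quotient.exact (s := Equiv.Perm.SameCycle.setoid (G.succ τ))
      (Quotient.out_eq _)) ?_
  generalize (Quotient.mk (Equiv.Perm.SameCycle.setoid (G.succ τ)) s) = c
  rw [← along_annulusMap]
  have hk := minimalPeriod_ne_zero (G.succ τ) (Quotient.out c)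
  have hper : ∀ t, slice (G.annulusMap (Quotient.out c)) ⟨0, by norm_num⟩
      (t + Function.minimalPeriod (G.succ τ) (Quotient.out c)) =
        slice (G.annulusMap (Quotient.out c)) ⟨0, by norm_num⟩ t :=
    fun t => G.annulusMap_add_period _ _ _
  -- The circle bounds the core disc of its handle at the level of its family and is slid from there
  -- to level 0.
  refine ((R.comap G.manifoldMap).comap G.bodyMap).along_level_eq_one (level τ) ⟨0, by norm_num⟩
    (G.surfaceMap.comp (slice (G.annulusMap (Quotient.out c)) ⟨0, by norm_num⟩)) (by
      have := hper 0
      rw [zero_add] at this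
      simp [this]) ?_
  refine handleCell.along_attaching_loop (f := G.handleAttach) (R.comap G.manifoldMap) ⟨τ, c⟩
    ((circleMap (Function.minimalPeriod (G.succ τ) (Quotient.out c))).prodMk
      (.const ℝ ⟨0, by norm_num⟩)) (norm_circleMap _) _ (fun t => ?_)
    (Prod.ext (circleMap_period hk) rfl)
  obtain ⟨m, hm⟩ := exists_angle_exp hk t
  change (G.surfaceMap (G.annulusMap (Quotient.out c) (angle _ (Complex.exp _), ⟨0, by norm_num⟩)),
    level τ) = _
  rw [hm, periodic_int (G.annulusMap_add_period _)]
  rfl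

end GaussDiagram

/-! ### Holonomies and the fundamental group -/

namespace Holonomy

variable {Y Q : Type*} [TopologicalSpace Y] [Group Q] (R : Holonomy Y Q)

/-- The holonomy of a homotopy class of paths. -/
def classVal {x y : Y} (p : Path.Homotopic.Quotient x y) : Q :=
  Quotient.liftOn p R.val fun _ _ h => R.val_homotopic h

theorem classVal_mk {x y : Y} (p : Path x y) :
    R.classVal (Path.Homotopic.Quotient.mk p) = R.val p := rfl

theorem classVal_refl (x : Y) : R.classVal (Path.Homotopic.Quotient.refl x) = 1 := R.val_refl x

theorem classVal_trans {x y z : Y} (p : Path.Homotopic.Quotient x y)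
    (q : Path.Homotopic.Quotient y z) : R.classVal (p.trans q) = R.classVal p * R.classVal q := by
  induction p using Path.Homotopic.Quotient.ind with | mk p =>
  induction q using Path.Homotopic.Quotient.ind with | mk q =>
  exact R.val_trans p q

theorem classVal_symm {x y : Y} (p : Path.Homotopic.Quotient x y) :
    R.classVal p.symm = (R.classVal p)⁻¹ := by
  rw [eq_inv_iff_mul_eq_one, ← classVal_trans, Path.Homotopic.Quotient.symm_trans, classVal_refl]

/-- The homomorphism of the fundamental group induced by a holonomy. -/
def toHom (x₀ : Y) : (FundamentalGroup Y x₀)ᵐᵒᵖ →* Q where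
  toFun p := R.classVal (FundamentalGroup.toPath p.unop)
  map_one' := R.classVal_refl x₀
  map_mul' p q := R.classVal_trans (FundamentalGroup.toPath p.unop) (FundamentalGroup.toPath q.unop)

/-- There is a holonomy with values in the fundamental group at `x₀` that is the identity on the
loops at `x₀`. -/
theorem exists_fundamentalGroup (x₀ : Y) : ∃ R : Holonomy Y (FundamentalGroup Y x₀)ᵐᵒᵖ,
    ∀ p : Path.Homotopic.Quotient x₀ x₀,
      R.classVal p = MulOpposite.op (FundamentalGroup.fromPath p) := by
  classical
  -- Prefixing the inverse of the chosen loop at x₀ makes the leg to x₀ itself trivial, so loops at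
  -- x₀ keep their class.
  let leg : ∀ {x : Y}, Joined x₀ x → Path.Homotopic.Quotient x₀ x := fun h =>
    (Path.Homotopic.Quotient.mk (Joined.refl x₀).somePath).symm.trans
      (Path.Homotopic.Quotient.mk h.somePath)
  have hleg : leg (Joined.refl x₀) = Path.Homotopic.Quotient.refl x₀ :=
    Path.Homotopic.Quotient.symm_trans _
  let val : ∀ {x y : Y}, Path.Homotopic.Quotient x y → (FundamentalGroup Y x₀)ᵐᵒᵖ :=
    -- The default 1 is used off the path component of x₀; no path leads from there to this
    -- component.
    fun {x y} p => if h : Joined x₀ x ∧ Joined x₀ y then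
      MulOpposite.op (FundamentalGroup.fromPath (((leg h.1).trans p).trans (leg h.2).symm)) else 1
  let R : Holonomy Y (FundamentalGroup Y x₀)ᵐᵒᵖ :=
    { val := fun p => val (Path.Homotopic.Quotient.mk p)
      val_trans := fun {x y z} p q => by
        by_cases h : Joined x₀ x
        · have hy : Joined x₀ y := h.trans ⟨p⟩
          have hz : Joined x₀ z := hy.trans ⟨q⟩
          simp only [val, h, hy, hz, and_self, dite_true]
          rw [← MulOpposite.op_mul, FundamentalGroup.mul_def]
          congr 1
          change _ = Path.Homotopic.Quotient.trans _ _
          simp only [Path.Homotopic.Quotient.mk_trans, Path.Homotopic.Quotient.trans_assoc]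
          rw [← Path.Homotopic.Quotient.trans_assoc (leg hy).symm,
            Path.Homotopic.Quotient.symm_trans, Path.Homotopic.Quotient.refl_trans]
        · have hy : ¬ Joined x₀ y := fun hy => h (hy.trans (Joined.symm ⟨p⟩))
          simp only [val, h, hy, false_and, dite_false, mul_one]
      val_homotopic := fun h => by
        rw [Path.Homotopic.Quotient.eq.2 h] }
  refine ⟨R, fun p => ?_⟩
  induction p using Path.Homotopic.Quotient.ind with | mk p =>
  change val _ = _
  have h := Joined.refl x₀
  simp only [val, h, and_self, dite_true]
  rw [hleg, Path.Homotopic.Quotient.refl_trans]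
  congr 1
  change Path.Homotopic.Quotient.trans _ _ = _
  rw [← Path.Homotopic.Quotient.trans_refl (Path.Homotopic.Quotient.symm _),
    Path.Homotopic.Quotient.symm_trans, Path.Homotopic.Quotient.trans_refl]

end Holonomy

/-! ### Potentials on forests -/

section Graph

variable {V E Q : Type*} [Group Q]

theorem JoinedVia.symm {Γ : Graph V E} {F : Set E} {u v : V} (h : JoinedVia Γ F u v) :
    JoinedVia Γ F v u := by
  induction h with
  | refl => exact .refl
  | tail _ h ih => exact .head (h.imp fun _ h => ⟨h.1, h.2.symm⟩) ih

theorem JoinedVia.mono {Γ : Graph V E} {F F' : Set E} (hF : F ⊆ F') {u v : V}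
    (h : JoinedVia Γ F u v) : JoinedVia Γ F' u v := by
  induction h with
  | refl => exact .refl
  | tail _ h ih => exact ih.tail (h.imp fun _ h => ⟨hF h.1, h.2⟩)

/-- On a graph without circuits every cochain is a coboundary. -/
theorem exists_potential [Finite E] {T : Graph V E}
    (hT : ∀ e u v, T.IsLink e u v → ¬ JoinedVia T {e}ᶜ u v) (src tgt : E → V)
    (hlink : ∀ e ∈ T.edgeSet, T.IsLink e (src e) (tgt e)) (c : E → Q) :
    ∃ g : V → Q, ∀ e ∈ T.edgeSet, g (src e) * c e = g (tgt e) := by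
  classical
  obtain ⟨F, hF⟩ := (Set.toFinite T.edgeSet).exists_finset_coe
  suffices ∀ F : Finset E, (F : Set E) ⊆ T.edgeSet →
      ∃ g : V → Q, ∀ e ∈ F, g (src e) * c e = g (tgt e) by
    obtain ⟨g, hg⟩ := this F hF.le
    exact ⟨g, fun e he => hg e (by rwa [← Finset.mem_coe, hF])⟩
  intro F
  induction F using Finset.induction_on with
  | empty => exact fun _ => ⟨1, by simp⟩
  | insert e F he ih =>
    intro hF
    rw [Finset.coe_insert, Set.insert_subset_iff] at hF
    obtain ⟨g, hg⟩ := ih hF.2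
    have hu : ¬ JoinedVia T F (tgt e) (src e) := fun h =>
      hT e _ _ (hlink e hF.1) ((h.mono fun f hf => by rintro rfl; exact he hf).symm)
    -- Acyclicity keeps `src e` out of the component of `tgt e`. A left translation on that
    -- component preserves the earlier equations, and this constant solves the one for e.
    refine ⟨fun w => if JoinedVia T F (tgt e) w then
      g (src e) * c e * (g (tgt e))⁻¹ * g w else g w, fun f hf => ?_⟩
    rcases Finset.mem_insert.1 hf with rfl | hf
    · have hv : JoinedVia T F (tgt f) (tgt f) := .refl
      simp [hu, hv]
    · have hl := hlink f (hF.2 hf)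
      have : JoinedVia T F (tgt e) (src f) ↔ JoinedVia T F (tgt e) (tgt f) :=
        ⟨fun h => h.tail ⟨f, hf, hl⟩, fun h => h.tail ⟨f, hf, hl.symm⟩⟩
      simp only [this]
      split_ifs
      · rw [mul_assoc, hg f hf]
      · exact hg f hf

end Graph

section Words

variable {α Γ Δ : Type*} [Group Γ] [Group Δ]

theorem map_orbitWord (φ : Γ →* Δ) (π : Equiv.Perm α) (x : α → Γ) (d : α) :
    φ (orbitWord π x d) = orbitWord π (fun d => φ (x d)) d := by
  rw [orbitWord, map_list_prod, List.map_map]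
  rfl

end Words

namespace GaussDiagram

variable (G : GaussDiagram) {P Q : Type*} [Group P] [Group Q]

/-! ### Holonomy along the edges -/

theorem val_arcPath (R : Holonomy G.Manifold Q) (v : G.Vertex) : R.val (G.arcPath v) =
    G.stripHol (R.comap G.coreMap) v (0, 0) (3, 0) *
      G.stripHol (R.comap G.coreMap) (G.after v) (-1, 0) (0, 0) := by
  change (R.comap G.coreMap).val (Path.trans _ (Path.cast _ _ _)) = _
  rw [Holonomy.val_trans, Holonomy.val_cast, Holonomy.val_eq_along, Holonomy.val_eq_along]
  have h1 := (R.comap G.coreMap).along_comp (G.stripMap v)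
    (⟨fun t => (3 * t, 0), by fun_prop⟩ : C(I, ℝ × ℝ)) 0 1
  have h2 := (R.comap G.coreMap).along_comp (G.stripMap (G.after v))
    (⟨fun t => (-1 + t, 0), by fun_prop⟩ : C(I, ℝ × ℝ)) 0 1
  simp only [ContinuousMap.coe_mk, Set.Icc.coe_zero, Set.Icc.coe_one, mul_zero, mul_one,
    add_zero, neg_add_cancel] at h1 h2
  rw [stripHol, stripHol, ← h1, ← h2]
  rfl

theorem arcHol_eq (R : Holonomy G.Manifold Q) (ρ : G.Vertex → Q) (v : G.Vertex) :
    G.arcHol (R.comap G.coreMap) ρ v = ρ v * R.val (G.arcPath v) * (ρ (G.after v))⁻¹ := by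
  rw [val_arcPath, arcHol]

theorem val_chord (R : Holonomy G.Manifold Q) (h : Fin G.n) :
    R.val (G.edgePath (Sum.inr h)) = 1 := by
  have hp : G.point (G.chordEnd h false) = G.point (G.chordEnd h true) :=
    congrArg G.ribbonToManifold (G.strip_chord h).symm
  exact (R.val_cast (Path.refl (G.point (G.chordEnd h true))) rfl hp).trans (R.val_refl _)

/-- A local system on the manifold with prescribed holonomy along the arcs. -/
theorem exists_holonomy (l : G.Vertex → P)
    (hcycle : ∀ d, orbitWord G.turn (fun d => l d.1 ^ (if d.2 then (1 : ℤ) else -1)) d = 1)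
    (hcircle : ∀ (τ : Bool) (s : G.Site τ), orbitWord (G.succ τ) (fun s => l ⟨τ, s⟩) s = 1) :
    ∃ R : Holonomy G.Manifold P, ∀ v, R.val (G.arcPath v) = l v := by
  obtain ⟨L, hL⟩ := G.exists_locSys_manifold l hcycle hcircle
  refine ⟨L.holonomy, fun v => ?_⟩
  rw [val_arcPath, stripHol, stripHol, Holonomy.comap_along, Holonomy.comap_along,
    (hL _ _ _ (G.isSection_strip l v)).along_eq,
    (hL _ _ _ (G.isSection_strip l (G.after v))).along_eq]
  norm_num

/-! ### Trees -/

variable {G} {T : Graph G.Vertex G.Edge}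

theorem isLink_of_mem_edgeSet (hT : T ≤ G.graph) {e : G.Edge} (he : e ∈ T.edgeSet) :
    T.IsLink e (G.src e) (G.tgt e) :=
  (hT.isLink_iff he).2 (Or.inl ⟨rfl, rfl⟩)

/-- The chords in T bring in all chord ends. A circle without chords is a component by itself, so by
connectedness its marked point is the only vertex. -/
theorem mem_vertexSet (hG : G.Connected) (hT : T ≤ G.graph) (hne : T.vertexSet.Nonempty)
    (hchords : ∀ h : Fin G.n, (Sum.inr h : G.Edge) ∈ T.edgeSet) (v : G.Vertex) :
    v ∈ T.vertexSet := by
  have hend : ∀ (τ : Bool) (h : Fin G.n), (⟨τ, Sum.inl h⟩ : G.Vertex) ∈ T.vertexSet := by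
    intro τ h
    have := isLink_of_mem_edgeSet hT (hchords h)
    cases τ
    · exact this.right_mem
    · exact this.left_mem
  obtain ⟨τ, h | b⟩ := v
  · exact hend τ h
  · obtain ⟨w, hw⟩ := hne
    suffices ∀ u, JoinedVia G.graph Set.univ ⟨τ, Sum.inr b⟩ u → u = ⟨τ, Sum.inr b⟩ from
      this w (hG.2 _ _) ▸ hw
    intro u hu
    induction hu with
    | refl => rfl
    | tail _ h ih =>
      subst ih
      obtain ⟨e, -, h⟩ := h
      have hne : ∀ h τ', (⟨τ, Sum.inr b⟩ : G.Vertex) ≠ G.chordEnd h τ' := fun h τ' h1 => by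
        simpa [chordEnd] using congrArg (fun v : G.Vertex => Sum.isLeft v.2) h1
      rcases e with f | f <;> rcases h with ⟨h1, h2⟩ | ⟨h1, h2⟩
      · refine h2.trans ?_
        rw [show f = _ from h1.symm]
        rfl
      · obtain ⟨τ', f | f⟩ := f
        · exact (hne _ _ h1).elim
        · exact h2.trans h1.symm
      · exact (hne _ _ h1).elim
      · exact (hne _ _ h1).elim

theorem joined_point (hG : G.Connected) (u v : G.Vertex) : Joined (G.point u) (G.point v) := by
  have h := hG.2 u v
  induction h with
  | refl => exact .refl _
  | tail _ h ih =>
    obtain ⟨e, -, ⟨rfl, rfl⟩ | ⟨rfl, rfl⟩⟩ := h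
    · exact ih.trans ⟨G.edgePath e⟩
    · exact ih.trans (Joined.symm ⟨G.edgePath e⟩)

/-- A maximal tree of a connected Gauss diagram determines the classes of the paths in it. -/
theorem exists_treeClass (hG : G.Connected) (hT : T ≤ G.graph) (hT' : IsTreeGraph T)
    (v₀ : G.Vertex) :
    ∃ t : ∀ v : G.Vertex, Path.Homotopic.Quotient (G.point v₀) (G.point v),
      t v₀ = Path.Homotopic.Quotient.refl _ ∧ ∀ e ∈ T.edgeSet,
        (t (G.src e)).trans (Path.Homotopic.Quotient.mk (G.edgePath e)) = t (G.tgt e) := by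
  obtain ⟨R, hR⟩ := Holonomy.exists_fundamentalGroup (G.point v₀)
  obtain ⟨g, hg⟩ := exists_potential hT'.acyclic G.src G.tgt
    (fun e he => isLink_of_mem_edgeSet hT he) fun e => R.val (G.edgePath e)
  let s : ∀ v, Path.Homotopic.Quotient (G.point v₀) (G.point v) := fun v =>
    Path.Homotopic.Quotient.mk (joined_point hG v₀ v).somePath
  -- Any class from v₀ to v, corrected by a loop at v₀ so that its holonomy is the difference of the
  -- potential.
  let t : ∀ v, Path.Homotopic.Quotient (G.point v₀) (G.point v) := fun v =>
    Path.Homotopic.Quotient.trans (FundamentalGroup.toPath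
      ((g v₀)⁻¹ * g v * (R.classVal (s v))⁻¹).unop) (s v)
  have ht : ∀ v, R.classVal (t v) = (g v₀)⁻¹ * g v := fun v => by
    rw [R.classVal_trans, hR]
    exact inv_mul_cancel_right _ _
  -- As R is faithful on loops at the base point, it distinguishes the classes from there to a given
  -- point.
  have hinj : ∀ (v : G.Vertex) (p q : Path.Homotopic.Quotient (G.point v₀) (G.point v)),
      R.classVal p = R.classVal q → p = q := by
    intro v p q h
    have h1 : R.classVal (p.trans q.symm) = 1 := by
      rw [R.classVal_trans, R.classVal_symm, h, mul_inv_cancel]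
    rw [hR] at h1
    have h2 : p.trans q.symm = Path.Homotopic.Quotient.refl _ := MulOpposite.op_injective h1
    rw [← Path.Homotopic.Quotient.trans_refl p, ← Path.Homotopic.Quotient.symm_trans q,
      ← Path.Homotopic.Quotient.trans_assoc, h2, Path.Homotopic.Quotient.refl_trans]
  refine ⟨t, hinj _ _ _ ?_, fun e he => hinj _ _ _ ?_⟩
  · rw [ht, R.classVal_refl, inv_mul_cancel]
  · rw [R.classVal_trans, ht, ht, R.classVal_mk, ← hg e he, mul_assoc]

/-- A holonomy that is trivial on the edges of a spanning tree is trivial on the classes of the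
paths in the tree. -/
theorem classVal_treeClass (hT : T ≤ G.graph) (hT' : IsTreeGraph T)
    (hspan : ∀ v, v ∈ T.vertexSet) {v₀ : G.Vertex}
    {t : ∀ v : G.Vertex, Path.Homotopic.Quotient (G.point v₀) (G.point v)}
    (h₀ : t v₀ = Path.Homotopic.Quotient.refl _)
    (ht : ∀ e ∈ T.edgeSet,
      (t (G.src e)).trans (Path.Homotopic.Quotient.mk (G.edgePath e)) = t (G.tgt e))
    (R : Holonomy G.Manifold Q) (hR : ∀ e ∈ T.edgeSet, R.val (G.edgePath e) = 1) (v : G.Vertex) :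
    R.classVal (t v) = 1 := by
  have h := hT'.connected v₀ (hspan v₀) v (hspan v)
  have hedge : ∀ e ∈ T.edgeSet, R.classVal (t (G.src e)) = R.classVal (t (G.tgt e)) := by
    intro e he
    rw [← ht e he, R.classVal_trans, R.classVal_mk, hR e he, mul_one]
  induction h with
  | refl => rw [h₀, R.classVal_refl]
  | tail _ h ih =>
    obtain ⟨e, -, h⟩ := h
    rcases h.mono hT with ⟨rfl, rfl⟩ | ⟨rfl, rfl⟩
    · rw [← hedge e h.edge_mem, ih]
    · rw [hedge e h.edge_mem, ih]

/-! ### The presentation of the fundamental group -/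

theorem letter_of_mem {e : G.Edge} (he : e ∈ T.edgeSet) : G.letter T e = 1 := dif_pos he

theorem letter_of_notMem {e : G.Edge} (he : e ∉ T.edgeSet) :
    G.letter T e = FreeGroup.of ⟨e, he⟩ := dif_neg he

variable {a : G.Cycle → G.Dart} {b : ∀ τ, G.Circle τ → G.Site τ}

/-- There is a holonomy with values in the presented group that is the class of the letter along
every edge. -/
theorem exists_holonomy_presentedGroup
    (hchords : ∀ h : Fin G.n, (Sum.inr h : G.Edge) ∈ T.edgeSet)
    (ha : ∀ c, Quotient.mk _ (a c) = c) (hb : ∀ τ c, Quotient.mk _ (b τ c) = c) :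
    ∃ R : Holonomy G.Manifold (PresentedGroup (G.relators T a b)),
      ∀ e, R.val (G.edgePath e) = PresentedGroup.mk _ (G.letter T e) := by
  obtain ⟨R, hR⟩ := G.exists_holonomy
    (fun v => PresentedGroup.mk (G.relators T a b) (G.letter T (Sum.inl v)))
    (fun d => by
      refine orbitWord_eq_one_of_sameCycle _ _ (Quotient.exact
        (s := Equiv.Perm.SameCycle.setoid G.turn) (ha (Quotient.mk _ d))) ?_
      simp only [← map_zpow]
      rw [← map_orbitWord]
      exact PresentedGroup.one_of_mem (Or.inl ⟨_, rfl⟩))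
    (fun τ s => by
      refine orbitWord_eq_one_of_sameCycle _ _ (Quotient.exact
        (s := Equiv.Perm.SameCycle.setoid (G.succ τ)) (hb τ (Quotient.mk _ s))) ?_
      rw [← map_orbitWord]
      exact PresentedGroup.one_of_mem (Or.inr ⟨⟨τ, Quotient.mk _ s⟩, rfl⟩))
  refine ⟨R, ?_⟩
  rintro (v | h)
  · exact hR v
  · rw [val_chord, letter_of_mem (hchords h), map_one]

end GaussDiagram

/-! ### The isomorphism with the presented group -/

namespace GaussDiagram

variable {G : GaussDiagram} {T : Graph G.Vertex G.Edge} {Q : Type*} [Group Q]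
  {a : G.Cycle → G.Dart} {b : ∀ τ, G.Circle τ → G.Site τ}

/-- For an arc in T both sides are 1 by hρ. Thus words in the holonomies of arcs are images of words
in the letters. -/
theorem arcHol_eq_lift (R : Holonomy G.Manifold Q) {ρ : G.Vertex → Q}
    (hρ : ∀ e ∈ T.edgeSet, ρ (G.src e) * R.val (G.edgePath e) = ρ (G.tgt e)) (v : G.Vertex) :
    G.arcHol (R.comap G.coreMap) ρ v = FreeGroup.lift
      (fun e : {e : G.Edge // e ∉ T.edgeSet} =>
        ρ (G.src e) * R.val (G.edgePath e) * (ρ (G.tgt e))⁻¹) (G.letter T (Sum.inl v)) := by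
  rw [arcHol_eq]
  by_cases he : (Sum.inl v : G.Edge) ∈ T.edgeSet
  · rw [letter_of_mem he, map_one, mul_inv_eq_one]
    exact hρ _ he
  · rw [letter_of_notMem he, FreeGroup.lift_apply_of]
    rfl

theorem eq_of_chord (hchords : ∀ h : Fin G.n, (Sum.inr h : G.Edge) ∈ T.edgeSet)
    (R : Holonomy G.Manifold Q) {ρ : G.Vertex → Q}
    (hρ : ∀ e ∈ T.edgeSet, ρ (G.src e) * R.val (G.edgePath e) = ρ (G.tgt e)) (h : Fin G.n) :
    ρ (G.chordEnd h true) = ρ (G.chordEnd h false) := by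
  rw [← show _ = ρ (G.chordEnd h false) from hρ _ (hchords h), val_chord, mul_one]
  rfl

/-- The relators are satisfied by the holonomies of the loops through the tree. -/
theorem lift_relator (hchords : ∀ h : Fin G.n, (Sum.inr h : G.Edge) ∈ T.edgeSet)
    (R : Holonomy G.Manifold Q) {ρ : G.Vertex → Q}
    (hρ : ∀ e ∈ T.edgeSet, ρ (G.src e) * R.val (G.edgePath e) = ρ (G.tgt e)) :
    ∀ r ∈ G.relators T a b, FreeGroup.lift (fun e : {e : G.Edge // e ∉ T.edgeSet} =>
      ρ (G.src e) * R.val (G.edgePath e) * (ρ (G.tgt e))⁻¹) r = 1 := by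
  rintro r (⟨c, rfl⟩ | ⟨c, rfl⟩)
  · rw [← G.cycle_word_eq_one R ρ (eq_of_chord hchords R hρ) (a c)]
    simp only [arcHol_eq_lift R hρ, ← map_zpow]
    exact map_orbitWord (FreeGroup.lift _) G.turn
      (fun d => G.letter T (Sum.inl d.1) ^ (if d.2 then (1 : ℤ) else -1)) (a c)
  · rw [← G.circle_word_eq_one R ρ c.1 (b c.1 c.2)]
    simp only [arcHol_eq_lift R hρ]
    exact map_orbitWord (FreeGroup.lift _) (G.succ c.1)
      (fun s => G.letter T (Sum.inl ⟨c.1, s⟩)) (b c.1 c.2)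

/-- A subgroup that contains the holonomies of the loops through the tree contains the holonomies
of all loops. -/
theorem val_mem (hchords : ∀ h : Fin G.n, (Sum.inr h : G.Edge) ∈ T.edgeSet)
    (R : Holonomy G.Manifold Q) {ρ : G.Vertex → Q}
    (hρ : ∀ e ∈ T.edgeSet, ρ (G.src e) * R.val (G.edgePath e) = ρ (G.tgt e)) (H : Subgroup Q)
    (hH : ∀ v, G.arcHol (R.comap G.coreMap) ρ v ∈ H) {v₀ : G.Vertex} (h₀ : ρ v₀ = 1)
    (p : Path (G.point v₀) (G.point v₀)) : R.val p ∈ H := by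
  -- The base coset is fixed by H, hence by the holonomies of all arcs.
  obtain ⟨N, hN, hv⟩ := G.exists_flat_ribbon (S := Q ⧸ H) (R.comap G.coreMap) ρ
    (eq_of_chord hchords R hρ) (QuotientGroup.mk 1) (fun v => by
      rw [MulAction.Quotient.smul_mk, smul_eq_mul, mul_one, QuotientGroup.eq, mul_one]
      exact H.inv_mem (hH v))
  obtain ⟨N', hN', hr⟩ := G.exists_flat_manifold R hN
  have h1 : N' (G.point v₀) = (QuotientGroup.mk 1 : Q ⧸ H) := by
    refine (hr (G.strip v₀ 0 0)).trans ?_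
    rw [hv, h₀, inv_one, one_smul]
  have h2 := hN' p.toContinuousMap
  rw [← R.val_eq_along] at h2
  simp only [Path.coe_toContinuousMap, Path.source, Path.target, h1] at h2
  rw [MulAction.Quotient.smul_mk, smul_eq_mul, mul_one, QuotientGroup.eq, inv_one, one_mul] at h2
  exact h2

/-- The relators hold in π₁, which gives φ. A holonomy with values in the presented group inverts φ
on the left, and flat functions with values in the cosets of its range show that φ is onto. -/
theorem exists_presentation (hG : G.Connected) (hT : T ≤ G.graph) (hT' : IsTreeGraph T)
    (hchords : ∀ h : Fin G.n, (Sum.inr h : G.Edge) ∈ T.edgeSet)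
    (ha : ∀ c, Quotient.mk _ (a c) = c) (hb : ∀ τ c, Quotient.mk _ (b τ c) = c) {v₀ : G.Vertex}
    {t : ∀ v : G.Vertex, Path.Homotopic.Quotient (G.point v₀) (G.point v)}
    (h₀ : t v₀ = Path.Homotopic.Quotient.refl _)
    (ht : ∀ e ∈ T.edgeSet,
      (t (G.src e)).trans (Path.Homotopic.Quotient.mk (G.edgePath e)) = t (G.tgt e)) :
    ∃ Φ : PresentedGroup (G.relators T a b) ≃* (FundamentalGroup G.Manifold (G.point v₀))ᵐᵒᵖ,
      ∀ e : {e : G.Edge // e ∉ T.edgeSet},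
        Φ (PresentedGroup.of e) = MulOpposite.op (FundamentalGroup.fromPath
          (((t (G.src e)).trans (Path.Homotopic.Quotient.mk (G.edgePath e))).trans
            (t (G.tgt e)).symm)) := by
  obtain ⟨R, hR⟩ := Holonomy.exists_fundamentalGroup (G.point v₀)
  let ρ : G.Vertex → (FundamentalGroup G.Manifold (G.point v₀))ᵐᵒᵖ := fun v => R.classVal (t v)
  have hρ : ∀ e ∈ T.edgeSet, ρ (G.src e) * R.val (G.edgePath e) = ρ (G.tgt e) := fun e he => by
    simp only [ρ, ← ht e he, R.classVal_trans, R.classVal_mk]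
  have h₁ : ρ v₀ = 1 := by simp only [ρ, h₀, R.classVal_refl]
  let φ : PresentedGroup (G.relators T a b) →* (FundamentalGroup G.Manifold (G.point v₀))ᵐᵒᵖ :=
    PresentedGroup.toGroup (lift_relator hchords R hρ)
  have hφ : ∀ e : {e : G.Edge // e ∉ T.edgeSet},
      φ (PresentedGroup.of e) = MulOpposite.op (FundamentalGroup.fromPath
        (((t (G.src e)).trans (Path.Homotopic.Quotient.mk (G.edgePath e))).trans
          (t (G.tgt e)).symm)) := fun e => by
    rw [← hR, R.classVal_trans, R.classVal_trans, R.classVal_symm, R.classVal_mk]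
    exact PresentedGroup.toGroup.of _
  have hinj : Function.Injective φ := by
    obtain ⟨F, hF⟩ := exists_holonomy_presentedGroup (T := T) hchords ha hb
    have hF1 := classVal_treeClass hT hT' (mem_vertexSet hG hT hT'.nonempty hchords) h₀ ht F
      fun e he => by rw [hF, letter_of_mem he, map_one]
    -- F is trivial on the tree, so on the loop of a generator e only the passage of e contributes.
    have : (F.toHom (G.point v₀)).comp φ = MonoidHom.id _ := by
      refine PresentedGroup.ext fun e => ?_
      rw [MonoidHom.comp_apply, hφ]
      change F.classVal (((t (G.src e)).trans _).trans _) = _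
      rw [F.classVal_trans, F.classVal_trans, F.classVal_symm, F.classVal_mk, hF1, hF1, hF,
        letter_of_notMem e.2, one_mul, inv_one, mul_one]
      rfl
    exact Function.LeftInverse.injective (g := F.toHom (G.point v₀)) fun x =>
      DFunLike.congr_fun this x
  have hsurj : Function.Surjective φ := by
    intro q
    have hq : q = R.classVal (FundamentalGroup.toPath q.unop) := (hR _).symm
    obtain ⟨p, hp⟩ := Path.Homotopic.Quotient.mk_surjective (FundamentalGroup.toPath q.unop)
    rw [hq, ← hp, R.classVal_mk]
    refine val_mem hchords R hρ φ.range (fun v => ?_) h₁ p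
    rw [arcHol_eq_lift R hρ]
    exact ⟨PresentedGroup.mk _ (G.letter T (Sum.inl v)), rfl⟩
  exact ⟨MulEquiv.ofBijective φ ⟨hinj, hsurj⟩, hφ⟩

end GaussDiagram

end

theorem mainTheorem12 (G : GaussDiagram) (hG : G.Connected)
    (T : Graph G.Vertex G.Edge) (hT : IsMaximalTree G.graph T)
    (hchords : ∀ h : Fin G.n, (Sum.inr h : G.Edge) ∈ T.edgeSet)
    (a : G.Cycle → G.Dart) (ha : ∀ c, Quotient.mk _ (a c) = c)
    (b : ∀ σ, G.Circle σ → G.Site σ) (hb : ∀ σ c, Quotient.mk _ (b σ c) = c)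
    (v₀ : G.Vertex) :
    -- `p * q` in Mathlib's fundamental group is `q` followed by `p`, so `ᵐᵒᵖ` is the
    -- usual fundamental group, in which `p * q` is `p` followed by `q`
    ∃ (τ : ∀ v : G.Vertex, Path.Homotopic.Quotient (G.point v₀) (G.point v))
      (Φ : PresentedGroup (G.relators T a b) ≃* (FundamentalGroup G.Manifold (G.point v₀))ᵐᵒᵖ),
      -- `τ v` is the class of the path from `v₀` to `v` in the tree `T`
      τ v₀ = Path.Homotopic.Quotient.refl _ ∧
      (∀ e ∈ T.edgeSet,
        (τ (G.src e)).trans (Path.Homotopic.Quotient.mk (G.edgePath e)) = τ (G.tgt e)) ∧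
      -- the generator `e` is the class of the loop through `T`, along `e`, and back through `T`
      ∀ e : {e : G.Edge // e ∉ T.edgeSet},
        Φ (PresentedGroup.of e) = MulOpposite.op (FundamentalGroup.fromPath
          (((τ (G.src e)).trans (Path.Homotopic.Quotient.mk (G.edgePath e))).trans
            (τ (G.tgt e)).symm)) := by
  obtain ⟨t, h₀, ht⟩ := GaussDiagram.exists_treeClass hG hT.prop.1 hT.prop.2 v₀
  obtain ⟨Φ, hΦ⟩ := GaussDiagram.exists_presentation hG hT.prop.1 hT.prop.2 hchords ha hb h₀ ht
  exact ⟨t, Φ, h₀, ht, hΦ⟩
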